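/- Spaces are pointed compactly generated spaces, products are formed in compactly generated spaces, and $[Y,Z]$ is the set of pointed homotopy classes of pointed maps. Let $X$ be path connected with non-degenerate base point $*$ (an NDR pair), and suppose that the reduced diagonal $X\to X\wedge X$ is null homotopic (weak LS-category less than $2$). Let $l,n\ge 1$. $X^{(l)}$ is the $l$-fold smash power of $X$. $J(Z)$ is the James construction, the free topological monoid on $Z$ with the base point as unit, and $J_n(Z)$ is its $n$-th stage, the quotient of $Z^n$ that identifies tuples representing the same word. The product on $[Y,J(X)]$ is induced by that of $J(X)$. For a finite index set $I$ let $K_I$ be the group with generators $x_i$ $(i\in I)$ and relations (1) $[[x_{i_1},\dots,x_{i_k}]=1$ whenever $i_s=i_t$ for some $s<t$, and (2) $[[x_{i_1}^{m_1},\dots,x_{i_k}^{m_k}]=[[x_{i_1},\dots,x_{i_k}]^{m_1\cdots m_k}$ for all integers $m_j$, where $[[a_1,\dots,a_k]=[\cdots[a_1,a_2],\cdots,a_k]$ and $[a,b]=a^{-1}b^{-1}ab$. Let $K_{ln}$ be $K_I$ for $I=\{1,\dots,ln\}$, divided into $n$ consecutive blocks of length $l$. In $[X^{ln},J(X)]$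 let $x_i$ be the class of $X^{ln}\xrightarrow{p_i}X\hookrightarrow J(X)$, and let $K_{ln}(X)$ be the subgroup generated by $x_1,\dots,x_{ln}$. Let $H^{(l)}_n\le K_{ln}$ be the subgroup of all $\alpha$ such that (a) setting any one generator of a block equal to $1$ has the same effect on $\alpha$ as setting all generators of that block equal to $1$, and (b) $D_0\alpha=\dots=D_{n-1}\alpha$, where $D_s:K_{ln}\to K_{l(n-1)}$ sends the generators of the $s$-th block (counted from $0$) to $1$ and renumbers the others in order. Let $q:X^{ln}\to (X^{(l)})^n\to J_n(X^{(l)})$ be the quotient map, and let $H^{(l)}_n(X)\subseteq[J_n(X^{(l)}),J(X)]$ consist of the classes $\beta$ for which $q^*\beta$ lies in $K_{ln}(X)$ and satisfies the analogues of (a) and (b), with "setting $x_i$ equal to $1$" replaced by restriction to the subspace where the $i$-th coordinate is $*$. Then $[X^{ln},J(X)]$ and $[J_n(X^{(l)}),J(X)]$ are groups, and there are homomorphisms $$e_X:K_{ln}\to[X^{ln},J(X)],\quad e_X(x_i)=x_i,\qquad\text{and}\qquad e_X:H^{(l)}_n\to H^{(l)}_n(X)\subseteq[J_n(X^{(l)}),J(X)]$$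 such that $q^*(e_X(h))=e_X(h)$ in $[X^{ln},J(X)]$ for all $h\in H^{(l)}_n$. Moreover, if $h\in H^{(l)}_n$ becomes trivial on setting any single generator $x_i$ equal to $1$, then $q^*(e_X(h))$ is trivial when restricted to any subspace of $X^{ln}$ on which a single coordinate is $*$. -/

import Mathlib

open TopologicalSpace Topology

universe u

/-! ## The combinatorial Cohen group -/

namespace Cohen

/-- The commutator with the convention `[x, y] = x⁻¹ y⁻¹ x y`. -/
def comm {G : Type*} [Group G] (x y : G) : G := x⁻¹ * y⁻¹ * x * y

/-- The left normed iterated commutator `[[a₁, a₂, …, a_k] = [⋯[[a₁, a₂], a₃], ⋯, a_k]`. -/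
def leftComm {G : Type*} [Group G] : List G → G
  | [] => 1
  | a :: as => as.foldl comm a

/-- The defining relators of the Cohen group on generators `x_i`, `i : ι`:
(1) `[[x_{i₁}, …, x_{i_k}]` whenever two of the indices coincide;
(2) `[[x_{i₁}^{n₁}, …, x_{i_k}^{n_k}] = [[x_{i₁}, …, x_{i_k}]^{n₁ ⋯ n_k}` for all integers `n_j`. -/
def relators (ι : Type) : Set (FreeGroup ι) :=
  {r | ∃ L : List ι, ¬ L.Nodup ∧ r = leftComm (L.map FreeGroup.of)} ∪
  {r | ∃ L : List (ι × ℤ), r = leftComm (L.map fun p => FreeGroup.of p.1 ^ p.2) *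
      (leftComm (L.map fun p => FreeGroup.of p.1) ^ (L.map Prod.snd).prod)⁻¹}

/-- The Cohen group on generators indexed by `ι`; `K_n` is `K (Fin n)`, and `K_{ln}` is
`K (Fin n × Fin l)`, where `(s, j)` stands for the `j`-th index of the `s`-th block of length `l`. -/
abbrev K (ι : Type) : Type := PresentedGroup (relators ι)

/-- The generator `x_i`. -/
def K.x {ι : Type} (i : ι) : K ι := PresentedGroup.of i

lemma map_comm {G H : Type*} [Group G] [Group H] (f : G →* H) (x y : G) :
    f (comm x y) = comm (f x) (f y) := by
  simp [comm]

lemma map_leftComm {G H : Type*} [Group G] [Group H] (f : G →* H) (L : List G) :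
    f (leftComm L) = leftComm (L.map f) := by
  cases L with
  | nil => simp [leftComm]
  | cons a as =>
    simp only [leftComm, List.map_cons]
    induction as generalizing a with
    | nil => rfl
    | cons b bs ih => simp only [List.foldl_cons, List.map_cons, ih, map_comm]

lemma foldl_comm_one {G : Type*} [Group G] (L : List G) : L.foldl comm 1 = 1 := by
  induction L with
  | nil => rfl
  | cons b bs ih => simpa [comm] using ih

lemma foldl_comm_of_mem {G : Type*} [Group G] (L : List G) (a : G) (h : (1 : G) ∈ L) :
    L.foldl comm a = 1 := by
  induction L generalizing a with
  | nil => simp at h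
  | cons b bs ih =>
    rcases List.mem_cons.1 h with h | h
    · subst h
      simpa [comm] using foldl_comm_one bs
    · exact ih _ h

lemma leftComm_of_mem {G : Type*} [Group G] (L : List G) (h : (1 : G) ∈ L) :
    leftComm L = 1 := by
  cases L with
  | nil => rfl
  | cons a as =>
    rcases List.mem_cons.1 h with h | h
    · subst h
      exact foldl_comm_one as
    · exact foldl_comm_of_mem as a h

/-- The image of the generator `x_i` under a relabelling `φ`: it is `x_{φ i}`, or `1` if `φ`
deletes the index `i`. -/
def K.relabel {ι κ : Type} (φ : ι → Option κ) (i : ι) : K κ := (φ i).elim 1 K.x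

lemma K.leftComm_eq_one {κ : Type} (L : List κ) (h : ¬ L.Nodup) :
    leftComm (L.map (K.x : κ → K κ)) = 1 := by
  have h1 : PresentedGroup.mk (relators κ) (leftComm (L.map FreeGroup.of)) = 1 :=
    PresentedGroup.one_of_mem (Or.inl ⟨L, h, rfl⟩)
  rw [map_leftComm, List.map_map] at h1
  exact h1

lemma K.leftComm_zpow {κ : Type} (L : List (κ × ℤ)) :
    leftComm (L.map fun p => (K.x p.1 : K κ) ^ p.2) =
      leftComm (L.map fun p => (K.x p.1 : K κ)) ^ (L.map Prod.snd).prod := by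
  have h1 := PresentedGroup.one_of_mem (rels := relators κ) (Or.inr ⟨L, rfl⟩)
  rw [map_mul, map_inv, mul_inv_eq_one, map_zpow, map_leftComm, map_leftComm, List.map_map,
    List.map_map] at h1
  simpa [Function.comp_def, K.x, PresentedGroup.of] using h1

/-- The homomorphism of Cohen groups with `x_i ↦ x_{φ i}`, and `x_i ↦ 1` where `φ` deletes `i`. -/
def K.map {ι κ : Type} (φ : ι → Option κ) : K ι →* K κ :=
  PresentedGroup.toGroup (f := K.relabel φ) <| by
    rintro r (⟨L, hL, rfl⟩ | ⟨L, rfl⟩)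
    · rw [map_leftComm, List.map_map]
      by_cases h : ∃ i ∈ L, φ i = none
      · obtain ⟨i, hi, hn⟩ := h
        exact leftComm_of_mem _ (List.mem_map.2 ⟨i, hi, by simp [K.relabel, hn]⟩)
      · push Not at h
        obtain ⟨M, hM⟩ : ∃ M : List κ, M.map some = L.map φ := by
          refine ⟨L.filterMap φ, ?_⟩
          clear hL
          induction L with
          | nil => rfl
          | cons a as ih =>
            obtain ⟨b, hb⟩ := Option.ne_none_iff_exists'.1 (h a (by simp))
            rw [List.filterMap_cons_some hb, List.map_cons, List.map_cons, hb,
              ih fun i hi => h i (by simp [hi])]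
        have e : L.map (⇑(FreeGroup.lift (K.relabel φ)) ∘ FreeGroup.of) = M.map K.x := by
          have := congrArg (List.map fun o : Option κ => o.elim (1 : K κ) K.x) hM
          rw [List.map_map, List.map_map] at this
          rw [show M.map K.x = _ from this]
          simp [Function.comp_def, K.relabel]
        rw [e]
        refine K.leftComm_eq_one M fun hN => hL ?_
        have : (M.map some).Nodup := hN.map (Option.some_injective _)
        rw [hM] at this
        exact List.Nodup.of_map _ this
    · rw [map_mul, map_inv, mul_inv_eq_one, map_zpow, map_leftComm, map_leftComm, List.map_map,
        List.map_map]
      by_cases h : ∃ p ∈ L, φ p.1 = none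
      · obtain ⟨p, hp, hn⟩ := h
        rw [leftComm_of_mem, leftComm_of_mem, one_zpow]
        · exact List.mem_map.2 ⟨p, hp, by simp [K.relabel, hn]⟩
        · exact List.mem_map.2 ⟨p, hp, by simp [K.relabel, hn]⟩
      · push Not at h
        obtain ⟨M, hM⟩ : ∃ M : List (κ × ℤ),
            M.map (fun p => (some p.1, p.2)) = L.map (fun p => (φ p.1, p.2)) := by
          refine ⟨L.filterMap fun p => (φ p.1).map fun k => (k, p.2), ?_⟩
          induction L with
          | nil => rfl
          | cons a as ih =>
            obtain ⟨b, hb⟩ := Option.ne_none_iff_exists'.1 (h a (by simp))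
            rw [List.filterMap_cons_some (b := (b, a.2)) (by simp [hb]), List.map_cons,
              List.map_cons, hb, ih fun i hi => h i (by simp [hi])]
        have e1 := congrArg (List.map fun o : Option κ × ℤ => (o.1.elim (1 : K κ) K.x) ^ o.2) hM
        have e2 := congrArg (List.map fun o : Option κ × ℤ => (o.1.elim (1 : K κ) K.x)) hM
        have e3 := congrArg (List.map fun o : Option κ × ℤ => o.2) hM
        simp only [List.map_map, Function.comp_def, Option.elim_some] at e1 e2 e3
        simp only [Function.comp_def, map_zpow, FreeGroup.lift_apply_of, K.relabel]
        rw [← e1, ← e2]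
        have e4 : L.map Prod.snd = M.map Prod.snd := e3.symm
        rw [e4]
        exact K.leftComm_zpow M

end Cohen

/-! ## Index bookkeeping -/

/-- Delete the indices in `A`, keep the others. -/
noncomputable def killIdx {ι : Type} (A : Set ι) (i : ι) : Option ι :=
  open Classical in if i ∈ A then none else some i

/-- The `s`-th block of indices. -/
def block {n l : ℕ} (s : Fin n) : Set (Fin n × Fin l) := {p | p.1 = s}

/-- Delete the `s`-th block of indices and close the gap: the blocks before `s` keep their number,
the blocks after `s` move down by one. -/
def deleteBlock {n l : ℕ} (s : Fin n) (p : Fin n × Fin l) : Option (Fin (n - 1) × Fin l) :=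
  if h : p.1 < s then some (⟨(p.1 : ℕ), by omega⟩, p.2)
  else if h' : s < p.1 then some (⟨(p.1 : ℕ) - 1, by omega⟩, p.2)
  else none

namespace Cohen

/-- The combinatorial group `H_n^{(l)}`, a subgroup of `K_{ln}`. An element `α` belongs to it if
* killing one generator of a block has the same effect on `α` as killing the whole block, and
* `D_0 α = ⋯ = D_{n-1} α`, where `D_s : K_{ln} → K_{l(n-1)}` kills the `s`-th block of generators
  and renumbers the remaining ones. -/
def H (l n : ℕ) : Subgroup (K (Fin n × Fin l)) where
  carrier := {α | (∀ s j, K.map (killIdx {(s, j)}) α = K.map (killIdx (block s)) α) ∧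
    ∀ s t, K.map (deleteBlock s) α = K.map (deleteBlock t) α}
  mul_mem' := by
    rintro a b ⟨h1, h2⟩ ⟨h3, h4⟩
    exact ⟨fun s j => by rw [map_mul, map_mul, h1, h3], fun s t => by
      rw [map_mul, map_mul, h2 s t, h4 s t]⟩
  one_mem' := ⟨fun s j => by rw [map_one, map_one], fun s t => by rw [map_one, map_one]⟩
  inv_mem' := by
    rintro a ⟨h1, h2⟩
    exact ⟨fun s j => by rw [map_inv, map_inv, h1], fun s t => by rw [map_inv, map_inv, h2 s t]⟩

end Cohen

/-! ## Pointed compactly generated spaces and homotopy classes of pointed maps -/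

/-- A pointed compactly generated space. -/
structure PtdCG : Type (u + 1) where
  carrier : Type u
  [top : TopologicalSpace carrier]
  [cg : CompactlyGeneratedSpace carrier]
  pt : carrier

namespace PtdCG

instance : CoeSort PtdCG.{u} (Type u) := ⟨PtdCG.carrier⟩

instance (X : PtdCG.{u}) : TopologicalSpace X := X.top

instance (X : PtdCG.{u}) : CompactlyGeneratedSpace X := X.cg

/-- Pointed continuous maps. -/
abbrev PMap (Y Z : PtdCG.{u}) : Type u := {f : C(Y, Z) // f Y.pt = Z.pt}

/-- The constant map to the base point. -/
def PMap.const (Y Z : PtdCG.{u}) : PMap Y Z := ⟨ContinuousMap.const Y Z.pt, rfl⟩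

/-- Pointed homotopy of pointed maps. -/
def PMap.Homotopic {Y Z : PtdCG.{u}} (f g : PMap Y Z) : Prop :=
  ContinuousMap.HomotopicRel f.1 g.1 {Y.pt}

instance homotopySetoid (Y Z : PtdCG.{u}) : Setoid (PMap Y Z) where
  r := PMap.Homotopic
  iseqv := ⟨fun f => ContinuousMap.HomotopicRel.refl f.1, fun h => h.symm, fun h h' => h.trans h'⟩

/-- The set `[Y, Z]` of pointed homotopy classes of pointed maps. -/
abbrev HClass (Y Z : PtdCG.{u}) : Type u := Quotient (homotopySetoid Y Z)

/-- The base point is non-degenerate: `(X, *)` is an NDR pair. -/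
def Nondegenerate (X : PtdCG.{u}) : Prop :=
  ∃ (v : C(X, unitInterval)) (h : C(X × unitInterval, X)),
    (∀ x, v x = 0 ↔ x = X.pt) ∧ (∀ x, h (x, 0) = x) ∧ (∀ t, h (X.pt, t) = X.pt) ∧
      ∀ x, v x < 1 → h (x, 1) = X.pt

/-! ### Products in compactly generated spaces -/

/-- The type of families `ι → X`, to be given the compactly generated product topology. -/
structure KPow (ι : Type) (X : Type u) : Type u where
  coord : ι → X

instance (ι : Type) (X : Type u) : CoeFun (KPow ι X) fun _ => ι → X := ⟨KPow.coord⟩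

/-- The topology of the product `X^ι` in compactly generated spaces: the compactly generated
topology associated with the product topology. -/
instance (ι : Type) (X : Type u) [TopologicalSpace X] : TopologicalSpace (KPow ι X) :=
  TopologicalSpace.coinduced KPow.mk (TopologicalSpace.compactlyGenerated.{u} (ι → X))

section KPow

variable {ι : Type} {X : Type u} [TopologicalSpace X]

lemma continuous_KPow_of_compact {K : Type u} [TopologicalSpace K] [CompactSpace K] [T2Space K]
    {f : K → ι → X} (h : Continuous f) : Continuous fun k => KPow.mk (f k) := by
  refine continuous_def.2 fun U hU => ?_
  have h1 : IsOpen ((fun s : (Σ (i : (S : CompHaus.{u}) × C(S, ι → X)), i.fst) => s.1.2 s.2) ⁻¹'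
      (KPow.mk ⁻¹' U)) := hU
  exact isOpen_sigma_iff.1 h1 ⟨CompHaus.of K, ⟨f, h⟩⟩

lemma continuous_from_KPow {T : Type*} [TopologicalSpace T] {f : KPow ι X → T}
    (h : ∀ (S : Type u) [TopologicalSpace S] [CompactSpace S] [T2Space S] (g : S → ι → X),
      Continuous g → Continuous fun s => f ⟨g s⟩) : Continuous f := by
  refine continuous_coinduced_dom.2 ?_
  exact continuous_from_compactlyGenerated.{u} (X := ι → X) _ fun S g => h S g g.continuous

lemma continuous_coord (i : ι) : Continuous fun v : KPow ι X => v i :=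
  continuous_from_KPow fun _ _ _ _ _ hg => (continuous_apply i).comp hg

lemma continuous_KPow {W : Type u} [TopologicalSpace W] [CompactlyGeneratedSpace W]
    {f : W → KPow ι X} (h : ∀ i, Continuous fun w => f w i) : Continuous f :=
  continuous_from_compactlyGeneratedSpace _ fun _ _ _ _ _ hg =>
    continuous_KPow_of_compact (continuous_pi fun i => (h i).comp hg)

instance : CompactlyGeneratedSpace (KPow ι X) := by
  refine compactlyGeneratedSpace_of_continuous_maps fun f hf => ?_
  refine continuous_from_KPow fun S _ _ _ g hg => ?_
  exact hf S (fun s => ⟨g s⟩) (continuous_KPow_of_compact hg)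

end KPow

/-- The product of a compactly generated space with a compact Hausdorff space is compactly
generated. -/
lemma compactlyGenerated_prod (Y K : Type u) [TopologicalSpace Y] [CompactlyGeneratedSpace Y]
    [TopologicalSpace K] [CompactSpace K] [T2Space K] : CompactlyGeneratedSpace (Y × K) := by
  refine compactlyGeneratedSpace_of_continuous_maps fun {T} _ f hf => ?_
  have h1 : ∀ y, Continuous fun k => f (y, k) := fun y =>
    hf K (fun k => (y, k)) (by fun_prop)
  let F : Y → C(K, T) := fun y => ⟨fun k => f (y, k), h1 y⟩
  have hF : Continuous F := by
    refine continuous_from_compactlyGeneratedSpace _ fun L _ _ _ g hg => ?_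
    refine ContinuousMap.continuous_of_continuous_uncurry _ ?_
    exact hf (L × K) (fun p => (g p.1, p.2)) (by fun_prop)
  exact ContinuousMap.continuous_uncurry_of_continuous ⟨F, hF⟩

/-- The power `X^ι` in pointed compactly generated spaces; `X^n` is `X.pow (Fin n)`. -/
def pow (X : PtdCG.{u}) (ι : Type) : PtdCG.{u} where
  carrier := KPow ι X
  pt := ⟨fun _ => X.pt⟩

/-! ### Topological monoids and the product of homotopy classes -/

/-- A topological monoid in compactly generated spaces, with the unit as base point. -/
class CGMonoid (M : PtdCG.{u}) extends Monoid M.carrier where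
  pt_eq : M.pt = 1
  continuous_mul' : Continuous fun p : KPow (Fin 2) M => p 0 * p 1

section Mul

variable {M : PtdCG.{u}} [CGMonoid M]

lemma CGMonoid.continuous_mul {W : Type u} [TopologicalSpace W] [CompactlyGeneratedSpace W]
    {f g : W → M} (hf : Continuous f) (hg : Continuous g) : Continuous fun w => f w * g w := by
  have : Continuous (fun w => ⟨![f w, g w]⟩ : W → KPow (Fin 2) M) := by
    refine continuous_KPow fun i => ?_
    fin_cases i
    · exact hf
    · exact hg
  exact (CGMonoid.continuous_mul' (M := M)).comp this

/-- The pointwise product of pointed maps into a topological monoid. -/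
def PMap.mul {Y : PtdCG.{u}} (f g : PMap Y M) : PMap Y M :=
  ⟨⟨fun y => f.1 y * g.1 y, CGMonoid.continuous_mul f.1.continuous g.1.continuous⟩, by
    change f.1 Y.pt * g.1 Y.pt = M.pt
    rw [f.2, g.2, CGMonoid.pt_eq, one_mul]⟩

lemma PMap.mul_homotopic {Y : PtdCG.{u}} {f f' g g' : PMap Y M} (hf : PMap.Homotopic f f')
    (hg : PMap.Homotopic g g') : PMap.Homotopic (f.mul g) (f'.mul g') := by
  obtain ⟨F⟩ := hf
  obtain ⟨G⟩ := hg
  have hc : Continuous fun p : unitInterval × Y => F p * G p := by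
    have hI : CompactlyGeneratedSpace (Y × ULift.{u} unitInterval) := compactlyGenerated_prod Y _
    have h1 : Continuous fun p : Y × ULift.{u} unitInterval =>
        F (p.2.down, p.1) * G (p.2.down, p.1) :=
      CGMonoid.continuous_mul (F.continuous.comp (by fun_prop)) (G.continuous.comp (by fun_prop))
    exact h1.comp (g := fun p : Y × ULift.{u} unitInterval => _)
      (f := fun p : unitInterval × Y => (p.2, ULift.up p.1)) (by fun_prop)
  refine ⟨⟨⟨⟨fun p => F p * G p, hc⟩, ?_, ?_⟩, ?_⟩⟩
  · intro y
    change F (0, y) * G (0, y) = f.1 y * g.1 y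
    rw [F.apply_zero, G.apply_zero]
  · intro y
    change F (1, y) * G (1, y) = f'.1 y * g'.1 y
    rw [F.apply_one, G.apply_one]
  · intro t y hy
    change F (t, y) * G (t, y) = f.1 y * g.1 y
    rw [F.eq_fst t hy, G.eq_fst t hy]

/-- The monoid `[Y, M]`, with the multiplication induced by the one of `M`. -/
instance (Y : PtdCG.{u}) : Monoid (HClass Y M) where
  mul := Quotient.map₂ PMap.mul fun _ _ h _ _ h' => PMap.mul_homotopic h h'
  one := ⟦PMap.const Y M⟧
  mul_assoc := by
    rintro ⟨a⟩ ⟨b⟩ ⟨c⟩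
    refine congrArg (Quotient.mk _) (Subtype.ext (ContinuousMap.ext fun y => ?_))
    exact mul_assoc (a.1 y) (b.1 y) (c.1 y)
  one_mul := by
    rintro ⟨a⟩
    refine congrArg (Quotient.mk _) (Subtype.ext (ContinuousMap.ext fun y => ?_))
    change M.pt * a.1 y = a.1 y
    exact (congrArg (· * a.1 y) CGMonoid.pt_eq).trans (one_mul _)
  mul_one := by
    rintro ⟨a⟩
    refine congrArg (Quotient.mk _) (Subtype.ext (ContinuousMap.ext fun y => ?_))
    change a.1 y * M.pt = a.1 y
    exact (congrArg (a.1 y * ·) CGMonoid.pt_eq).trans (mul_one _)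

/-- The homomorphism `g^* : [Y, M] → [Y', M]` induced by a pointed map `g : Y' → Y`. -/
def pullback (M : PtdCG.{u}) [CGMonoid M] {Y Y' : PtdCG.{u}} (g : PMap Y' Y) :
    HClass Y M →* HClass Y' M where
  toFun := Quotient.map (fun f => ⟨f.1.comp g.1, by
      rw [ContinuousMap.comp_apply, g.2, f.2]⟩) (by
    rintro f f' ⟨F⟩
    refine ⟨⟨⟨⟨fun p => F (p.1, g.1 p.2), by fun_prop⟩, ?_, ?_⟩, ?_⟩⟩
    · exact fun y => F.apply_zero _
    · exact fun y => F.apply_one _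
    · intro t y hy
      refine F.eq_fst t ?_
      rw [Set.mem_singleton_iff] at hy ⊢
      rw [hy, g.2])
  map_one' := rfl
  map_mul' := by
    rintro ⟨a⟩ ⟨b⟩
    rfl

end Mul

/-! ### Smash powers -/

/-- Two points of `X^l` are identified in the smash power if they are equal or both lie in the fat
wedge, that is, both have a coordinate equal to the base point. -/
def smashSetoid (X : PtdCG.{u}) (l : ℕ) : Setoid (KPow (Fin l) X) where
  r a b := a = b ∨ ((∃ i, a i = X.pt) ∧ ∃ i, b i = X.pt)
  iseqv := by
    refine ⟨fun a => Or.inl rfl, ?_, ?_⟩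
    · rintro a b (h | ⟨h, h'⟩)
      · exact Or.inl h.symm
      · exact Or.inr ⟨h', h⟩
    · rintro a b c (rfl | ⟨h, h'⟩) (rfl | ⟨h2, h2'⟩)
      · exact Or.inl rfl
      · exact Or.inr ⟨h2, h2'⟩
      · exact Or.inr ⟨h, h'⟩
      · exact Or.inr ⟨h, h2'⟩

/-- The `l`-fold self smash product `X^{(l)}`, for `l > 0`. -/
def smash (X : PtdCG.{u}) (l : ℕ) : PtdCG.{u} where
  carrier := Quotient (X.smashSetoid l)
  pt := Quotient.mk (X.smashSetoid l) ⟨fun _ => X.pt⟩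

/-- The reduced diagonal `X → X ∧ X`. -/
def reducedDiagonal (X : PtdCG.{u}) : PMap X (X.smash 2) :=
  ⟨⟨fun x => Quotient.mk (X.smashSetoid 2) ⟨fun _ => x⟩,
    continuous_quotient_mk'.comp (continuous_KPow fun _ => continuous_id)⟩, rfl⟩

/-- `X` has weak LS-category less than `2`: the reduced diagonal is null homotopic. -/
def WeakCatLtTwo (X : PtdCG.{u}) : Prop :=
  PMap.Homotopic X.reducedDiagonal (PMap.const X (X.smash 2))

/-! ### The James construction -/

/-- The underlying monoid of the James construction: reduced words, that is, words in the points
of `X` other than the base point. This is the free monoid on `X` with the base point as unit. -/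
def Word (X : PtdCG.{u}) : Type u := FreeMonoid {x : X // x ≠ X.pt}

instance (X : PtdCG.{u}) : Monoid X.Word := inferInstanceAs (Monoid (FreeMonoid _))

/-- A point of `X` as an element of the James construction; the base point becomes the unit. -/
noncomputable def letter (X : PtdCG.{u}) (x : X) : X.Word :=
  open Classical in if h : x = X.pt then 1 else FreeMonoid.of ⟨x, h⟩

/-- The element `x₁ x₂ ⋯ x_k` of the James construction. -/
noncomputable def word (X : PtdCG.{u}) {k : ℕ} (v : KPow (Fin k) X) : X.Word :=
  (List.ofFn fun i => X.letter (v i)).prod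

/-- The quotient map from the disjoint union of the powers `X^k` to the James construction. -/
noncomputable def wordSigma (X : PtdCG.{u}) (v : Σ k : ℕ, KPow (Fin k) X) : X.Word := X.word v.2

/-- The James construction has the quotient topology from the disjoint union of the
powers `X^k`. -/
noncomputable instance (X : PtdCG.{u}) : TopologicalSpace X.Word :=
  TopologicalSpace.coinduced X.wordSigma inferInstance

lemma continuous_wordSigma (X : PtdCG.{u}) : Continuous X.wordSigma := continuous_coinduced_rng

lemma continuous_word (X : PtdCG.{u}) (k : ℕ) : Continuous (X.word (k := k)) :=
  X.continuous_wordSigma.comp (continuous_sigmaMk (i := k))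

instance (X : PtdCG.{u}) : CompactlyGeneratedSpace X.Word :=
  uCompactlyGeneratedSpace_of_coinduced X.continuous_wordSigma rfl

lemma letter_pt (X : PtdCG.{u}) : X.letter X.pt = 1 := dif_pos rfl

lemma letter_of_ne (X : PtdCG.{u}) {x : X} (h : x ≠ X.pt) :
    X.letter x = (FreeMonoid.of ⟨x, h⟩ : FreeMonoid {x : X // x ≠ X.pt}) := dif_neg h

/-- Concatenation of families. -/
def appendK {X : Type u} {m n : ℕ} (v : KPow (Fin m) X) (w : KPow (Fin n) X) :
    KPow (Fin (m + n)) X := ⟨Fin.append v.coord w.coord⟩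

lemma word_appendK (X : PtdCG.{u}) {m n : ℕ} (v : KPow (Fin m) X) (w : KPow (Fin n) X) :
    X.word (appendK v w) = X.word v * X.word w := by
  have : (fun i => X.letter ((appendK v w) i)) =
      Fin.append (fun i => X.letter (v i)) (fun i => X.letter (w i)) := by
    funext i
    refine Fin.addCases (fun i => ?_) (fun i => ?_) i <;> simp [appendK]
  rw [word, this, List.ofFn_fin_append, List.prod_append]
  rfl

lemma wordSigma_surjective (X : PtdCG.{u}) : Function.Surjective X.wordSigma := by
  intro w
  refine FreeMonoid.recOn (motive := fun w : FreeMonoid {x : X // x ≠ X.pt} =>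
    ∃ a, X.wordSigma a = w) w ⟨⟨0, ⟨Fin.elim0⟩⟩, rfl⟩ ?_
  rintro x xs ⟨⟨k, v⟩, hv⟩
  refine ⟨⟨1 + k, appendK ⟨fun _ => x.1⟩ v⟩, ?_⟩
  refine (X.word_appendK _ _).trans ?_
  refine congrArg₂ (fun a b : FreeMonoid {x : X // x ≠ X.pt} => a * b) ?_ hv
  refine Eq.trans ?_ (X.letter_of_ne x.2)
  exact mul_one _

lemma isQuotientMap_wordSigma (X : PtdCG.{u}) : IsQuotientMap X.wordSigma :=
  ⟨⟨rfl⟩, X.wordSigma_surjective⟩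

/-- Multiplication on the left by words of fixed length. -/
lemma continuous_word_mul (X : PtdCG.{u}) {m : ℕ} (C : Type u) [TopologicalSpace C]
    [CompactSpace C] [T2Space C] {c : C → KPow (Fin m) X} (hc : Continuous c) :
    Continuous fun p : C × X.Word => X.word (c p.1) * p.2 := by
  refine X.isQuotientMap_wordSigma.continuous_lift_prod_right ?_
  have h : Continuous fun p : (Σ k : ℕ, KPow (Fin k) X) × C =>
      X.word (c p.2) * X.wordSigma p.1 := by
    rw [← (Homeomorph.sigmaProdDistrib (X := fun k : ℕ => KPow (Fin k) X)
      (Y := C)).symm.comp_continuous_iff', continuous_sigma_iff]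
    intro k
    have hk : CompactlyGeneratedSpace (KPow (Fin k) X × C) := compactlyGenerated_prod _ _
    have h1 : Continuous fun p : KPow (Fin k) X × C => appendK (c p.2) p.1 := by
      refine continuous_KPow fun i => ?_
      refine Fin.addCases (fun i => ?_) (fun i => ?_) i
      · simpa [appendK, Function.comp_def] using
          (continuous_coord i).comp (hc.comp continuous_snd)
      · simpa [appendK, Function.comp_def] using
          (continuous_coord i).comp (continuous_fst (X := KPow (Fin k) X) (Y := C))
    refine ((X.continuous_word _).comp h1).congr fun p => ?_
    exact X.word_appendK _ _
  exact h.comp continuous_swap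

lemma continuous_mul_right (X : PtdCG.{u}) (C : Type u) [TopologicalSpace C]
    [CompactSpace C] [T2Space C] {b : C → X.Word} (hb : Continuous b) :
    Continuous fun p : X.Word × C => p.1 * b p.2 := by
  refine X.isQuotientMap_wordSigma.continuous_lift_prod_left ?_
  rw [← (Homeomorph.sigmaProdDistrib (X := fun k : ℕ => KPow (Fin k) X)
      (Y := C)).symm.comp_continuous_iff', continuous_sigma_iff]
  intro k
  have hk : CompactlyGeneratedSpace (KPow (Fin k) X × C) := compactlyGenerated_prod _ _
  refine continuous_from_compactlyGeneratedSpace _ fun S _ _ _ g hg => ?_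
  exact (X.continuous_word_mul S (c := fun s => (g s).1) (continuous_fst.comp hg)).comp
    (continuous_id.prodMk (hb.comp (continuous_snd.comp hg)))

/-- The James construction `J(X)`. -/
noncomputable def James (X : PtdCG.{u}) : PtdCG.{u} where
  carrier := X.Word
  pt := 1

noncomputable instance (X : PtdCG.{u}) : CGMonoid X.James where
  toMonoid := inferInstanceAs (Monoid X.Word)
  pt_eq := rfl
  continuous_mul' := by
    refine continuous_from_compactlyGeneratedSpace _ fun S _ _ _ g hg => ?_
    have h0 := (continuous_coord (X := X.Word) (0 : Fin 2)).comp hg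
    have h1 := (continuous_coord (X := X.Word) (1 : Fin 2)).comp hg
    exact (X.continuous_mul_right S h1).comp (h0.prodMk continuous_id)

/-- The canonical inclusion `E : X → J(X)`. -/
noncomputable def jamesIncl (X : PtdCG.{u}) : PMap X X.James :=
  ⟨⟨X.letter, by
    have h : Continuous fun x : X => X.word (k := 1) ⟨fun _ => x⟩ :=
      (X.continuous_word 1).comp (continuous_KPow fun _ => continuous_id)
    refine h.congr fun x => ?_
    simp [word]⟩, X.letter_pt⟩

/-- The `n`-th stage `J_n(X)` of the James filtration: the quotient of `X^n` in which two families
are identified if they represent the same element of `J(X)`. -/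
noncomputable def JamesFil (X : PtdCG.{u}) (n : ℕ) : PtdCG.{u} where
  carrier := Quotient (Setoid.ker (X.word (k := n)))
  pt := Quotient.mk _ ⟨fun _ => X.pt⟩

/-! ### The geometric groups -/

/-- The map `X^κ → X^ι` whose `i`-th coordinate is the `φ i`-th coordinate of the argument, or the
base point if `φ` deletes `i`. -/
def coordMap (X : PtdCG.{u}) {ι κ : Type} (φ : ι → Option κ) : PMap (X.pow κ) (X.pow ι) :=
  ⟨⟨fun v => ⟨fun i => (φ i).elim X.pt v.coord⟩, by
    refine continuous_KPow (W := KPow κ X) fun i => ?_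
    cases h : φ i with
    | none => simpa [h] using continuous_const
    | some k => simpa [h] using continuous_coord k⟩, by
    refine congrArg KPow.mk (funext fun i => ?_)
    change (φ i).elim X.pt (fun _ => X.pt) = X.pt
    cases φ i <;> rfl⟩

/-- The homomorphism `[X^ι, J(X)] → [X^κ, J(X)]` induced by `coordMap φ`. -/
noncomputable def coordPullback (X : PtdCG.{u}) {ι κ : Type} (φ : ι → Option κ) :
    HClass (X.pow ι) X.James →* HClass (X.pow κ) X.James :=
  pullback X.James (X.coordMap φ)

/-- The coordinate projection `p_i : X^ι → X`. -/
def proj (X : PtdCG.{u}) {ι : Type} (i : ι) : PMap (X.pow ι) X :=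
  ⟨⟨fun v => v.coord i, continuous_coord i⟩, rfl⟩

/-- The class `x_i ∈ [X^ι, J(X)]` of the composite of `p_i : X^ι → X` with `E : X → J(X)`. -/
noncomputable def xClass (X : PtdCG.{u}) {ι : Type} (i : ι) : HClass (X.pow ι) X.James :=
  pullback X.James (X.proj i) ⟦X.jamesIncl⟧

/-- The subgroup `K_n(X)` of `[X^n, J(X)]` generated by the classes `x_i` (the subgroup generated
inside the group of invertible elements). -/
noncomputable def KGeo (X : PtdCG.{u}) (ι : Type) : Submonoid (HClass (X.pow ι) X.James) :=
  (Subgroup.closure {a : (HClass (X.pow ι) X.James)ˣ | ∃ i : ι, a.val = X.xClass i}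
    ).toSubmonoid.map (Units.coeHom _)

/-- The quotient map `X^{ln} → X^{(l)} × ⋯ × X^{(l)} → J_n(X^{(l)})`. -/
noncomputable def quotMap (X : PtdCG.{u}) (l n : ℕ) :
    PMap (X.pow (Fin n × Fin l)) ((X.smash l).JamesFil n) :=
  ⟨⟨fun v => Quotient.mk _ ⟨fun s => Quotient.mk (X.smashSetoid l) ⟨fun j => v.coord (s, j)⟩⟩, by
    refine continuous_quotient_mk'.comp
      (continuous_KPow (W := KPow (Fin n × Fin l) X) (X := X.smash l) fun s => ?_)
    exact continuous_quotient_mk'.comp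
      (continuous_KPow (W := KPow (Fin n × Fin l) X) (X := X) fun j => continuous_coord (s, j))⟩, rfl⟩

/-- The homomorphism `[J_n(X^{(l)}), J(X)] → [X^{ln}, J(X)]` induced by the quotient map. -/
noncomputable def quotPullback (X : PtdCG.{u}) (l n : ℕ) :
    HClass ((X.smash l).JamesFil n) X.James →* HClass (X.pow (Fin n × Fin l)) X.James :=
  pullback X.James (X.quotMap l n)

/-- The group `H_n^{(l)}(X)`: the classes in `[J_n(X^{(l)}), J(X)]` whose image `α` in
`[X^{ln}, J(X)]` lies in `K_{ln}(X)` and satisfies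
* restricting one coordinate of a block to the base point has the same effect on `α` as
  restricting the whole block to the base point, and
* `D_0 α = ⋯ = D_{n-1} α`, where `D_s : [X^{ln}, J(X)] → [X^{l(n-1)}, J(X)]` restricts to the
  subspace where all coordinates of the `s`-th block are the base point. -/
noncomputable def HGeo (X : PtdCG.{u}) (l n : ℕ) :
    Submonoid (HClass ((X.smash l).JamesFil n) X.James) where
  carrier := {β | X.quotPullback l n β ∈ X.KGeo (Fin n × Fin l) ∧
    (∀ s j, X.coordPullback (killIdx {(s, j)}) (X.quotPullback l n β) =
      X.coordPullback (killIdx (block s)) (X.quotPullback l n β)) ∧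
    ∀ s t, X.coordPullback (deleteBlock s) (X.quotPullback l n β) =
      X.coordPullback (deleteBlock t) (X.quotPullback l n β)}
  mul_mem' := by
    rintro a b ⟨h0, h1, h2⟩ ⟨h3, h4, h5⟩
    refine ⟨?_, fun s j => ?_, fun s t => ?_⟩
    · rw [map_mul]
      exact mul_mem h0 h3
    · rw [map_mul, map_mul, map_mul, h1, h4]
    · rw [map_mul, map_mul, map_mul, h2 s t, h5 s t]
  one_mem' := by
    refine ⟨?_, fun s j => ?_, fun s t => ?_⟩
    · rw [map_one]
      exact one_mem _
    · rw [map_one, map_one, map_one]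
    · rw [map_one, map_one, map_one]

end PtdCG

/-! The space `X` is not assumed to be a CW complex, so inverses up to homotopy are built by hand.
Off a neighbourhood of the base point, a null homotopy of the reduced diagonal yields countably many
open sets on which the inclusion into `J(X)` is null homotopic: follow one coordinate of the
homotopy until just before it meets the wedge, then contract (`homOn_coverFun`). Invertibility up to
homotopy can be glued over countable covers by cozero sets (`unitOn_univ_of_countable_cover`), so
the inclusion of letters has an inverse `χ` (`unitOn_letter`). Extending `χ` to words in reversed
order, with Moore paths that cancel a word from the inside outwards, gives a right inverse of the
identity of `J(X)` (`exists_james_inverse`). Hence `[Y, J(X)]` is a group for every `Y`.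

The same null homotopy makes any two classes on `X^I` that vanish on the hyperplane `x_i = *`
commute: compare the two orders of the product as a function of the `i`-th coordinate; it factors
through the diagonal into `X ∧ X` (`mul_comm_of_kill`). So each `x_i` lies in an abelian normal
subgroup, the kernel of restriction to its hyperplane, and this alone forces both families of Cohen
relations (`leftComm_eq_one_of_not_nodup`, `leftComm_zpow_of_abelian`). This gives `e_X` on
`K_{ln}`, natural for relabelling and deletion of coordinates (`coordPullback_cohenHom`).

Finally `q^*` is injective (`injective_pullback_quotMap`), and every class satisfying (a) and (b) is
in its image (`exists_quotPullback`). Both proofs remove one block at a time and so reduce to maps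
that are trivial on the fat wedge, outside of which `q` is injective. Injectivity uses a homotopy
extension argument; surjectivity uses a James-Hopf type extension to all of `J(X^{(l)})`, a product
over subwords. On `H^{(l)}_n` the map `e_X` is the unique lift through `q^*`, hence a homomorphism,
and the last claim is naturality of `e_X` on `K_{ln}`. -/

set_option linter.unusedSectionVars false

/-! ### Compactly generated spaces: open subspaces, products, powers of quotient maps. -/

namespace PtdCG

/-- An open subspace of a compactly generated space is compactly generated. -/
lemma compactlyGenerated_of_isOpen {W : Type u} [TopologicalSpace W] [CompactlyGeneratedSpace W]
    {U : Set W} (hU : IsOpen U) : CompactlyGeneratedSpace U := by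
  refine compactlyGeneratedSpace_of_isOpen fun s hs => ?_
  have : IsOpen (Subtype.val '' s) := by
    refine CompactlyGeneratedSpace.isOpen' fun S _ _ _ g hg => ?_
    refine isOpen_iff_mem_nhds.2 fun p hp => ?_
    have hpU : g p ∈ U := by
      obtain ⟨a, -, ha⟩ := hp
      exact ha ▸ a.2
    -- The preimage of `U` in `S` need not be compact, so the test is made on a compact
    -- neighbourhood of `p` that maps into `U`.
    obtain ⟨C, hC, hCc, hCU⟩ := exists_mem_nhds_isCompact_mapsTo hg (hU.mem_nhds hpU)
    have : CompactSpace C := isCompact_iff_compactSpace.1 hCc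
    have h2 := hs C (fun c => ⟨g c.1, hCU c.2⟩)
      ((hg.comp continuous_subtype_val).subtype_mk fun c => hCU c.2)
    obtain ⟨O, hO, hOe⟩ := isOpen_induced_iff.1 h2
    have hpO : p ∈ O := by
      have : (⟨p, mem_of_mem_nhds hC⟩ : C) ∈ Subtype.val ⁻¹' O := by
        rw [hOe]
        obtain ⟨a, ha, ha'⟩ := hp
        have : (⟨g p, hpU⟩ : U) = a := Subtype.ext ha'.symm
        simpa [this] using ha
      exact this
    filter_upwards [hC, hO.mem_nhds hpO] with x hx hxO
    have : (⟨x, hx⟩ : C) ∈ Subtype.val ⁻¹' O := hxO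
    rw [hOe] at this
    exact ⟨_, this, rfl⟩
  rw [← Set.preimage_image_eq s Subtype.val_injective]
  exact this.preimage continuous_subtype_val

lemma compactlyGenerated_prod_left (K Y : Type u) [TopologicalSpace Y] [CompactlyGeneratedSpace Y]
    [TopologicalSpace K] [CompactSpace K] [T2Space K] : CompactlyGeneratedSpace (K × Y) := by
  have := compactlyGenerated_prod Y K
  refine compactlyGeneratedSpace_of_continuous_maps fun {T} _ f hf => ?_
  have h1 : Continuous fun p : Y × K => f (p.2, p.1) :=
    continuous_from_compactlyGeneratedSpace _ fun S _ _ _ g hg =>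
      hf S (fun s => ((g s).2, (g s).1)) (by fun_prop)
  exact h1.comp continuous_swap

/-- The product of a compactly generated space with a locally compact Hausdorff space is compactly
generated. -/
lemma compactlyGenerated_prod_of_locallyCompact (Y : Type u) (K : Type) [TopologicalSpace Y]
    [CompactlyGeneratedSpace Y] [TopologicalSpace K] [LocallyCompactSpace K] [T2Space K] :
    CompactlyGeneratedSpace (Y × K) := by
  have hK : LocallyCompactSpace (ULift.{u} K) :=
    Homeomorph.ulift.isClosedEmbedding.locallyCompactSpace
  refine compactlyGeneratedSpace_of_continuous_maps fun {T} _ f hf => ?_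
  have h1 : ∀ y, Continuous fun k => f (y, k) := fun y => by
    have : Continuous fun k : ULift.{u} K => f (y, k.down) :=
      continuous_from_compactlyGeneratedSpace _ fun S _ _ _ g hg =>
        hf S (fun s => (y, (g s).down)) (by fun_prop)
    exact this.comp continuous_uliftUp
  -- Exponential law: continuity of the curried map can be tested on compact spaces over `Y`, and
  -- local compactness of `K` allows uncurrying.
  let F : Y → C(K, T) := fun y => ⟨fun k => f (y, k), h1 y⟩
  have hF : Continuous F := by
    refine continuous_from_compactlyGeneratedSpace _ fun L _ _ _ g hg => ?_
    refine ContinuousMap.continuous_of_continuous_uncurry _ ?_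
    have : Continuous fun p : L × ULift.{u} K => f (g p.1, p.2.down) :=
      continuous_from_compactlyGeneratedSpace _ fun S _ _ _ g' hg' =>
        hf S (fun s => (g (g' s).1, (g' s).2.down)) (by fun_prop)
    exact this.comp (f := fun p : L × K => (p.1, ULift.up p.2)) (by fun_prop)
  exact ContinuousMap.continuous_uncurry_of_continuous ⟨F, hF⟩

instance (Y : Type u) [TopologicalSpace Y] [CompactlyGeneratedSpace Y] :
    CompactlyGeneratedSpace (Y × ℝ) := compactlyGenerated_prod_of_locallyCompact Y ℝ

instance (Y : Type u) [TopologicalSpace Y] [CompactlyGeneratedSpace Y] :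
    CompactlyGeneratedSpace (Y × unitInterval) := compactlyGenerated_prod_of_locallyCompact Y _

lemma CGMonoid.continuousOn_mul {M : PtdCG.{u}} [CGMonoid M] {W : Type u} [TopologicalSpace W]
    [CompactlyGeneratedSpace W] {U : Set W} (hU : IsOpen U) {f g : W → M}
    (hf : ContinuousOn f U) (hg : ContinuousOn g U) : ContinuousOn (fun w => f w * g w) U := by
  have := compactlyGenerated_of_isOpen hU
  rw [continuousOn_iff_continuous_domRestrict] at *
  exact CGMonoid.continuous_mul hf hg

/-- A function that is continuous on finitely many powers of the total space of a quotient map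
descends continuously. -/
lemma continuous_of_comp_quotient_aux {A B : Type u} [TopologicalSpace A] [TopologicalSpace B]
    [CompactlyGeneratedSpace A] {p : A → B} (hp : IsQuotientMap p) {T : Type*}
    [TopologicalSpace T] (m : ℕ) : ∀ (S : Type u) [TopologicalSpace S] [CompactSpace S] [T2Space S]
    (F : S → (Fin m → B) → T),
    (Continuous fun q : S × KPow (Fin m) A => F q.1 fun i => p (q.2 i)) →
    ∀ g : S → Fin m → B, Continuous g → Continuous fun s => F s (g s) := by
  induction m with
  | zero =>
    intro S _ _ _ F hF g hg
    have : Continuous fun s : S => (s, (⟨Fin.elim0⟩ : KPow (Fin 0) A)) := by fun_prop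
    refine (hF.comp this).congr fun s => ?_
    exact congrArg (F s) (Subsingleton.elim _ _)
  | succ m ih =>
    intro S _ _ _ F hF g hg
    -- The coordinates are lifted from `B` to `A` one at a time, because `p × id` is again a
    -- quotient map when the other factor is compact Hausdorff. The remaining coordinates are
    -- absorbed in the test space.
    have key : Continuous fun q : S × B => F q.1 (Fin.cons q.2 (fun i => g q.1 i.succ)) := by
      refine hp.continuous_lift_prod_right ?_
      have : CompactlyGeneratedSpace (S × A) := compactlyGenerated_prod_left _ _
      refine continuous_from_compactlyGeneratedSpace _ fun S' _ _ _ e he => ?_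
      refine ih S' (fun s' c => F (e s').1 (Fin.cons (p (e s').2) c)) ?_
        (fun s' i => g (e s').1 i.succ) (by fun_prop)
      have hc : CompactlyGeneratedSpace (S' × KPow (Fin m) A) :=
        compactlyGenerated_prod_left _ _
      have h2 : Continuous fun q : S' × KPow (Fin m) A =>
          (⟨Fin.cons (e q.1).2 q.2.coord⟩ : KPow (Fin (m + 1)) A) := by
        refine continuous_KPow fun i => ?_
        refine Fin.cases ?_ (fun i => ?_) i
        · exact continuous_snd.comp (he.comp continuous_fst)
        · exact (continuous_coord i).comp continuous_snd
      refine (hF.comp ((continuous_fst.comp (he.comp continuous_fst)).prodMk h2)).congr fun q => ?_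
      refine congrArg (F _) (funext fun i => ?_)
      refine Fin.cases rfl (fun i => rfl) i
    have h3 : Continuous fun s => (s, g s 0) := by fun_prop
    refine (key.comp h3).congr fun s => ?_
    exact congrArg (F s) (Fin.cons_self_tail (g s))

/-- Finite powers of quotient maps are quotient maps in compactly generated spaces. -/
lemma continuous_of_comp_quotient {A B : Type u} [TopologicalSpace A] [TopologicalSpace B]
    [CompactlyGeneratedSpace A] {p : A → B} (hp : IsQuotientMap p) {T : Type*}
    [TopologicalSpace T] {m : ℕ} {F : KPow (Fin m) B → T}
    (hF : Continuous fun v : KPow (Fin m) A => F ⟨fun i => p (v i)⟩) : Continuous F := by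
  refine continuous_from_KPow fun S _ _ _ g hg => ?_
  exact continuous_of_comp_quotient_aux hp m S (fun _ c => F ⟨c⟩) (hF.comp continuous_snd) g hg

end PtdCG

/-! ### Homotopies over open subsets and their gluing over two sets. -/

namespace PtdCG

section Local

variable {Y Z : Type*} [TopologicalSpace Y] [TopologicalSpace Z]

lemma continuousOn_of_locally_eq {F : Y → Z} {S : Set Y}
    (h : ∀ p ∈ S, ∃ O, IsOpen O ∧ p ∈ O ∧ ∃ G : Y → Z, ContinuousOn G O ∧ Set.EqOn F G O) :
    ContinuousOn F S := by
  intro p hp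
  obtain ⟨O, hO, hpO, G, hG, hFG⟩ := h p hp
  exact ((hG.congr hFG).continuousAt (hO.mem_nhds hpO)).continuousWithinAt

lemma continuousOn_comp_time {F : Y × ℝ → Z} {A : Set Y} (hF : ContinuousOn F (A ×ˢ Set.univ))
    {S : Set (Y × ℝ)} {e : Y × ℝ → ℝ} (he : ContinuousOn e S) (hS : ∀ p ∈ S, p.1 ∈ A) :
    ContinuousOn (fun p => F (p.1, e p)) S :=
  hF.comp (continuousOn_fst.prodMk he) fun p hp => ⟨hS p hp, Set.mem_univ _⟩

lemma continuousOn_comp_time' {F : Y × ℝ → Z} {A : Set Y} (hF : ContinuousOn F (A ×ˢ Set.univ))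
    {S : Set Y} {e : Y → ℝ} (he : ContinuousOn e S) (hS : S ⊆ A) :
    ContinuousOn (fun x => F (x, e x)) S :=
  hF.comp (continuousOn_id.prodMk he) fun _ hp => ⟨hS hp, Set.mem_univ _⟩

end Local

variable {M : PtdCG.{u}} [CGMonoid M] {Y : Type u} [TopologicalSpace Y]
  {N A B : Set Y} {f g k f' g' : Y → M}

/-- The functions `f` and `g` are homotopic on `A` through functions with value `1` on `N`; the
homotopy is defined for all real times and stationary outside `[0, 1]`. -/
def HomOn (N A : Set Y) (f g : Y → M) : Prop :=
  ∃ F : Y × ℝ → M, ContinuousOn F (A ×ˢ Set.univ) ∧ (∀ x ∈ A, ∀ t ≤ 0, F (x, t) = f x) ∧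
    (∀ x ∈ A, ∀ t, 1 ≤ t → F (x, t) = g x) ∧ ∀ x ∈ A, x ∈ N → ∀ t, F (x, t) = 1

/-- The function `f` is continuous on `A` with value `1` on `N`. -/
def Adm (N A : Set Y) (f : Y → M) : Prop := ContinuousOn f A ∧ ∀ x ∈ A, x ∈ N → f x = 1

lemma Adm.homOn_refl (h : Adm N A f) : HomOn N A f f :=
  ⟨fun p => f p.1, h.1.comp continuousOn_fst fun _ hp => hp.1, fun _ _ _ _ => rfl,
    fun _ _ _ _ => rfl, fun x hx hN _ => h.2 x hx hN⟩

lemma Adm.mono (h : Adm N A f) (hBA : B ⊆ A) : Adm N B f :=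
  ⟨h.1.mono hBA, fun x hx => h.2 x (hBA hx)⟩

lemma adm_one : Adm N A (1 : Y → M) := ⟨continuousOn_const, fun _ _ _ => rfl⟩

lemma Adm.mul [CompactlyGeneratedSpace Y] (hA : IsOpen A) (hf : Adm N A f) (hg : Adm N A g) :
    Adm N A (f * g) :=
  ⟨CGMonoid.continuousOn_mul hA hf.1 hg.1, fun x hx hN => by
    simp [hf.2 x hx hN, hg.2 x hx hN]⟩

namespace HomOn

lemma adm_left (h : HomOn N A f g) : Adm N A f := by
  obtain ⟨F, hF, h0, h1, hN⟩ := h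
  refine ⟨?_, fun x hx hxN => by rw [← h0 x hx 0 le_rfl, hN x hx hxN]⟩
  exact (continuousOn_comp_time' hF (e := fun _ => 0) continuousOn_const subset_rfl).congr
    fun x hx => (h0 x hx 0 le_rfl).symm

lemma symm (h : HomOn N A f g) : HomOn N A g f := by
  obtain ⟨F, hF, h0, h1, hN⟩ := h
  refine ⟨fun p => F (p.1, 1 - p.2), continuousOn_comp_time hF (by fun_prop) fun p hp => hp.1,
    fun x hx t ht => h1 x hx _ (by linarith), fun x hx t ht => h0 x hx _ (by linarith),
    fun x hx hxN t => hN x hx hxN _⟩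

lemma adm_right (h : HomOn N A f g) : Adm N A g := h.symm.adm_left

lemma mono (h : HomOn N A f g) (hBA : B ⊆ A) : HomOn N B f g := by
  obtain ⟨F, hF, h0, h1, hN⟩ := h
  exact ⟨F, hF.mono (Set.prod_mono_left hBA), fun x hx => h0 x (hBA hx),
    fun x hx => h1 x (hBA hx), fun x hx => hN x (hBA hx)⟩

lemma congr (h : HomOn N A f g) (hf : Set.EqOn f f' A) (hg : Set.EqOn g g' A) :
    HomOn N A f' g' := by
  obtain ⟨F, hF, h0, h1, hN⟩ := h
  exact ⟨F, hF, fun x hx t ht => (h0 x hx t ht).trans (hf hx),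
    fun x hx t ht => (h1 x hx t ht).trans (hg hx), hN⟩

lemma trans (hA : IsOpen A) (h : HomOn N A f g) (h' : HomOn N A g k) : HomOn N A f k := by
  obtain ⟨F, hF, h0, h1, hN⟩ := h
  obtain ⟨G, hG, h0', h1', hN'⟩ := h'
  -- Speed 3 leaves a rest at `g` for times between `1/3` and `2/3`, so the two formulas agree on an
  -- open overlap.
  refine ⟨fun p => if p.2 < 1 / 2 then F (p.1, 3 * p.2) else G (p.1, 3 * p.2 - 2), ?_, ?_, ?_, ?_⟩
  · refine continuousOn_of_locally_eq fun p hp => ?_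
    rcases lt_or_ge p.2 (1 / 2) with h | h
    · refine ⟨A ×ˢ {t | t < 2 / 3}, hA.prod isOpen_Iio, ⟨hp.1, show p.2 < _ by linarith⟩,
        fun p => F (p.1, 3 * p.2), continuousOn_comp_time hF (by fun_prop) fun p hp => hp.1,
        fun q hq => ?_⟩
      have h2 : q.2 < 2 / 3 := hq.2
      dsimp only
      split_ifs with h3
      · rfl
      · rw [h1 _ hq.1 _ (by linarith), h0' _ hq.1 _ (by linarith)]
    · refine ⟨A ×ˢ {t | 1 / 3 < t}, hA.prod isOpen_Ioi, ⟨hp.1, show _ < p.2 by linarith⟩,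
        fun p => G (p.1, 3 * p.2 - 2), continuousOn_comp_time hG (by fun_prop) fun p hp => hp.1,
        fun q hq => ?_⟩
      have h2 : 1 / 3 < q.2 := hq.2
      dsimp only
      split_ifs with h3
      · rw [h1 _ hq.1 _ (by linarith), h0' _ hq.1 _ (by linarith)]
      · rfl
  · intro x hx t ht
    dsimp only
    rw [if_pos (by linarith), h0 _ hx _ (by linarith)]
  · intro x hx t ht
    dsimp only
    rw [if_neg (by linarith), h1' _ hx _ (by linarith)]
  · intro x hx hxN t
    dsimp only
    rw [hN _ hx hxN, hN' _ hx hxN, ite_self]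

lemma mul [CompactlyGeneratedSpace Y] (hA : IsOpen A) (h : HomOn N A f f') (h' : HomOn N A g g') :
    HomOn N A (f * g) (f' * g') := by
  obtain ⟨F, hF, h0, h1, hN⟩ := h
  obtain ⟨G, hG, h0', h1', hN'⟩ := h'
  refine ⟨fun p => F p * G p, CGMonoid.continuousOn_mul (hA.prod isOpen_univ) hF hG,
    fun x hx t ht => ?_, fun x hx t ht => ?_, fun x hx hxN t => ?_⟩
  · simp [h0 x hx t ht, h0' x hx t ht]
  · simp [h1 x hx t ht, h1' x hx t ht]
  · simp [hN x hx hxN t, hN' x hx hxN t]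

end HomOn

/-- The function `f` is invertible on `A` up to homotopy. -/
def UnitOn (N A : Set Y) (f : Y → M) : Prop :=
  ∃ g, Adm N A g ∧ HomOn N A (f * g) 1 ∧ HomOn N A (g * f) 1

variable [CompactlyGeneratedSpace Y]

/-- Uniqueness of inverses: `g ≃ g * f * k ≃ k`. -/
lemma homOn_of_inverse (hA : IsOpen A) (hg : Adm N A g) (hk : Adm N A k)
    (h1 : HomOn N A (g * f) 1) (h2 : HomOn N A (f * k) 1) : HomOn N A g k := by
  have h3 := hg.homOn_refl.mul hA h2
  have h4 := h1.mul hA hk.homOn_refl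
  rw [mul_one] at h3
  rw [one_mul, mul_assoc] at h4
  exact h3.symm.trans hA h4

lemma UnitOn.of_left_right (hA : IsOpen A) (hf : Adm N A f) (hg : Adm N A g) (hk : Adm N A k)
    (h1 : HomOn N A (g * f) 1) (h2 : HomOn N A (f * k) 1) : UnitOn N A f :=
  ⟨g, hg, (hf.homOn_refl.mul hA (homOn_of_inverse hA hg hk h1 h2)).trans hA h2, h1⟩

lemma unitOn_of_homOn_one (h : HomOn N A f 1) : UnitOn N A f :=
  ⟨1, adm_one, by rwa [mul_one], by rwa [one_mul]⟩

lemma UnitOn.congr (hA : IsOpen A) (h : UnitOn N A f) (hf : HomOn N A f f') : UnitOn N A f' := by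
  obtain ⟨g, h1, h2, h3⟩ := h
  exact ⟨g, h1, (hf.symm.mul hA h1.homOn_refl).trans hA h2,
    (h1.homOn_refl.mul hA hf.symm).trans hA h3⟩

section MayerVietoris

variable {a b : Y → ℝ}

/-- The transition parameter from the set where `a > 0` to the set where `b > 0`. -/
noncomputable def transition (a b : Y → ℝ) (x : Y) : ℝ := 2 * b x / (a x + b x) - 1 / 2

/-- The parameter ranges over `[-1/2, 3/2]` and leaves `[0, 1]` already at the ratio `3 : 1`, before
`b` or `a` vanishes. Homotopies that are stationary outside `[0, 1]` therefore extend continuously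
past the overlap. -/
lemma transition_le (hb : ∀ x, 0 ≤ b x) {x : Y} (h : 3 * b x < a x) : transition a b x ≤ 0 := by
  have := hb x
  have h2 : 0 < a x + b x := by linarith
  have : 2 * b x / (a x + b x) ≤ 1 / 2 := by
    rw [div_le_iff₀ h2]
    linarith
  simp only [transition]
  linarith

lemma le_transition (ha : ∀ x, 0 ≤ a x) {x : Y} (h : 3 * a x < b x) : 1 ≤ transition a b x := by
  have := ha x
  have h2 : 0 < a x + b x := by linarith
  have : 3 / 2 ≤ 2 * b x / (a x + b x) := by
    rw [le_div_iff₀ h2]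
    linarith
  simp only [transition]
  linarith

lemma pos_left_of_transition_lt (ha : ∀ x, 0 ≤ a x) {x : Y} (h : 0 < a x + b x)
    (h' : transition a b x < 1) : 0 < a x := by
  refine lt_of_not_ge fun h3 => ?_
  have := le_transition ha (b := b) (x := x) (by linarith)
  linarith

lemma pos_right_of_lt_transition (hb : ∀ x, 0 ≤ b x) {x : Y} (h : 0 < a x + b x)
    (h' : 0 < transition a b x) : 0 < b x := by
  refine lt_of_not_ge fun h3 => ?_
  have := transition_le hb (a := a) (x := x) (by linarith)
  linarith

lemma transition_bounds {x : Y} (ha : 0 ≤ a x) (hb : 0 ≤ b x) (h : 0 < a x + b x) :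
    -(1 / 2) ≤ transition a b x ∧ transition a b x ≤ 3 / 2 := by
  have h1 : 0 ≤ 2 * b x / (a x + b x) := by positivity
  have h2 : 2 * b x / (a x + b x) ≤ 2 := by
    rw [div_le_iff₀ h]
    linarith
  simp only [transition]
  constructor <;> linarith

lemma continuousOn_transition (hac : Continuous a) (hbc : Continuous b) :
    ContinuousOn (transition a b) {x | 0 < a x + b x} := by
  unfold transition
  refine ContinuousOn.sub (ContinuousOn.div (by fun_prop) (by fun_prop) fun x hx => ?_)
    continuousOn_const
  exact ne_of_gt hx

lemma mv_cases (ha : ∀ x, 0 ≤ a x) (hb : ∀ x, 0 ≤ b x) {x : Y} (h : 0 < a x + b x) :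
    3 * b x < a x ∨ (0 < a x ∧ 0 < b x) ∨ 3 * a x < b x := by
  have h1 := ha x
  have h2 := hb x
  rcases h1.eq_or_lt with h3 | h3
  · right; right; linarith
  rcases h2.eq_or_lt with h4 | h4
  · left; linarith
  exact Or.inr (Or.inl ⟨h3, h4⟩)

open Classical in
/-- The extension by `1` of a function from the set where `a` and `b` are positive. -/
noncomputable def extOne (a b : Y → ℝ) (u : Y → M) (x : Y) : M :=
  if 0 < a x ∧ 0 < b x then u x else 1

/-- By `hl` and `hr` the homotopy `K` is already `1` before the overlap is left on either side, so
extending it by `1` creates no discontinuity. -/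
lemma homOn_extOne (hac : Continuous a) (hbc : Continuous b) (ha : ∀ x, 0 ≤ a x)
    (hb : ∀ x, 0 ≤ b x) {K : Y × ℝ → M} {u v : Y → M}
    (hK : ContinuousOn K ({x | 0 < a x ∧ 0 < b x} ×ˢ Set.univ))
    (h0 : ∀ x, 0 < a x → 0 < b x → ∀ t ≤ 0, K (x, t) = u x)
    (h1 : ∀ x, 0 < a x → 0 < b x → ∀ t, 1 ≤ t → K (x, t) = v x)
    (hN : ∀ x, 0 < a x → 0 < b x → x ∈ N → ∀ t, K (x, t) = 1)
    (hl : ∀ x, 0 < a x → 0 < b x → transition a b x ≤ 0 → ∀ t, K (x, t) = 1)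
    (hr : ∀ x, 0 < a x → 0 < b x → 1 ≤ transition a b x → ∀ t, K (x, t) = 1) :
    HomOn N {x | 0 < a x + b x} (extOne a b u) (extOne a b v) := by
  classical
  have hpos : ∀ x, ¬(0 < a x ∧ 0 < b x) → 0 < a x + b x → transition a b x ≤ 0 ∨
      1 ≤ transition a b x := fun x hx h => by
    rcases mv_cases ha hb h with h' | h' | h'
    · exact Or.inl (transition_le hb h')
    · exact absurd h' hx
    · exact Or.inr (le_transition ha h')
  refine ⟨fun p => if 0 < a p.1 ∧ 0 < b p.1 then K p else 1, ?_, ?_, ?_, ?_⟩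
  · refine continuousOn_of_locally_eq fun p hp => ?_
    rcases mv_cases ha hb hp.1 with h | h | h
    · refine ⟨{p | 3 * b p.1 < a p.1}, isOpen_lt (by fun_prop) (by fun_prop), h, fun _ => 1,
        continuousOn_const, fun q hq => ?_⟩
      dsimp only
      split_ifs with h2
      · exact hl q.1 h2.1 h2.2 (transition_le hb hq) q.2
      · rfl
    · refine ⟨{x | 0 < a x ∧ 0 < b x} ×ˢ Set.univ,
        ((isOpen_lt continuous_const hac).inter (isOpen_lt continuous_const hbc)).prod isOpen_univ,
        ⟨h, Set.mem_univ _⟩, K, hK, fun q hq => if_pos hq.1⟩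
    · refine ⟨{p | 3 * a p.1 < b p.1}, isOpen_lt (by fun_prop) (by fun_prop), h, fun _ => 1,
        continuousOn_const, fun q hq => ?_⟩
      dsimp only
      split_ifs with h2
      · exact hr q.1 h2.1 h2.2 (le_transition ha hq) q.2
      · rfl
  · intro x hx t ht
    simp only [extOne]
    split_ifs with h2
    · exact h0 x h2.1 h2.2 t ht
    · rfl
  · intro x hx t ht
    simp only [extOne]
    split_ifs with h2
    · exact h1 x h2.1 h2.2 t ht
    · rfl
  · intro x hx hxN t
    dsimp only
    split_ifs with h2
    · exact hN x h2.1 h2.2 hxN t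
    · rfl

lemma extOne_mul (u v : Y → M) : extOne a b (u * v) = extOne a b u * extOne a b v := by
  funext x
  simp only [extOne, Pi.mul_apply]
  split_ifs <;> simp

lemma extOne_one : extOne a b (1 : Y → M) = 1 := by
  funext x
  simp [extOne]

/-- A family of loops times the reversed family is null homotopic. -/
lemma homOn_loop_mul_reverse (hac : Continuous a) (hbc : Continuous b) (ha : ∀ x, 0 ≤ a x)
    (hb : ∀ x, 0 ≤ b x) {ω : Y × ℝ → M}
    (hω : ContinuousOn ω ({x | 0 < a x ∧ 0 < b x} ×ˢ Set.univ))
    (h0 : ∀ x, 0 < a x → 0 < b x → ∀ t ≤ 0, ω (x, t) = 1)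
    (h1 : ∀ x, 0 < a x → 0 < b x → ∀ t, 1 ≤ t → ω (x, t) = 1)
    (hN : ∀ x, 0 < a x → 0 < b x → x ∈ N → ∀ t, ω (x, t) = 1) :
    HomOn N {x | 0 < a x + b x} (extOne a b (fun x => ω (x, transition a b x)) *
      extOne a b (fun x => ω (x, 1 - transition a b x))) 1 := by
  have hC : IsOpen {x | 0 < a x ∧ 0 < b x} :=
    (isOpen_lt continuous_const hac).inter (isOpen_lt continuous_const hbc)
  have hD : IsOpen {x | 0 < a x + b x} := isOpen_lt continuous_const (by fun_prop)
  have hσ : ContinuousOn (fun p : Y × ℝ => transition a b p.1)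
      ({x | 0 < a x ∧ 0 < b x} ×ˢ Set.univ) :=
    (continuousOn_transition hac hbc).comp continuousOn_fst fun p hp => add_pos hp.1.1 hp.1.2
  have hcl : ∀ s : Set (Y × ℝ), ContinuousOn (fun p : Y × ℝ => max 0 (min p.2 1)) s := fun s =>
    Continuous.continuousOn (by fun_prop)
  set σ := transition a b with hσdef
  rw [← extOne_mul]
  -- Sliding the arguments to `2σ - 1` and `1 - 2σ` leaves at most one nontrivial factor, as `ω` is
  -- `1` at nonpositive times. The product becomes the there-and-back path `ω(|2σ - 1|)`, which is
  -- then pushed beyond time `1`.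
  refine HomOn.trans hD (g := extOne a b fun x => ω (x, |2 * σ x - 1|)) ?_ ?_
  · refine homOn_extOne hac hbc ha hb
      (K := fun p => ω (p.1, σ p.1 + max 0 (min p.2 1) * (σ p.1 - 1)) *
        ω (p.1, 1 - σ p.1 - max 0 (min p.2 1) * σ p.1)) ?_ ?_ ?_ ?_ ?_ ?_
    · refine CGMonoid.continuousOn_mul (hC.prod isOpen_univ) ?_ ?_
      · refine continuousOn_comp_time hω ?_ fun p hp => hp.1
        exact hσ.add ((hcl _).mul (hσ.sub continuousOn_const))
      · refine continuousOn_comp_time hω ?_ fun p hp => hp.1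
        exact (continuousOn_const.sub hσ).sub ((hcl _).mul hσ)
    · intro x _ _ t ht
      have : max 0 (min t 1) = 0 := by rw [min_eq_left (by linarith), max_eq_left ht]
      simp [this]
    · intro x hax hbx t ht
      have : max 0 (min t 1) = 1 := by rw [min_eq_right ht]; simp
      simp only [this]
      rcases le_total (2 * σ x - 1) 0 with h | h
      · rw [h0 x hax hbx _ (by linarith), one_mul, abs_of_nonpos h]
        congr 2; ring
      · rw [h0 x hax hbx (1 - σ x - 1 * σ x) (by linarith), mul_one, abs_of_nonneg h]
        congr 2; ring
    · intro x hax hbx hxN t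
      simp only [hN x hax hbx hxN, mul_one]
    · intro x hax hbx hx t
      have h2 : 0 ≤ max 0 (min t 1) := le_max_left _ _
      dsimp only
      rw [h0 x hax hbx _ (by nlinarith), h1 x hax hbx _ (by nlinarith), mul_one]
    · intro x hax hbx hx t
      have h2 : 0 ≤ max 0 (min t 1) := le_max_left _ _
      dsimp only
      rw [h1 x hax hbx _ (by nlinarith), h0 x hax hbx _ (by nlinarith), mul_one]
  · rw [← extOne_one (a := a) (b := b)]
    refine homOn_extOne hac hbc ha hb (K := fun p => ω (p.1, |2 * σ p.1 - 1| + max 0 p.2))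
      ?_ ?_ ?_ ?_ ?_ ?_
    · refine continuousOn_comp_time hω ?_ fun p hp => hp.1
      exact (((continuousOn_const.mul hσ).sub continuousOn_const).abs).add
        (Continuous.continuousOn (by fun_prop))
    · intro x _ _ t ht
      simp [max_eq_left ht]
    · intro x hax hbx t ht
      have := abs_nonneg (2 * σ x - 1)
      have := le_max_right 0 t
      exact h1 x hax hbx _ (by linarith)
    · intro x hax hbx hxN t
      exact hN x hax hbx hxN _
    · intro x hax hbx hx t
      have := neg_le_abs (2 * σ x - 1)
      have := le_max_left 0 t
      exact h1 x hax hbx _ (by linarith)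
    · intro x hax hbx hx t
      have := le_abs_self (2 * σ x - 1)
      have := le_max_left 0 t
      exact h1 x hax hbx _ (by linarith)

/-- A function that is null homotopic on both members of a numerable cover by two open sets is
invertible up to homotopy. -/
lemma unitOn_of_null_null (hac : Continuous a) (hbc : Continuous b) (ha : ∀ x, 0 ≤ a x)
    (hb : ∀ x, 0 ≤ b x) (hA : HomOn N {x | 0 < a x} f 1) (hB : HomOn N {x | 0 < b x} f 1) :
    UnitOn N {x | 0 < a x + b x} f := by
  classical
  have hD : IsOpen {x | 0 < a x + b x} := isOpen_lt continuous_const (by fun_prop)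
  have hC : IsOpen {x | 0 < a x ∧ 0 < b x} :=
    (isOpen_lt continuous_const hac).inter (isOpen_lt continuous_const hbc)
  obtain ⟨F, hF, hF0, hF1, hFN⟩ := hA
  obtain ⟨G, hG, hG0, hG1, hGN⟩ := hB
  simp only [Set.mem_ofPred_eq] at hF0 hF1 hG0 hG1 hFN hGN
  have hσ := continuousOn_transition hac hbc
  -- A loop at `1` over each point of the overlap: back along `F` to `f`, a rest, then along `G` to
  -- `1`.
  let ω : Y × ℝ → M := fun p => if p.2 < 1 / 2 then F (p.1, 1 - 3 * p.2) else G (p.1, 3 * p.2 - 2)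
  have hω : ContinuousOn ω ({x | 0 < a x ∧ 0 < b x} ×ˢ Set.univ) := by
    refine continuousOn_of_locally_eq fun p hp => ?_
    rcases lt_or_ge p.2 (1 / 2) with h | h
    · refine ⟨{x | 0 < a x ∧ 0 < b x} ×ˢ {t | t < 2 / 3}, hC.prod isOpen_Iio,
        ⟨hp.1, show p.2 < _ by linarith⟩, fun p => F (p.1, 1 - 3 * p.2),
        continuousOn_comp_time hF (by fun_prop) fun p hp => hp.1.1, fun q hq => ?_⟩
      have h2 : q.2 < 2 / 3 := hq.2
      simp only [ω]
      split_ifs with h3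
      · rfl
      · rw [hF0 _ hq.1.1 _ (by linarith), hG0 _ hq.1.2 _ (by linarith)]
    · refine ⟨{x | 0 < a x ∧ 0 < b x} ×ˢ {t | 1 / 3 < t}, hC.prod isOpen_Ioi,
        ⟨hp.1, show _ < p.2 by linarith⟩, fun p => G (p.1, 3 * p.2 - 2),
        continuousOn_comp_time hG (by fun_prop) fun p hp => hp.1.2, fun q hq => ?_⟩
      have h2 : 1 / 3 < q.2 := hq.2
      simp only [ω]
      split_ifs with h3
      · rw [hF0 _ hq.1.1 _ (by linarith), hG0 _ hq.1.2 _ (by linarith)]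
      · rfl
  have hω0 : ∀ x, 0 < a x → 0 < b x → ∀ t ≤ 0, ω (x, t) = 1 := fun x hax hbx t ht => by
    simp only [ω]
    rw [if_pos (by linarith), hF1 x hax _ (by linarith)]
    rfl
  have hω1 : ∀ x, 0 < a x → 0 < b x → ∀ t, 1 ≤ t → ω (x, t) = 1 := fun x hax hbx t ht => by
    simp only [ω]
    rw [if_neg (by linarith), hG1 x hbx _ (by linarith)]
    rfl
  have hωN : ∀ x, 0 < a x → 0 < b x → x ∈ N → ∀ t, ω (x, t) = 1 := fun x hax hbx hxN t => by
    simp only [ω]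
    rw [hFN x hax hxN, hGN x hbx hxN, ite_self]
  -- Contract `f` by `F` on one side and by `G` on the other, to an extent that dies out in the
  -- middle third of the transition. What remains is the clutching loop `ω` read at the transition
  -- parameter.
  have key : HomOn N {x | 0 < a x + b x} f (extOne a b fun x => ω (x, transition a b x)) := by
    refine ⟨fun p => if transition a b p.1 < 1 / 2 then
        F (p.1, max 0 (min p.2 1) * (1 - 3 * transition a b p.1)) else
        G (p.1, max 0 (min p.2 1) * (3 * transition a b p.1 - 2)), ?_, ?_, ?_, ?_⟩
    · refine continuousOn_of_locally_eq fun p hp => ?_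
      have hσ' : ContinuousOn (fun p : Y × ℝ => transition a b p.1)
          ({x | 0 < a x + b x} ×ˢ Set.univ) := hσ.comp continuousOn_fst fun p hp => hp.1
      have hS := hD.prod (isOpen_univ (X := ℝ))
      have hcl : Continuous fun p : Y × ℝ => max 0 (min p.2 1) := by fun_prop
      have e1 : ContinuousOn (fun p : Y × ℝ => max 0 (min p.2 1) * (1 - 3 * transition a b p.1))
          ({x | 0 < a x + b x} ×ˢ Set.univ) :=
        hcl.continuousOn.mul (continuousOn_const.sub (continuousOn_const.mul hσ'))
      have e2 : ContinuousOn (fun p : Y × ℝ => max 0 (min p.2 1) * (3 * transition a b p.1 - 2))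
          ({x | 0 < a x + b x} ×ˢ Set.univ) :=
        hcl.continuousOn.mul ((continuousOn_const.mul hσ').sub continuousOn_const)
      rcases lt_or_ge (transition a b p.1) (1 / 2) with h | h
      · refine ⟨_, hσ'.isOpen_inter_preimage hS (isOpen_Iio (a := 2 / 3)),
          ⟨hp, show transition a b p.1 < 2 / 3 by linarith⟩, _,
          continuousOn_comp_time hF (e1.mono Set.inter_subset_left) fun q hq => ?_,
            fun q hq => ?_⟩
        · have h2 : transition a b q.1 < 2 / 3 := hq.2
          exact pos_left_of_transition_lt ha hq.1.1 (by linarith)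
        · have h2 : transition a b q.1 < 2 / 3 := hq.2
          dsimp only
          split_ifs with h3
          · rfl
          · have h4 := pos_left_of_transition_lt ha hq.1.1 (by linarith)
            have h5 := pos_right_of_lt_transition hb hq.1.1 (by linarith)
            have h2 : 0 ≤ max 0 (min q.2 1) := le_max_left _ _
            rw [hF0 _ h4 _ (by nlinarith), hG0 _ h5 _ (by nlinarith)]
      · refine ⟨_, hσ'.isOpen_inter_preimage hS (isOpen_Ioi (a := 1 / 3)),
          ⟨hp, show 1 / 3 < transition a b p.1 by linarith⟩, _,
          continuousOn_comp_time hG (e2.mono Set.inter_subset_left) fun q hq => ?_,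
            fun q hq => ?_⟩
        · have h2 : 1 / 3 < transition a b q.1 := hq.2
          exact pos_right_of_lt_transition hb hq.1.1 (by linarith)
        · have h2 : 1 / 3 < transition a b q.1 := hq.2
          dsimp only
          split_ifs with h3
          · have h4 := pos_left_of_transition_lt ha hq.1.1 (by linarith)
            have h5 := pos_right_of_lt_transition hb hq.1.1 (by linarith)
            have h2 : 0 ≤ max 0 (min q.2 1) := le_max_left _ _
            rw [hF0 _ h4 _ (by nlinarith), hG0 _ h5 _ (by nlinarith)]
          · rfl
    · intro x hx t ht
      have : max 0 (min t 1) = 0 := by rw [min_eq_left (by linarith), max_eq_left ht]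
      simp only [this, zero_mul]
      split_ifs with h3
      · exact hF0 _ (pos_left_of_transition_lt ha hx (by linarith)) _ le_rfl
      · exact hG0 _ (pos_right_of_lt_transition hb hx (by linarith)) _ le_rfl
    · intro x hx t ht
      have : max 0 (min t 1) = 1 := by rw [min_eq_right ht]; simp
      simp only [this, one_mul, extOne, ω]
      by_cases h4 : 0 < a x ∧ 0 < b x
      · rw [if_pos h4]
      · rw [if_neg h4]
        rcases mv_cases ha hb hx with h | h | h
        · have := transition_le hb h
          rw [if_pos (by linarith)]
          exact hF1 x (pos_left_of_transition_lt ha hx (by linarith)) _ (by linarith)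
        · exact absurd h h4
        · have := le_transition ha h
          rw [if_neg (by linarith)]
          exact hG1 x (pos_right_of_lt_transition hb hx (by linarith)) _ (by linarith)
    · intro x hx hxN t
      dsimp only
      split_ifs with h3
      · exact hFN _ (pos_left_of_transition_lt ha hx (by linarith)) hxN _
      · exact hGN _ (pos_right_of_lt_transition hb hx (by linarith)) hxN _
  refine UnitOn.congr hD ?_ key.symm
  -- The reversed loops give the inverse; the other order is the same statement for the reverse of
  -- `ω`.
  have r1 := homOn_loop_mul_reverse hac hbc ha hb hω hω0 hω1 hωN
  have r2 := homOn_loop_mul_reverse (N := N) hac hbc ha hb (ω := fun p => ω (p.1, 1 - p.2))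
    (continuousOn_comp_time hω (by fun_prop) fun p hp => hp.1)
    (fun x hax hbx t ht => hω1 x hax hbx _ (by linarith))
    (fun x hax hbx t ht => hω0 x hax hbx _ (by linarith))
    (fun x hax hbx hxN t => hωN x hax hbx hxN _)
  simp only [sub_sub_cancel] at r2
  refine ⟨extOne a b (fun x => ω (x, 1 - transition a b x)), ?_, r1, r2⟩
  refine HomOn.adm_left (homOn_extOne (K := fun p => ω (p.1, 1 - transition a b p.1))
    (v := fun x => ω (x, 1 - transition a b x)) hac hbc ha hb ?_ ?_ ?_ ?_ ?_ ?_)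
  · refine continuousOn_comp_time hω (continuousOn_const.sub (hσ.comp continuousOn_fst
      fun p hp => add_pos hp.1.1 hp.1.2)) fun p hp => hp.1
  · exact fun _ _ _ _ _ => rfl
  · exact fun _ _ _ _ _ => rfl
  · exact fun x hax hbx hxN t => hωN x hax hbx hxN _
  · exact fun x hax hbx hx t => hω1 x hax hbx _ (by linarith)
  · exact fun x hax hbx hx t => hω0 x hax hbx _ (by linarith)

/-- Functions on the two members of a numerable cover that are homotopic on the intersection can
be glued up to homotopy. -/
lemma exists_glue (hac : Continuous a) (hbc : Continuous b) (ha : ∀ x, 0 ≤ a x)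
    (hb : ∀ x, 0 ≤ b x) (hf : Adm N {x | 0 < a x} f) (hg : Adm N {x | 0 < b x} g)
    (h : HomOn N {x | 0 < a x ∧ 0 < b x} f g) :
    ∃ k : Y → M, HomOn N {x | 0 < a x} f k ∧ HomOn N {x | 0 < b x} g k := by
  classical
  have hC : IsOpen {x | 0 < a x ∧ 0 < b x} :=
    (isOpen_lt continuous_const hac).inter (isOpen_lt continuous_const hbc)
  obtain ⟨F, hF, hF0, hF1, hFN⟩ := h
  simp only [Set.mem_ofPred_eq] at hF0 hF1 hFN
  have hσ : ContinuousOn (fun p : Y × ℝ => transition a b p.1)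
      ({x | 0 < a x ∧ 0 < b x} ×ˢ Set.univ) :=
    (continuousOn_transition hac hbc).comp continuousOn_fst fun p hp => add_pos hp.1.1 hp.1.2
  refine ⟨fun x => if 0 < a x ∧ 0 < b x then F (x, transition a b x) else
    if 0 < a x then f x else g x, ?_, ?_⟩
  -- The transition parameter is at most `3/2`, so a shift by `-2` puts it where `F` equals `f`. On
  -- the other side it is at least `-1/2`, and a shift by `2` puts it where `F` equals `g`.
  · refine ⟨fun p => if 0 < a p.1 ∧ 0 < b p.1 then
      F (p.1, transition a b p.1 - 2 + 2 * min p.2 1) else f p.1, ?_, ?_, ?_, ?_⟩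
    · refine continuousOn_of_locally_eq fun p hp => ?_
      rcases (hb p.1).eq_or_lt with h | h
      · refine ⟨{p | 3 * b p.1 < a p.1}, isOpen_lt (by fun_prop) (by fun_prop), ?_,
          fun p => f p.1, hf.1.comp continuousOn_fst fun q hq => ?_, fun q hq => ?_⟩
        · have : 0 < a p.1 := hp.1
          change 3 * b p.1 < a p.1
          linarith
        · have h1 : 3 * b q.1 < a q.1 := hq
          have := hb q.1
          exact lt_of_le_of_lt (by linarith) h1
        · have := transition_le hb hq
          have h3 := min_le_right q.2 1
          dsimp only
          split_ifs with h2
          · exact hF0 _ h2 _ (by linarith)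
          · rfl
      · refine ⟨_, hC.prod isOpen_univ, ⟨⟨hp.1, h⟩, Set.mem_univ _⟩, _,
          continuousOn_comp_time hF ((hσ.sub continuousOn_const).add
            (Continuous.continuousOn (by fun_prop : Continuous fun p : Y × ℝ => 2 * min p.2 1)))
            fun p hp => hp.1, fun q hq => if_pos hq.1⟩
    · intro x hx t ht
      have hx' : 0 < a x := hx
      dsimp only
      split_ifs with h2
      · have h3 := (transition_bounds (ha x) (hb x) (by linarith)).2
        have := min_le_left t 1
        exact hF0 _ h2 _ (by linarith)
      · rfl
    · intro x hx t ht
      have hx' : 0 < a x := hx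
      simp only [min_eq_right ht, hx', true_and, if_true]
      split_ifs with h2
      · congr 2; ring
      · rfl
    · intro x hx hxN t
      dsimp only
      split_ifs with h2
      · exact hFN _ h2 hxN _
      · exact hf.2 _ hx hxN
  · refine ⟨fun p => if 0 < a p.1 ∧ 0 < b p.1 then
      F (p.1, transition a b p.1 + 2 - 2 * min p.2 1) else g p.1, ?_, ?_, ?_, ?_⟩
    · refine continuousOn_of_locally_eq fun p hp => ?_
      rcases (ha p.1).eq_or_lt with h | h
      · refine ⟨{p | 3 * a p.1 < b p.1}, isOpen_lt (by fun_prop) (by fun_prop), ?_,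
          fun p => g p.1, hg.1.comp continuousOn_fst fun q hq => ?_, fun q hq => ?_⟩
        · have : 0 < b p.1 := hp.1
          change 3 * a p.1 < b p.1
          linarith
        · have h1 : 3 * a q.1 < b q.1 := hq
          have := ha q.1
          exact lt_of_le_of_lt (by linarith) h1
        · have := le_transition ha hq
          have h3 := min_le_right q.2 1
          dsimp only
          split_ifs with h2
          · exact hF1 _ h2 _ (by linarith)
          · rfl
      · refine ⟨_, hC.prod isOpen_univ, ⟨⟨h, hp.1⟩, Set.mem_univ _⟩, _,
          continuousOn_comp_time hF ((hσ.add continuousOn_const).sub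
            (Continuous.continuousOn (by fun_prop : Continuous fun p : Y × ℝ => 2 * min p.2 1)))
            fun p hp => hp.1, fun q hq => if_pos hq.1⟩
    · intro x hx t ht
      have hx' : 0 < b x := hx
      dsimp only
      split_ifs with h2
      · have h3 := (transition_bounds (ha x) (hb x) (by linarith [h2.1])).1
        have := min_le_left t 1
        exact hF1 _ h2 _ (by linarith)
      · rfl
    · intro x hx t ht
      have hx' : 0 < b x := hx
      simp only [min_eq_right ht, hx', and_true]
      split_ifs with h2
      · congr 2; ring
      · rfl
    · intro x hx hxN t
      dsimp only
      split_ifs with h2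
      · exact hFN _ h2 hxN _
      · exact hg.2 _ hx hxN

/-- A function that is invertible up to homotopy on both members of a numerable cover by two open
sets is invertible up to homotopy. -/
lemma unitOn_of_unitOn_unitOn (hac : Continuous a) (hbc : Continuous b) (ha : ∀ x, 0 ≤ a x)
    (hb : ∀ x, 0 ≤ b x) (hf : Adm N {x | 0 < a x + b x} f) (hA : UnitOn N {x | 0 < a x} f)
    (hB : UnitOn N {x | 0 < b x} f) : UnitOn N {x | 0 < a x + b x} f := by
  have oA : IsOpen {x | 0 < a x} := isOpen_lt continuous_const hac
  have oB : IsOpen {x | 0 < b x} := isOpen_lt continuous_const hbc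
  have oC : IsOpen {x | 0 < a x ∧ 0 < b x} := oA.inter oB
  have oD : IsOpen {x | 0 < a x + b x} := isOpen_lt continuous_const (by fun_prop)
  have sA : {x | 0 < a x} ⊆ {x | 0 < a x + b x} := fun x hx => add_pos_of_pos_of_nonneg hx (hb x)
  have sB : {x | 0 < b x} ⊆ {x | 0 < a x + b x} := fun x hx => add_pos_of_nonneg_of_pos (ha x) hx
  obtain ⟨α, hα, hfα, hαf⟩ := hA
  obtain ⟨β, hβ, hfβ, hβf⟩ := hB
  have hC1 : {x | 0 < a x ∧ 0 < b x} ⊆ {x | 0 < a x} := fun x hx => hx.1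
  have hC2 : {x | 0 < a x ∧ 0 < b x} ⊆ {x | 0 < b x} := fun x hx => hx.2
  -- The local inverses are homotopic on the overlap. Their gluing `δ` need not be an inverse, since
  -- the null homotopies of `f * δ` on the two sets need not match.
  obtain ⟨δ, hδα, hδβ⟩ := exists_glue hac hbc ha hb hα hβ
    (homOn_of_inverse oC (hα.mono hC1) (hβ.mono hC2) (hαf.mono hC1) (hfβ.mono hC2))
  have fA := (hf.mono sA).homOn_refl
  have fB := (hf.mono sB).homOn_refl
  have hδ : Adm N {x | 0 < a x + b x} δ := by
    refine ⟨continuousOn_of_locally_eq fun p hp => ?_, fun x hx hxN => ?_⟩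
    · rcases (ha p).eq_or_lt with h | h
      · refine ⟨_, oB, ?_, δ, hδβ.adm_right.1, fun _ _ => rfl⟩
        have : 0 < a p + b p := hp
        change 0 < b p
        linarith
      · exact ⟨_, oA, h, δ, hδα.adm_right.1, fun _ _ => rfl⟩
    · have : 0 < a x + b x := hx
      rcases (ha x).eq_or_lt with h | h
      · exact hδβ.adm_right.2 x (show 0 < b x by linarith) hxN
      · exact hδα.adm_right.2 x h hxN
  -- Being null on each set, `f * δ` and `δ * f` are invertible. This corrects `δ` to a right
  -- inverse `δ * g` and a left inverse `g' * δ` of `f`.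
  obtain ⟨g, hg, h1, -⟩ := unitOn_of_null_null hac hbc ha hb
    ((fA.mul oA hδα.symm).trans oA hfα) ((fB.mul oB hδβ.symm).trans oB hfβ)
  obtain ⟨g', hg', -, h2⟩ := unitOn_of_null_null hac hbc ha hb
    ((hδα.symm.mul oA fA).trans oA hαf) ((hδβ.symm.mul oB fB).trans oB hβf)
  refine UnitOn.of_left_right oD hf (hg'.mul oD hδ) (hδ.mul oD hg) ?_ ?_
  · rwa [mul_assoc]
  · rwa [← mul_assoc]

end MayerVietoris

end PtdCG

/-! ### Gluing over countable covers. -/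

namespace PtdCG

variable {M : PtdCG.{u}} [CGMonoid M] {Y : Type u} [TopologicalSpace Y]
  {N A B : Set Y} {f g k f' g' : Y → M}

lemma continuousOn_of_pieces {U : Set Y} (hU : IsOpen U) {m : Y → ℤ}
    (hm : ∀ x ∈ U, ∀ᶠ y in 𝓝 x, m y = m x) {V : ℤ → Set Y} (hV : ∀ x ∈ U, x ∈ V (m x))
    {G : ℤ → Y × ℝ → M} (hG : ∀ j, ContinuousOn (G j) (V j ×ˢ Set.univ)) :
    ContinuousOn (fun p => G (m p.1) p) (U ×ˢ Set.univ) := by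
  refine continuousOn_of_locally_eq fun p hp => ?_
  obtain ⟨O, hO, hOo, hpO⟩ := mem_nhds_iff.1 (hm p.1 hp.1)
  refine ⟨(U ∩ O) ×ˢ Set.univ, (hU.inter hOo).prod isOpen_univ, ⟨⟨hp.1, hpO⟩, Set.mem_univ _⟩,
    G (m p.1), (hG _).mono fun q hq => ⟨?_, Set.mem_univ _⟩, fun q hq => ?_⟩
  · have := hV q.1 hq.1.1
    rwa [show m q.1 = m p.1 from hO hq.1.2] at this
  · have : m q.1 = m p.1 := hO hq.1.2
    simp only [this]

lemma HomOn.of_pieces {U : Set Y} (hU : IsOpen U) {m : Y → ℤ}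
    (hm : ∀ x ∈ U, ∀ᶠ y in 𝓝 x, m y = m x) {V : ℤ → Set Y} (hV : ∀ x ∈ U, x ∈ V (m x))
    {u v : ℤ → Y → M} (h : ∀ j, HomOn N (V j) (u j) (v j)) :
    HomOn N U (fun x => u (m x) x) (fun x => v (m x) x) := by
  choose F hF h0 h1 hN using h
  exact ⟨fun p => F (m p.1) p, continuousOn_of_pieces hU hm hV hF,
    fun x hx t ht => h0 _ x (hV x hx) t ht, fun x hx t ht => h1 _ x (hV x hx) t ht,
    fun x hx hxN t => hN _ x (hV x hx) hxN t⟩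

/-- Invertibility up to homotopy is inherited by disjoint unions of open sets. -/
lemma UnitOn.of_pieces {U : Set Y} (hU : IsOpen U) {m : Y → ℤ}
    (hm : ∀ x ∈ U, ∀ᶠ y in 𝓝 x, m y = m x) {V : ℤ → Set Y} (hV : ∀ x ∈ U, x ∈ V (m x))
    (h : ∀ j, UnitOn N (V j) f) : UnitOn N U f := by
  choose g hg h1 h2 using h
  exact ⟨fun x => g (m x) x, (HomOn.of_pieces hU hm hV fun j => (hg j).homOn_refl).adm_left,
    HomOn.of_pieces hU hm hV h1, HomOn.of_pieces hU hm hV h2⟩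

variable [CompactlyGeneratedSpace Y]

/-- The cozero set of a sum of nonnegative functions is the union of the cozero sets, so the gluing
over two sets iterates. -/
lemma unitOn_finset_sum {u : ℕ → Y → ℝ} (hc : ∀ i, Continuous (u i)) (hu : ∀ i x, 0 ≤ u i x)
    (hf : Adm N Set.univ f) (h : ∀ i, UnitOn N {x | 0 < u i x} f) (n : ℕ) :
    UnitOn N {x | 0 < ∑ i ∈ Finset.range n, u i x} f := by
  induction n with
  | zero =>
    have : {x : Y | 0 < ∑ i ∈ Finset.range 0, u i x} = ∅ := by simp
    rw [this]
    refine ⟨1, adm_one, ?_⟩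
    constructor <;>
    exact ⟨fun _ => 1, continuousOn_const, fun x hx => hx.elim, fun x hx => hx.elim,
      fun x hx => hx.elim⟩
  | succ n ih =>
    simp only [Finset.sum_range_succ]
    exact unitOn_of_unitOn_unitOn (continuous_finsetSum _ fun i _ => hc i) (hc n)
      (fun x => Finset.sum_nonneg fun i _ => hu i x) (hu n) (hf.mono (Set.subset_univ _)) ih (h n)

/-- A nonzero sine keeps `κ x` away from the integers, where the floor jumps. -/
lemma eventually_floor_eq {κ : Y → ℝ} (hκ : Continuous κ) {x : Y}
    (h : 0 < Real.sin (Real.pi * κ x) ^ 2) : ∀ᶠ y in 𝓝 x, ⌊κ y⌋ = ⌊κ x⌋ := by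
  have h1 : (⌊κ x⌋ : ℝ) < κ x := by
    refine lt_of_le_of_ne (Int.floor_le _) fun h2 => ?_
    rw [← h2, mul_comm, Real.sin_int_mul_pi] at h
    simp at h
  filter_upwards [hκ.continuousAt.eventually (lt_mem_nhds h1),
    hκ.continuousAt.eventually (gt_mem_nhds (Int.lt_floor_add_one (κ x)))] with y hy hy'
  exact Int.floor_eq_iff.2 ⟨hy.le, hy'⟩

/-- A function that is invertible up to homotopy on the members of a countable cover by cozero
sets is invertible up to homotopy. -/
lemma unitOn_univ_of_countable_cover {u : ℕ → Y → ℝ} (hc : ∀ i, Continuous (u i))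
    (hu : ∀ i x, 0 ≤ u i x) (hcov : ∀ x, ∃ i, 0 < u i x) (hf : Adm N Set.univ f)
    (h : ∀ i, UnitOn N {x | 0 < u i x} f) : UnitOn N Set.univ f := by
  have hfin := unitOn_finset_sum hc hu hf h
  -- The reciprocal of `∑ w i` is a continuous exhaustion function: where it is below `2 ^ n`, one
  -- of `u 0, …, u n` is positive. Its slabs reduce the countable case to finite unions and disjoint
  -- unions.
  let w : ℕ → Y → ℝ := fun i x => (1 / 2) ^ i * min (u i x) 1
  have hw0 : ∀ i x, 0 ≤ w i x := fun i x =>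
    mul_nonneg (by positivity) (le_min (hu i x) zero_le_one)
  have hw1 : ∀ i x, w i x ≤ (1 / 2) ^ i := fun i x =>
    mul_le_of_le_one_right (by positivity) (min_le_right _ _)
  have hsum : ∀ x, Summable fun i => w i x := fun x =>
    Summable.of_nonneg_of_le (hw0 · x) (hw1 · x) summable_geometric_two
  have hsc : Continuous fun x => ∑' i, w i x := by
    refine continuous_tsum (fun i => ?_) summable_geometric_two fun i x => ?_
    · exact continuous_const.mul ((hc i).min continuous_const)
    · rw [Real.norm_of_nonneg (hw0 i x)]
      exact hw1 i x
  have hspos : ∀ x, 0 < ∑' i, w i x := fun x => by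
    obtain ⟨i, hi⟩ := hcov x
    exact (hsum x).tsum_pos (hw0 · x) i (mul_pos (by positivity) (lt_min hi one_pos))
  have hκ : Continuous fun x => (∑' i, w i x)⁻¹ := hsc.inv₀ fun x => (hspos x).ne'
  have hmem : ∀ (x : Y) (n : ℕ), (∑' i, w i x)⁻¹ < 2 ^ n →
      0 < ∑ i ∈ Finset.range (n + 1), u i x := fun x n hn => by
    refine lt_of_not_ge fun h0 => ?_
    have hz : ∀ i ∈ Finset.range (n + 1), u i x = 0 :=
      (Finset.sum_eq_zero_iff_of_nonneg fun i _ => hu i x).1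
        (le_antisymm h0 (Finset.sum_nonneg fun i _ => hu i x))
    -- If `u 0, …, u n` all vanish at `x`, only the geometric tail from `n + 1` on remains.
    have h1 : ∑' i, w i x ≤ (1 / 2) ^ n := by
      rw [← (hsum x).sum_add_tsum_nat_add (n + 1), Finset.sum_eq_zero, zero_add]
      · calc ∑' i, w (i + (n + 1)) x ≤ ∑' i : ℕ, (1 / 2 : ℝ) ^ (n + 1) * (1 / 2) ^ i := by
              refine Summable.tsum_le_tsum (fun i => ?_)
                ((summable_nat_add_iff (n + 1)).2 (hsum x)) (summable_geometric_two.mul_left _)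
              refine (hw1 _ x).trans (le_of_eq ?_)
              rw [pow_add, mul_comm]
          _ = (1 / 2) ^ n := by
              rw [tsum_mul_left, tsum_geometric_two, pow_succ]
              ring
      · intro i hi
        simp [w, hz i hi]
    rw [one_div, inv_pow] at h1
    exact absurd hn (not_lt.2 (le_inv_of_le_inv₀ (hspos x) h1))
  -- Off the zeros of the sine the slabs between consecutive integers are disjoint and open, and
  -- each lies in a finite union of members of the cover.
  have piece : ∀ c : ℝ, 0 ≤ c → UnitOn N
      {x | 0 < Real.sin (Real.pi * ((∑' i, w i x)⁻¹ + c)) ^ 2} f := fun c hc0 => by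
    refine UnitOn.of_pieces (isOpen_lt continuous_const (by fun_prop))
      (m := fun x => ⌊(∑' i, w i x)⁻¹ + c⌋)
      (V := fun j => {x | 0 < ∑ i ∈ Finset.range (j.toNat + 1 + 1), u i x})
      (fun x hx => eventually_floor_eq (hκ.add continuous_const) hx) (fun x hx => ?_)
      fun j => hfin _
    refine hmem x _ ?_
    have h1 : (∑' i, w i x)⁻¹ < ⌊(∑' i, w i x)⁻¹ + c⌋ + 1 := by
      have := Int.lt_floor_add_one ((∑' i, w i x)⁻¹ + c)
      linarith
    refine h1.trans_le ?_
    set j := ⌊(∑' i, w i x)⁻¹ + c⌋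
    have h2 : (j : ℝ) ≤ (j.toNat : ℝ) := by exact_mod_cast Int.self_le_toNat j
    have h3 : ((j.toNat + 1 : ℕ) : ℝ) ≤ 2 ^ (j.toNat + 1) := by
      exact_mod_cast Nat.lt_two_pow_self.le
    push_cast at h3
    linarith
  have hcos : ∀ x, Real.sin (Real.pi * ((∑' i, w i x)⁻¹ + 1 / 2)) ^ 2 =
      Real.cos (Real.pi * ((∑' i, w i x)⁻¹ + 0)) ^ 2 := fun x => by
    rw [← Real.sin_add_pi_div_two]
    congr 2
    ring
  -- The slabs and their shifts by one half cover everything, because `sin ^ 2 + cos ^ 2 = 1`.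
  have := unitOn_of_unitOn_unitOn (a := fun x => Real.sin (Real.pi * ((∑' i, w i x)⁻¹ + 0)) ^ 2)
    (b := fun x => Real.sin (Real.pi * ((∑' i, w i x)⁻¹ + 1 / 2)) ^ 2) (by fun_prop) (by fun_prop)
    (fun x => sq_nonneg _) (fun x => sq_nonneg _) (hf.mono (Set.subset_univ _))
    (piece 0 le_rfl) (piece (1 / 2) (by norm_num))
  simp only [hcos, Real.sin_sq_add_cos_sq, zero_lt_one, Set.ofPred_true] at this
  exact this

end PtdCG

/-! ### A cover of `X` from the null homotopy of the reduced diagonal. -/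

namespace PtdCG

/-- The data making `(X, *)` an NDR pair, with a real valued function. -/
structure NDRData (X : PtdCG.{u}) where
  ν : X → ℝ
  h : C(X × unitInterval, X)
  ν_continuous : Continuous ν
  ν_nonneg : ∀ x, 0 ≤ ν x
  ν_eq_zero : ∀ x, ν x = 0 ↔ x = X.pt
  h_zero : ∀ x, h (x, 0) = x
  h_pt : ∀ t, h (X.pt, t) = X.pt
  h_one : ∀ x, ν x < 1 → h (x, 1) = X.pt

lemma Nondegenerate.exists_data {X : PtdCG.{u}} (hX : X.Nondegenerate) : Nonempty X.NDRData := by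
  obtain ⟨v, h, h1, h2, h3, h4⟩ := hX
  exact ⟨⟨fun x => v x, h, by fun_prop, fun x => (v x).2.1,
    fun x => by rw [← h1 x]; exact Set.Icc.coe_eq_zero, h2, h3, fun x hx => h4 x hx⟩⟩

variable {X : PtdCG.{u}} (D : X.NDRData)

attribute [fun_prop] NDRData.ν_continuous

namespace NDRData

lemma ν_pt : D.ν X.pt = 0 := (D.ν_eq_zero _).2 rfl

/-- The end of the deformation, retracting a neighbourhood of the base point to the base point. -/
def r (x : X) : X := D.h (x, 1)

lemma continuous_r : Continuous D.r := D.h.continuous.comp (by fun_prop)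

lemma r_pt : D.r X.pt = X.pt := D.h_pt 1

/-- The distance from the wedge in `X ∧ X`. -/
def w : X.smash 2 → ℝ :=
  Quotient.lift (s := X.smashSetoid 2) (fun v : KPow (Fin 2) X => min (D.ν (v 0)) (D.ν (v 1))) <| by
    have key : ∀ v : KPow (Fin 2) X, (∃ i, v i = X.pt) → min (D.ν (v 0)) (D.ν (v 1)) = 0 := by
      rintro v ⟨i, hi⟩
      fin_cases i
      · rw [show v 0 = X.pt from hi, D.ν_pt, min_eq_left (D.ν_nonneg _)]
      · rw [show v 1 = X.pt from hi, D.ν_pt, min_eq_right (D.ν_nonneg _)]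
    rintro a b (h | ⟨ha, hb⟩)
    · rw [h]
    · rw [key a ha, key b hb]

lemma w_mk (v : KPow (Fin 2) X) :
    D.w (Quotient.mk (X.smashSetoid 2) v) = min (D.ν (v 0)) (D.ν (v 1)) := rfl

lemma continuous_w : Continuous D.w := by
  refine Continuous.quotient_lift (s := X.smashSetoid 2) ?_ _
  exact (D.ν_continuous.comp (continuous_coord 0)).min (D.ν_continuous.comp (continuous_coord 1))

lemma w_nonneg (z : X.smash 2) : 0 ≤ D.w z := by
  induction z using Quotient.inductionOn with
  | _ v => exact le_min (D.ν_nonneg _) (D.ν_nonneg _)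

lemma w_pt : D.w (X.smash 2).pt = 0 := by
  change min (D.ν X.pt) (D.ν X.pt) = 0
  rw [D.ν_pt, min_self]

end NDRData

/-- A coordinate of a point of the smash product. -/
noncomputable def smashCoord (X : PtdCG.{u}) (i : Fin 2) (z : X.smash 2) : X :=
  (Quotient.out (s := X.smashSetoid 2) z) i

/-- Off the wedge the equivalence classes are singletons, so the chosen representative is `v`
itself. -/
lemma smashCoord_mk {v : KPow (Fin 2) X} (hv : 0 < D.w (Quotient.mk (X.smashSetoid 2) v))
    (i : Fin 2) : X.smashCoord i (Quotient.mk (X.smashSetoid 2) v) = v i := by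
  rcases Quotient.mk_out (s := X.smashSetoid 2) v with h | ⟨-, j, hj⟩
  · exact congrArg (fun v : KPow (Fin 2) X => v i) h
  · exfalso
    rw [D.w_mk] at hv
    fin_cases j
    · rw [show v 0 = X.pt from hj, D.ν_pt] at hv
      exact absurd hv (not_lt.2 (min_le_left _ _))
    · rw [show v 1 = X.pt from hj, D.ν_pt] at hv
      exact absurd hv (not_lt.2 (min_le_right _ _))

lemma continuousOn_smashCoord (i : Fin 2) : ContinuousOn (X.smashCoord i) {z | 0 < D.w z} := by
  have hO : IsOpen {z | 0 < D.w z} := isOpen_lt continuous_const D.continuous_w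
  refine (continuousOn_open_iff hO).2 fun t ht => ?_
  refine isOpen_coinduced.2 ?_
  have : IsOpen {v : KPow (Fin 2) X | 0 < D.w (Quotient.mk (X.smashSetoid 2) v) ∧ v i ∈ t} :=
    (isOpen_lt continuous_const (D.continuous_w.comp continuous_quotient_mk')).inter
      (ht.preimage (continuous_coord i))
  convert this using 1
  ext v
  refine and_congr_right fun hv => ?_
  exact iff_of_eq (congrArg (· ∈ t) (smashCoord_mk D hv i))

namespace NDRData

/-- A function on `X ∧ X` that is positive at the points off the wedge whose `i`-th coordinate is
near the base point. -/
noncomputable def near (i : Fin 2) : X.smash 2 → ℝ :=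
  fun z => D.w z * max 0 (1 - D.ν (X.smashCoord i z))

/-- At the wedge the coordinate is an arbitrary choice, but there the factor `w` vanishes. -/
lemma continuous_near (i : Fin 2) : Continuous (D.near i) := by
  refine isQuotientMap_quotient_mk'.continuous_iff.2 ?_
  have : Continuous fun v : KPow (Fin 2) X =>
      D.w (Quotient.mk (X.smashSetoid 2) v) * max 0 (1 - D.ν (v i)) :=
    (D.continuous_w.comp continuous_quotient_mk').mul
      (continuous_const.max (continuous_const.sub (D.ν_continuous.comp (continuous_coord i))))
  refine this.congr fun v => ?_
  rcases (D.w_nonneg (Quotient.mk (X.smashSetoid 2) v)).eq_or_lt with h | h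
  · rw [← h, zero_mul]
    refine Eq.symm ?_
    refine (congrArg (· * _) h.symm).trans (zero_mul _)
  · refine congrArg (fun x => D.w (Quotient.mk (X.smashSetoid 2) v) * max 0 (1 - D.ν x)) ?_
    exact (smashCoord_mk D h i).symm

end NDRData

/-- The interval as the image of the reals. -/
noncomputable def toI (t : ℝ) : unitInterval := Set.projIcc 0 1 zero_le_one t

@[fun_prop]
lemma continuous_toI : Continuous toI := continuous_projIcc (h := zero_le_one)

lemma toI_of_nonpos {t : ℝ} (h : t ≤ 0) : toI t = 0 := Set.projIcc_of_le_left _ h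

lemma toI_of_one_le {t : ℝ} (h : 1 ≤ t) : toI t = 1 := Set.projIcc_of_right_le _ h

lemma letter_continuous (X : PtdCG.{u}) : Continuous X.letter := X.jamesIncl.1.continuous

section Cover

variable (H : C(unitInterval × X, X.smash 2))

/-- The function defining a member of the cover of `X` by sets contractible in `X`, obtained from a
null homotopy of the reduced diagonal. -/
noncomputable def coverFun (q : unitInterval) (i : Fin 2) (x : X) : ℝ :=
  max 0 (D.ν x - 1 / 2) * sInf ((fun s => D.w (H (s, x))) '' Set.Icc 0 q) * D.near i (H (q, x))

lemma continuous_coverFun (q : unitInterval) (i : Fin 2) : Continuous (coverFun D H q i) := by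
  have h1 : Continuous fun x : X => sInf ((fun s => D.w (H (s, x))) '' Set.Icc 0 q) := by
    refine IsCompact.continuous_sInf (f := fun (x : X) s => D.w (H (s, x))) isCompact_Icc ?_
    exact D.continuous_w.comp (H.continuous.comp continuous_swap)
  have h2 : Continuous fun x : X => D.near i (H (q, x)) :=
    (D.continuous_near i).comp (H.continuous.comp (by fun_prop))
  exact ((continuous_const.max (D.ν_continuous.sub continuous_const)).mul h1).mul h2

lemma sInf_w_nonneg (q : unitInterval) (x : X) :
    0 ≤ sInf ((fun s => D.w (H (s, x))) '' Set.Icc 0 q) :=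
  Real.sInf_nonneg (by rintro _ ⟨s, -, rfl⟩; exact D.w_nonneg _)

lemma near_nonneg (i : Fin 2) (z : X.smash 2) : 0 ≤ D.near i z :=
  mul_nonneg (D.w_nonneg _) (le_max_left _ _)

lemma coverFun_nonneg (q : unitInterval) (i : Fin 2) (x : X) : 0 ≤ coverFun D H q i x :=
  mul_nonneg (mul_nonneg (le_max_left _ _) (sInf_w_nonneg D H q x)) (near_nonneg D _ _)

/-- The infimum over the compact interval is attained, so its positivity says that the path avoids
the wedge up to time `q`. Along such a path the `i`-th coordinate is defined and ends in the
contractible neighbourhood of the base point. -/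
lemma coverFun_pos {q : unitInterval} {i : Fin 2} {x : X} :
    0 < coverFun D H q i x ↔ 1 / 2 < D.ν x ∧ (∀ s ≤ q, 0 < D.w (H (s, x))) ∧
      D.ν (X.smashCoord i (H (q, x))) < 1 := by
  have hcont : Continuous fun s => D.w (H (s, x)) :=
    D.continuous_w.comp (H.continuous.comp (by fun_prop))
  constructor
  · intro h
    have h1 := pos_of_mul_pos_left h (near_nonneg D _ _)
    have h2 := pos_of_mul_pos_right h (mul_nonneg (le_max_left _ _) (sInf_w_nonneg D H q x))
    have h3 := pos_of_mul_pos_left h1 (sInf_w_nonneg D H q x)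
    have h4 := pos_of_mul_pos_right h1 (le_max_left _ _)
    have h5 := pos_of_mul_pos_right h2 (D.w_nonneg _)
    refine ⟨?_, fun s hs => ?_, ?_⟩
    · rcases lt_max_iff.1 h3 with h | h
      · exact absurd h (lt_irrefl _)
      · linarith
    · refine h4.trans_le (csInf_le ⟨0, ?_⟩ ⟨s, ⟨bot_le, hs⟩, rfl⟩)
      rintro _ ⟨s, -, rfl⟩
      exact D.w_nonneg _
    · rcases lt_max_iff.1 h5 with h | h
      · exact absurd h (lt_irrefl _)
      · linarith
  · rintro ⟨h1, h2, h3⟩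
    refine mul_pos (mul_pos (lt_max_of_lt_right (by linarith)) ?_)
      (mul_pos (h2 q le_rfl) (lt_max_of_lt_right (by linarith)))
    obtain ⟨s, hs, hs'⟩ := ((isCompact_Icc (a := (0 : unitInterval)) (b := q)).image
      hcont).sInf_mem ⟨_, 0, ⟨le_rfl, bot_le⟩, rfl⟩
    rw [← hs']
    exact h2 s hs.2

lemma exists_coverFun_pos (h0 : ∀ x, H (0, x) = X.reducedDiagonal.1 x)
    (h1 : ∀ x, H (1, x) = (X.smash 2).pt) {x : X} (hx : 1 / 2 < D.ν x) :
    ∃ (k : ℕ) (i : Fin 2), 0 < coverFun D H (denseSeq unitInterval k) i x := by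
  have hcont : Continuous fun s => D.w (H (s, x)) :=
    D.continuous_w.comp (H.continuous.comp (by fun_prop))
  have hcl : IsCompact {s | D.w (H (s, x)) = 0} :=
    (isClosed_eq hcont continuous_const).isCompact
  -- `s0` is the first time at which the path meets the wedge. Slightly earlier it is off the wedge
  -- with one coordinate near the base point; that open condition holds at a time from a dense
  -- sequence, so countably many sets suffice.
  obtain ⟨s0, hs0, hmin⟩ := hcl.exists_isLeast ⟨1, by
    change D.w (H (1, x)) = 0
    rw [h1, D.w_pt]⟩
  have hs0' : D.w (H (s0, x)) = 0 := hs0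
  have hne : s0 ≠ 0 := by
    rintro rfl
    rw [h0] at hs0'
    have : min (D.ν x) (D.ν x) = 0 := hs0'
    rw [min_self] at this
    linarith
  have hpos : (0 : unitInterval) < s0 := lt_of_le_of_ne bot_le hne.symm
  have hO : IsOpen {s | D.w (H (s, x)) < 1} := isOpen_lt hcont continuous_const
  have hcls : s0 ∈ closure (Set.Iio s0) := by
    rw [closure_Iio' (a := s0) ⟨(0 : unitInterval), hpos⟩]
    exact Set.mem_Iic.2 le_rfl
  have hnon : ({s | D.w (H (s, x)) < 1} ∩ Set.Iio s0).Nonempty :=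
    mem_closure_iff.1 hcls _ hO (by
      change D.w (H (s0, x)) < 1
      rw [hs0']
      exact one_pos)
  obtain ⟨k, hk, hk'⟩ := (denseRange_denseSeq unitInterval).exists_mem_open
    (hO.inter isOpen_Iio) hnon
  have hw : ∀ s ≤ denseSeq unitInterval k, 0 < D.w (H (s, x)) := fun s hs => by
    refine lt_of_le_of_ne (D.w_nonneg _) fun h => ?_
    exact absurd (hmin h.symm) (not_le.2 (hs.trans_lt hk'))
  have hk2 : D.w (H (denseSeq unitInterval k, x)) < 1 := hk
  have hk3 := hw _ le_rfl
  obtain ⟨v, hv⟩ := Quotient.exists_rep (s := X.smashSetoid 2) (H (denseSeq unitInterval k, x))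
  have hv' : (Quotient.mk (X.smashSetoid 2) v : X.smash 2) = H (denseSeq unitInterval k, x) := hv
  rw [← hv'] at hk2 hk3
  have hc := smashCoord_mk D hk3
  rw [D.w_mk] at hk2
  rcases min_lt_iff.1 hk2 with h | h
  · exact ⟨k, 0, (coverFun_pos D H).2 ⟨hx, hw, by rw [← hv', hc]; exact h⟩⟩
  · exact ⟨k, 1, (coverFun_pos D H).2 ⟨hx, hw, by rw [← hv', hc]; exact h⟩⟩

/-- Undo the retraction `r`, follow the `i`-th coordinate of `H` from `x` to a point with `ν < 1`,
and contract it by `h`. The condition on `N` is vacuous, since these sets lie in `ν > 1/2`. -/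
lemma homOn_coverFun (h0 : ∀ x, H (0, x) = X.reducedDiagonal.1 x) (q : unitInterval) (i : Fin 2) :
    HomOn (M := X.James) {x | D.ν x ≤ 1 / 2} {x | 0 < coverFun D H q i x}
      (fun x => X.letter (D.r x)) 1 := by
  have hU : IsOpen {x | 0 < coverFun D H q i x} :=
    isOpen_lt continuous_const (continuous_coverFun D H q i)
  have hE := X.letter_continuous
  have hN : ∀ x : X, 0 < coverFun D H q i x → D.ν x ≤ 1 / 2 → False := fun x hx hxN =>
    absurd ((coverFun_pos D H).1 hx).1 (not_lt.2 hxN)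
  have hproj : Continuous fun p : X × ℝ => toI p.2 := by fun_prop
  have s1 : HomOn (M := X.James) {x | D.ν x ≤ 1 / 2} {x | 0 < coverFun D H q i x}
      X.letter (fun x => X.letter (D.r x)) := by
    refine ⟨fun p => X.letter (D.h (p.1, toI p.2)), ?_, fun x hx t ht => ?_, fun x hx t ht => ?_,
      fun x hx hxN => (hN x hx hxN).elim⟩
    · exact (hE.comp (D.h.continuous.comp (by fun_prop))).continuousOn
    · simp only [toI_of_nonpos ht, D.h_zero]
      rfl
    · simp only [toI_of_one_le ht, NDRData.r]
      rfl
  have s2 : HomOn (M := X.James) {x | D.ν x ≤ 1 / 2} {x | 0 < coverFun D H q i x}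
      X.letter (fun x => X.letter (X.smashCoord i (H (q, x)))) := by
    refine ⟨fun p => X.letter (X.smashCoord i (H (q * toI p.2, p.1))), ?_, fun x hx t ht => ?_,
      fun x hx t ht => ?_, fun x hx hxN => (hN x hx hxN).elim⟩
    · refine hE.comp_continuousOn ((continuousOn_smashCoord D i).comp
        (H.continuous.comp (by fun_prop)).continuousOn fun p hp => ?_)
      exact ((coverFun_pos D H).1 hp.1).2.1 _ (mul_le_of_le_one_right' le_top)
    · dsimp only
      have h2 : 0 < D.w (H (0, x)) := ((coverFun_pos D H).1 hx).2.1 0 bot_le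
      rw [toI_of_nonpos ht, mul_zero, h0]
      rw [h0] at h2
      exact congrArg X.letter (smashCoord_mk D h2 i)
    · simp only [toI_of_one_le ht, mul_one]
      rfl
  have s3 : HomOn (M := X.James) {x | D.ν x ≤ 1 / 2} {x | 0 < coverFun D H q i x}
      (fun x => X.letter (X.smashCoord i (H (q, x)))) 1 := by
    refine ⟨fun p => X.letter (D.h (X.smashCoord i (H (q, p.1)), toI p.2)), ?_, fun x hx t ht => ?_,
      fun x hx t ht => ?_, fun x hx hxN => (hN x hx hxN).elim⟩
    · refine hE.comp_continuousOn (D.h.continuous.comp_continuousOn (ContinuousOn.prodMk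
        ((continuousOn_smashCoord D i).comp (H.continuous.comp (by fun_prop)).continuousOn
          fun p hp => ?_) hproj.continuousOn))
      exact ((coverFun_pos D H).1 hp.1).2.1 _ le_rfl
    · simp only [toI_of_nonpos ht, D.h_zero]
      rfl
    · simp only [toI_of_one_le ht]
      rw [D.h_one _ ((coverFun_pos D H).1 hx).2.2, X.letter_pt]
      rfl
  exact s1.symm.trans hU (s2.trans hU s3)

end Cover

/-- If the reduced diagonal of `X` is null homotopic then the inclusion `X → J(X)`, deformed to be
trivial near the base point, has an inverse up to homotopy. -/
lemma unitOn_letter (hcat : X.WeakCatLtTwo) :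
    UnitOn (M := X.James) {x | D.ν x ≤ 1 / 2} Set.univ (fun x => X.letter (D.r x)) := by
  obtain ⟨H⟩ := hcat
  have h0 : ∀ x, H.toContinuousMap (0, x) = X.reducedDiagonal.1 x := fun x => H.apply_zero x
  have h1 : ∀ x, H.toContinuousMap (1, x) = (X.smash 2).pt := fun x => H.apply_one x
  have hone : ∀ x, D.ν x < 1 → X.letter (D.r x) = 1 := fun x hx => by
    rw [NDRData.r, D.h_one x hx, X.letter_pt]
  obtain ⟨e, he⟩ := exists_surjective_nat (Option (ℕ × Fin 2))
  -- The extra index `none` stands for the neighbourhood `ν < 1` of the base point, where `r` is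
  -- constant and the function is `1`.
  let u : Option (ℕ × Fin 2) → X → ℝ := fun o => o.elim (fun x => max 0 (1 - D.ν x))
    fun p => coverFun D H.toContinuousMap (denseSeq unitInterval p.1) p.2
  have hc : ∀ o, Continuous (u o) := by
    rintro (_ | p)
    · exact continuous_const.max (continuous_const.sub D.ν_continuous)
    · exact continuous_coverFun D _ _ _
  have hu : ∀ o x, 0 ≤ u o x := by
    rintro (_ | p) x
    · exact le_max_left _ _
    · exact coverFun_nonneg D _ _ _ _
  refine unitOn_univ_of_countable_cover (u := fun n => u (e n)) (fun n => hc _) (fun n => hu _)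
    (fun x => ?_) ⟨(X.letter_continuous.comp D.continuous_r).continuousOn, fun x _ hx => ?_⟩
    fun n => unitOn_of_homOn_one ?_
  · rcases lt_or_ge (1 / 2) (D.ν x) with h | h
    · obtain ⟨k, i, hki⟩ := exists_coverFun_pos D H.toContinuousMap h0 h1 h
      obtain ⟨n, hn⟩ := he (some (k, i))
      exact ⟨n, by rw [hn]; exact hki⟩
    · obtain ⟨n, hn⟩ := he none
      refine ⟨n, ?_⟩
      rw [hn]
      exact lt_max_of_lt_right (by linarith)
  · have : D.ν x ≤ 1 / 2 := hx
    exact hone x (by linarith)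
  · rcases e n with _ | p
    · have : ∀ x ∈ {x | 0 < u none x}, X.letter (D.r x) = (1 : X.James) := fun x hx => by
        refine hone x ?_
        rcases lt_max_iff.1 (show 0 < max 0 (1 - D.ν x) from hx) with h | h
        · exact absurd h (lt_irrefl _)
        · linarith
      exact (adm_one.homOn_refl).congr (fun x hx => (this x hx).symm) fun _ _ => rfl
    · exact homOn_coverFun D _ h0 _ _

end PtdCG

/-! ### Inverses in the James construction; `[Y, J(X)]` is a group. -/

namespace PtdCG

variable {X : PtdCG.{u}}

lemma word_zero (v : KPow (Fin 0) X) : X.word v = 1 := by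
  simp [word]

lemma word_succ {k : ℕ} (v : KPow (Fin (k + 1)) X) :
    X.word v = X.letter (v 0) * X.word (⟨fun i => v i.succ⟩ : KPow (Fin k) X) := by
  simp [word, List.ofFn_succ]

lemma continuous_from_word {T : Type*} [TopologicalSpace T] {f : X.Word → T}
    (h : ∀ k, Continuous fun v : KPow (Fin k) X => f (X.word v)) : Continuous f :=
  X.isQuotientMap_wordSigma.continuous_iff.2 (continuous_sigma h)

lemma continuous_from_word_prod {T K : Type*} [TopologicalSpace T] [TopologicalSpace K]
    [LocallyCompactSpace K] {f : X.Word × K → T}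
    (h : ∀ k, Continuous fun p : KPow (Fin k) X × K => f (X.word p.1, p.2)) : Continuous f := by
  refine X.isQuotientMap_wordSigma.continuous_lift_prod_left ?_
  rw [← (Homeomorph.sigmaProdDistrib (X := fun k : ℕ => KPow (Fin k) X)
    (Y := K)).symm.comp_continuous_iff', continuous_sigma_iff]
  exact h

lemma word_induction {p : X.Word → Prop} (h1 : p 1) (h : ∀ x w, p w → p (X.letter x * w))
    (w : X.Word) : p w := by
  obtain ⟨⟨k, v⟩, rfl⟩ := X.wordSigma_surjective w
  change p (X.word v)
  induction k with
  | zero => rwa [word_zero]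
  | succ k ih =>
    rw [word_succ]
    exact h _ _ (ih _)

/-- Recursion on words: a step function for which the base point acts trivially on all the values
that occur. -/
noncomputable def wordRec {S : Type*} (s : S) (step : X → S → S) (w : X.Word) : S :=
  (FreeMonoid.toList (α := {x : X // x ≠ X.pt}) w).foldr (fun x a => step x a) s

/-- A base point letter is invisible in the reduced word; `h` makes the recursion formula hold for
it too, which continuity in all letters requires. -/
lemma wordRec_letter_mul {S : Type*} (s : S) (step : X → S → S) (x : X) (w : X.Word)
    (h : step X.pt (wordRec s step w) = wordRec s step w) :
    wordRec s step (X.letter x * w) = step x (wordRec s step w) := by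
  by_cases hx : x = X.pt
  · rw [hx, letter_pt, one_mul, h]
  · rw [letter_of_ne X hx]
    rfl

variable {M : PtdCG.{u}} [CGMonoid M]

/-- The homomorphism on words extending a pointed function on letters. -/
noncomputable def wordLift (φ : X → M) : X.Word → M := wordRec 1 fun x a => φ x * a

lemma wordLift_one (φ : X → M) : wordLift φ (1 : X.Word) = 1 := rfl

lemma wordLift_letter_mul {φ : X → M} (hφ : φ X.pt = 1) (x : X) (w : X.Word) :
    wordLift φ (X.letter x * w) = φ x * wordLift φ w :=
  wordRec_letter_mul _ _ _ _ (by rw [hφ, one_mul])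

lemma continuous_wordLift_word {W : Type u} [TopologicalSpace W] [CompactlyGeneratedSpace W]
    {φ : W → X → M} (hφ : ∀ s, φ s X.pt = 1)
    (hc : ∀ f : W → X, Continuous f → Continuous fun s => φ s (f s)) {k : ℕ}
    {v : W → KPow (Fin k) X} (hv : Continuous v) :
    Continuous fun s => wordLift (φ s) (X.word (v s)) := by
  induction k with
  | zero =>
    simp only [word_zero, wordLift_one]
    exact continuous_const
  | succ k ih =>
    simp only [word_succ, wordLift_letter_mul (hφ _)]
    exact CGMonoid.continuous_mul (hc _ ((continuous_coord 0).comp hv))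
      (ih (continuous_KPow fun i => (continuous_coord i.succ).comp hv))

/-- The antihomomorphism on words extending a pointed function on letters. -/
noncomputable def wordAnti (φ : X → M) : X.Word → M := wordRec 1 fun x a => a * φ x

lemma wordAnti_letter_mul {φ : X → M} (hφ : φ X.pt = 1) (x : X) (w : X.Word) :
    wordAnti φ (X.letter x * w) = wordAnti φ w * φ x :=
  wordRec_letter_mul _ _ _ _ (by rw [hφ, mul_one])

lemma wordAnti_one (φ : X → M) : wordAnti φ (1 : X.Word) = 1 := rfl

lemma continuous_wordAnti_word {φ : X → M} (hφ : φ X.pt = 1) (hc : Continuous φ) {W : Type u}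
    [TopologicalSpace W] [CompactlyGeneratedSpace W] {k : ℕ}
    {v : W → KPow (Fin k) X} (hv : Continuous v) :
    Continuous fun s => wordAnti φ (X.word (v s)) := by
  induction k with
  | zero =>
    simp only [word_zero, wordAnti_one]
    exact continuous_const
  | succ k ih =>
    simp only [word_succ, wordAnti_letter_mul hφ]
    exact CGMonoid.continuous_mul (ih (continuous_KPow fun i => (continuous_coord i.succ).comp hv))
      (hc.comp ((continuous_coord 0).comp hv))

section MoorePath

/-- A pointed function `e` together with a right inverse `χ` and Moore paths from `e x * χ x` to
`1`, which have length `l x`. -/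
structure MooreInverse (X M : PtdCG.{u}) [CGMonoid M] where
  e : X → M
  χ : X → M
  F : X × ℝ → M
  l : X → ℝ
  e_continuous : Continuous e
  χ_continuous : Continuous χ
  F_continuous : Continuous F
  l_continuous : Continuous l
  l_nonneg : ∀ x, 0 ≤ l x
  e_pt : e X.pt = 1
  χ_pt : χ X.pt = 1
  l_pt : l X.pt = 0
  F_zero : ∀ x, F (x, 0) = e x * χ x
  F_end : ∀ x t, l x ≤ t → F (x, t) = 1

variable (P : MooreInverse X M)

namespace MooreInverse

/-- The Moore path from `e w * χ w` to `1` for a word `w`, together with its length. -/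
noncomputable def pathAux : X.Word → (ℝ → M) × ℝ :=
  wordRec (fun _ => 1, 0) fun x a =>
    (fun t => if t ≤ a.2 then P.e x * a.1 t * P.χ x else P.F (x, t - a.2), P.l x + a.2)

/-- The path cancels the inner word first, between `e x` and `χ x`, and then runs the path of `x`. A
base point letter adds a path of length zero and changes nothing; this is why Moore paths are used.
-/
lemma pathAux_letter_mul (x : X) (w : X.Word)
    (h : ∀ t, (P.pathAux w).2 ≤ t → (P.pathAux w).1 t = 1) :
    P.pathAux (X.letter x * w) = (fun t => if t ≤ (P.pathAux w).2 then
      P.e x * (P.pathAux w).1 t * P.χ x else P.F (x, t - (P.pathAux w).2),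
      P.l x + (P.pathAux w).2) := by
  refine wordRec_letter_mul _ _ _ _ ?_
  change ((fun t => if t ≤ (P.pathAux w).2 then P.e X.pt * (P.pathAux w).1 t * P.χ X.pt
      else P.F (X.pt, t - (P.pathAux w).2), P.l X.pt + (P.pathAux w).2) : (ℝ → M) × ℝ) =
    P.pathAux w
  refine Prod.ext (funext fun t => ?_) ?_
  · dsimp only
    split_ifs with ht
    · rw [P.e_pt, P.χ_pt, one_mul, mul_one]
    · push Not at ht
      rw [h t ht.le, P.F_end]
      rw [P.l_pt]
      linarith
  · dsimp only
    rw [P.l_pt, zero_add]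

lemma pathAux_end (w : X.Word) : ∀ t, (P.pathAux w).2 ≤ t → (P.pathAux w).1 t = 1 := by
  induction w using word_induction with
  | h1 => exact fun _ _ => rfl
  | h x w ih =>
    intro t ht
    rw [P.pathAux_letter_mul x w ih] at ht ⊢
    dsimp only at ht ⊢
    have := P.l_nonneg x
    split_ifs with h
    · have h2 : t = (P.pathAux w).2 := by linarith
      rw [ih t h2.ge, mul_one, ← P.F_zero, P.F_end _ _ (by linarith)]
    · exact P.F_end _ _ (by linarith)

lemma pathAux_snd_nonneg (w : X.Word) : 0 ≤ (P.pathAux w).2 := by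
  induction w using word_induction with
  | h1 => exact le_rfl
  | h x w ih =>
    rw [P.pathAux_letter_mul x w (P.pathAux_end w)]
    exact add_nonneg (P.l_nonneg x) ih

lemma pathAux_zero (w : X.Word) : (P.pathAux w).1 0 = wordLift P.e w * wordAnti P.χ w := by
  induction w using word_induction with
  | h1 => exact (mul_one _).symm
  | h x w ih =>
    rw [P.pathAux_letter_mul x w (P.pathAux_end w)]
    dsimp only
    rw [if_pos (P.pathAux_snd_nonneg w), ih, wordLift_letter_mul P.e_pt, wordAnti_letter_mul P.χ_pt]
    simp only [mul_assoc]

/-- At the junction time both formulas give `e x * χ x`, the inner word having been cancelled. -/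
lemma continuous_pathAux {W : Type u} [TopologicalSpace W] [CompactlyGeneratedSpace W] {k : ℕ}
    {v : W → KPow (Fin k) X} (hv : Continuous v) :
    Continuous (fun s => (P.pathAux (X.word (v s))).2) ∧ ∀ t : W → ℝ, Continuous t →
      Continuous fun s => (P.pathAux (X.word (v s))).1 (t s) := by
  induction k with
  | zero =>
    simp only [word_zero]
    exact ⟨continuous_const, fun _ _ => continuous_const⟩
  | succ k ih =>
    obtain ⟨h1, h2⟩ := ih (v := fun s => ⟨fun i => v s i.succ⟩)
      (continuous_KPow fun i => (continuous_coord i.succ).comp hv)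
    have h0 := (continuous_coord 0).comp hv
    simp only [word_succ, P.pathAux_letter_mul _ _ (P.pathAux_end _)]
    refine ⟨(P.l_continuous.comp h0).add h1, fun t ht => ?_⟩
    refine Continuous.if_le ?_ ?_ ht h1 fun s hs => ?_
    · exact CGMonoid.continuous_mul (CGMonoid.continuous_mul (P.e_continuous.comp h0) (h2 t ht))
        (P.χ_continuous.comp h0)
    · exact P.F_continuous.comp (h0.prodMk (ht.sub h1))
    · rw [hs, sub_self, P.F_zero, P.pathAux_end _ _ le_rfl, mul_one]

end MooreInverse

end MoorePath

/-- The identity as a pointed map. -/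
def PMap.id (Y : PtdCG.{u}) : PMap Y Y := ⟨ContinuousMap.id Y, rfl⟩

lemma PMap.homotopic_of {Y Z : PtdCG.{u}} {f g : PMap Y Z} (F : Y × unitInterval → Z)
    (hF : Continuous F) (h0 : ∀ y, F (y, 0) = f.1 y) (h1 : ∀ y, F (y, 1) = g.1 y)
    (hpt : ∀ t, F (Y.pt, t) = Z.pt) : PMap.Homotopic f g := by
  refine ⟨⟨⟨⟨fun p => F (p.2, p.1), hF.comp continuous_swap⟩, h0, h1⟩, ?_⟩⟩
  rintro t y rfl
  exact (hpt t).trans f.2.symm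

/-- In the James construction the identity has a right inverse up to homotopy. -/
lemma exists_james_inverse (D : X.NDRData) (hcat : X.WeakCatLtTwo) :
    ∃ χ : PMap X.James X.James, PMap.Homotopic ((PMap.id X.James).mul χ) (PMap.const _ _) := by
  obtain ⟨χ, hχ, ⟨F, hF, hF0, hF1, hFN⟩, -⟩ := unitOn_letter D hcat
  have hN : ∀ x, D.ν x ≤ 1 / 2 → ∀ t, F (x, t) = 1 := fun x hx t => hFN x trivial hx t
  let P : MooreInverse X X.James :=
    { e := fun x => X.letter (D.r x)
      χ := χ
      -- With length `ν x`, the doubled speed finishes in time when `ν x > 1/2`; when `ν x ≤ 1/2`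
      -- the homotopy is constantly `1`.
      F := fun p => F (p.1, 2 * p.2)
      l := D.ν
      e_continuous := X.letter_continuous.comp D.continuous_r
      χ_continuous := continuousOn_univ.1 hχ.1
      F_continuous := by
        rw [Set.univ_prod_univ, continuousOn_univ] at hF
        exact hF.comp (by fun_prop)
      l_continuous := D.ν_continuous
      l_nonneg := D.ν_nonneg
      e_pt := by
        rw [D.r_pt, X.letter_pt]
        rfl
      χ_pt := hχ.2 _ trivial (by
        change D.ν X.pt ≤ 1 / 2
        rw [D.ν_pt]
        norm_num)
      l_pt := D.ν_pt
      F_zero := fun x => by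
        dsimp only
        rw [mul_zero, hF0 x trivial 0 le_rfl]
        exact rfl
      F_end := fun x t ht => by
        rcases le_or_gt (D.ν x) (1 / 2) with h | h
        · exact hN x h _
        · exact hF1 x trivial _ (by linarith) }
  let χJ : PMap X.James X.James :=
    ⟨⟨wordAnti P.χ, continuous_from_word fun k =>
      continuous_wordAnti_word P.χ_pt P.χ_continuous continuous_id⟩, rfl⟩
  let E : X → X.James := X.letter
  have hE : E X.pt = 1 := X.letter_pt
  have hrt : ∀ t : unitInterval, E (D.h (X.pt, t)) = 1 := fun t => by rw [D.h_pt, hE]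
  let rJ : PMap X.James X.James :=
    ⟨⟨wordLift P.e, continuous_from_word fun k =>
      continuous_wordLift_word (φ := fun _ => P.e) (fun _ => P.e_pt)
        (fun f hf => P.e_continuous.comp hf) continuous_id⟩, rfl⟩
  refine ⟨χJ, ?_⟩
  -- The inverse exists only for letters deformed by `r`; applying the NDR homotopy letter by letter
  -- deforms the identity accordingly.
  have h1 : PMap.Homotopic (PMap.id X.James) rJ := by
    refine PMap.homotopic_of (fun p => wordLift (fun x => E (D.h (x, p.2))) p.1)
      ?_ (fun w => ?_) (fun w => rfl) fun t => rfl
    · refine continuous_from_word_prod fun k => ?_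
      refine continuous_wordLift_word
        (φ := fun (p : KPow (Fin k) X × unitInterval) x => E (D.h (x, p.2)))
        (fun p => hrt p.2) (fun f hf => ?_) continuous_fst
      exact X.letter_continuous.comp (D.h.continuous.comp (hf.prodMk continuous_snd))
    · change wordLift (fun x => E (D.h (x, 0))) w = w
      simp only [D.h_zero]
      induction w using word_induction with
      | h1 => rfl
      | h x w ih =>
        rw [wordLift_letter_mul hE, ih]
        rfl
  have h2 : PMap.Homotopic (rJ.mul χJ) (PMap.const _ _) := by
    -- The Moore path is rescaled to unit length.
    refine PMap.homotopic_of (fun p => (P.pathAux p.1).1 (p.2 * (P.pathAux p.1).2)) ?_ (fun w => ?_)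
      (fun w => ?_) fun t => rfl
    · refine continuous_from_word_prod fun k => ?_
      obtain ⟨h1, h2⟩ := P.continuous_pathAux
        (continuous_fst : Continuous fun p : KPow (Fin k) X × unitInterval => p.1)
      exact h2 _ ((continuous_subtype_val.comp continuous_snd).mul h1)
    · simp only [Set.Icc.coe_zero, zero_mul]
      exact P.pathAux_zero w
    · simp only [Set.Icc.coe_one, one_mul]
      exact P.pathAux_end w _ le_rfl
  exact ContinuousMap.HomotopicRel.trans
    (PMap.mul_homotopic h1 (ContinuousMap.HomotopicRel.refl χJ.1)) h2

/-- The composite of pointed maps. -/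
def PMap.comp {Y Z W : PtdCG.{u}} (g : PMap Z W) (f : PMap Y Z) : PMap Y W :=
  ⟨g.1.comp f.1, by rw [ContinuousMap.comp_apply, f.2, g.2]⟩

lemma mk_mul_mk {Y : PtdCG.{u}} (f g : PMap Y M) :
    (⟦f⟧ : HClass Y M) * ⟦g⟧ = ⟦f.mul g⟧ := rfl

lemma pullback_mk {Y Y' : PtdCG.{u}} (g : PMap Y' Y) (f : PMap Y M) :
    pullback M g ⟦f⟧ = ⟦f.comp g⟧ := rfl

/-- A topological monoid whose identity map has a right inverse up to homotopy. -/
structure HInverse (M : PtdCG.{u}) [CGMonoid M] where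
  χ : PMap M M
  k : M × unitInterval → M
  k_continuous : Continuous k
  k_zero : ∀ a, k (a, 0) = a * χ.1 a
  k_one : ∀ a, k (a, 1) = 1
  k_unit : ∀ t, k (1, t) = 1

lemma exists_hInverse (hX : X.Nondegenerate) (hcat : X.WeakCatLtTwo) :
    Nonempty (HInverse X.James) := by
  obtain ⟨D⟩ := hX.exists_data
  obtain ⟨χ, ⟨H⟩⟩ := exists_james_inverse D hcat
  refine ⟨⟨χ, fun p => H (p.2, p.1), H.continuous.comp continuous_swap,
    fun a => H.apply_zero a, fun a => H.apply_one a, fun t => ?_⟩⟩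
  exact (H.eq_fst t (x := X.James.pt) rfl).trans ((PMap.id X.James).mul χ).2

namespace HInverse

variable (I : HInverse M) {Y : PtdCG.{u}}

lemma χ_one : I.χ.1 1 = 1 := by
  have h : ∀ a : M, a = M.pt → I.χ.1 a = a := by
    rintro _ rfl
    exact I.χ.2
  exact h 1 CGMonoid.pt_eq.symm

lemma mk_mul_comp (f : PMap Y M) : (⟦f⟧ : HClass Y M) * ⟦I.χ.comp f⟧ = 1 := by
  refine Quotient.sound (PMap.homotopic_of (fun p => I.k (f.1 p.1, p.2)) ?_ (fun y => ?_)
    (fun y => ?_) fun t => ?_)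
  · exact I.k_continuous.comp ((f.1.continuous.comp continuous_fst).prodMk continuous_snd)
  · exact I.k_zero _
  · exact (I.k_one _).trans CGMonoid.pt_eq.symm
  · dsimp only
    rw [f.2, CGMonoid.pt_eq]
    exact I.k_unit t

lemma isUnit (I : HInverse M) (a : HClass Y M) : IsUnit a := by
  -- Right inverses for all elements of a monoid make it a group.
  have h : ∀ a : HClass Y M, ∃ b, a * b = 1 := by
    rintro ⟨f⟩
    exact ⟨_, I.mk_mul_comp f⟩
  obtain ⟨b, hb⟩ := h a
  obtain ⟨c, hc⟩ := h b
  have : a = c := by rw [← mul_one a, ← hc, ← mul_assoc, hb, one_mul]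
  exact ⟨⟨a, b, hb, by rw [this, hc]⟩, rfl⟩

end HInverse

end PtdCG

/-! ### Trivialising maps near coordinate hyperplanes; commuting classes. -/

namespace PtdCG

variable {X M : PtdCG.{u}} [CGMonoid M] {ι : Type} [DecidableEq ι]

/-- Replace a coordinate. -/
def setCoord (v : KPow ι X) (i : ι) (x : X) : KPow ι X := ⟨Function.update v.coord i x⟩

lemma setCoord_same (v : KPow ι X) (i : ι) (x : X) : setCoord v i x i = x :=
  Function.update_self _ _ _

lemma setCoord_of_ne (v : KPow ι X) {i j : ι} (h : j ≠ i) (x : X) : setCoord v i x j = v j :=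
  Function.update_of_ne h _ _

lemma setCoord_self (v : KPow ι X) (i : ι) : setCoord v i (v i) = v :=
  congrArg KPow.mk (Function.update_eq_self _ _)

lemma setCoord_pt (i : ι) : setCoord (X.pow ι).pt i X.pt = (X.pow ι).pt :=
  setCoord_self (X.pow ι).pt i

lemma continuous_setCoord {W : Type u} [TopologicalSpace W] [CompactlyGeneratedSpace W]
    {v : W → KPow ι X} {x : W → X} (i : ι) (hv : Continuous v) (hx : Continuous x) :
    Continuous fun s => setCoord (v s) i (x s) := by
  refine continuous_KPow fun j => ?_
  by_cases h : j = i
  · subst h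
    simpa only [setCoord_same] using hx
  · simpa only [setCoord_of_ne _ h, Function.comp_def] using (continuous_coord j).comp hv

lemma coordMap_killIdx_singleton (i : ι) (v : KPow ι X) :
    (X.coordMap (killIdx {i})).1 v = setCoord v i X.pt := by
  refine congrArg KPow.mk (funext fun j => ?_)
  by_cases h : j = i
  · subst h
    simp [killIdx]
  · simp [killIdx, h]

lemma homotopic_of_pow {ι : Type} {f g : PMap (X.pow ι) M} (F : KPow ι X × unitInterval → M)
    (hF : Continuous F) (h0 : ∀ v : KPow ι X, F (v, 0) = f.1 v)
    (h1 : ∀ v : KPow ι X, F (v, 1) = g.1 v)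
    (hpt : ∀ t, F ((X.pow ι).pt, t) = M.pt) : PMap.Homotopic f g :=
  PMap.homotopic_of (Y := X.pow ι) F hF h0 h1 hpt

/-- The fat wedge. -/
def fatWedge (X : PtdCG.{u}) (ι : Type) : Set (KPow ι X) := {v | ∃ i, v i = X.pt}

lemma setCoord_mem_fatWedge {v : KPow ι X} (i : ι) {x : X} (h : ∃ j, j ≠ i ∧ v j = X.pt) :
    setCoord v i x ∈ fatWedge X ι := by
  obtain ⟨j, hj, hv⟩ := h
  exact ⟨j, by rw [setCoord_of_ne _ hj, hv]⟩

lemma setCoord_pt_mem_fatWedge (v : KPow ι X) (i : ι) : setCoord v i X.pt ∈ fatWedge X ι :=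
  ⟨i, setCoord_same _ _ _⟩

section Cut

variable (D : X.NDRData) (I : HInverse M)

/-- Multiply a function by the inverse of its restriction to the subspace where the `i`-th
coordinate is the base point, and deform the result to be trivial near that subspace. -/
noncomputable def cut (i : ι) (α : KPow ι X → M) (v : KPow ι X) : M :=
  -- For `ν ≤ 1/2` the retraction is at the base point, so the product has the form `a * χ a` and
  -- can be run along `k`: time `0` at `ν = 1/2`, time `1` from `ν = 1/4` down.
  if D.ν (v i) ≤ 1 / 2 then I.k (α (setCoord v i X.pt), toI (2 - 4 * D.ν (v i)))
  else α (setCoord v i (D.r (v i))) * I.χ.1 (α (setCoord v i X.pt))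

lemma continuous_cut (i : ι) {W : Type u} [TopologicalSpace W] [CompactlyGeneratedSpace W]
    {Γ : W → KPow ι X → M}
    (hΓ : ∀ f : W → KPow ι X, Continuous f → Continuous fun s => Γ s (f s))
    {v : W → KPow ι X} (hv : Continuous v) : Continuous fun s => cut D I i (Γ s) (v s) := by
  have hi : Continuous fun s => v s i := (continuous_coord i).comp hv
  have hν : Continuous fun s => D.ν (v s i) := D.ν_continuous.comp hi
  have hd : Continuous fun s => Γ s (setCoord (v s) i X.pt) :=
    hΓ _ (continuous_setCoord i hv continuous_const)
  refine Continuous.if_le ?_ ?_ hν continuous_const fun s hs => ?_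
  · exact I.k_continuous.comp (hd.prodMk (by fun_prop))
  · exact CGMonoid.continuous_mul
      (hΓ _ (continuous_setCoord i hv (D.continuous_r.comp hi))) (I.χ.1.continuous.comp hd)
  · rw [hs, toI_of_nonpos (by norm_num), I.k_zero, NDRData.r, D.h_one _ (by rw [hs]; norm_num)]

/-- This ensures that cutting in one direction keeps the vanishing already achieved on the other
hyperplanes. -/
lemma cut_eq_one {i : ι} {α : KPow ι X → M} {v : KPow ι X} (h : α (setCoord v i X.pt) = 1)
    (h' : α (setCoord v i (D.r (v i))) = 1) : cut D I i α v = 1 := by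
  rw [cut, h, h', I.k_unit, I.χ_one, mul_one, ite_self]

lemma cut_eq_one_of_le {i : ι} {α : KPow ι X → M} {v : KPow ι X} (h : D.ν (v i) ≤ 1 / 4) :
    cut D I i α v = 1 := by
  rw [cut, if_pos (by linarith), toI_of_one_le (by linarith), I.k_one]

/-- The iteration of `cut` over a list of indices. -/
noncomputable def cutList (L : List ι) (α : KPow ι X → M) : KPow ι X → M :=
  L.foldr (fun i β => cut D I i β) α

lemma continuous_cutList {W : Type u} [TopologicalSpace W] [CompactlyGeneratedSpace W]
    {Γ : W → KPow ι X → M} (hΓ : ∀ f : W → KPow ι X, Continuous f → Continuous fun s => Γ s (f s))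
    (L : List ι) : ∀ {v : W → KPow ι X}, Continuous v →
    Continuous fun s => cutList D I L (Γ s) (v s) := by
  induction L with
  | nil => exact fun hv => hΓ _ hv
  | cons i L ih => exact fun hv => continuous_cut D I i (fun f hf => ih hf) hv

lemma cutList_eq_one {L : List ι} {α : KPow ι X → M} {v : KPow ι X} {i : ι} (hi : i ∈ L)
    (h : v i = X.pt) : cutList D I L α v = 1 := by
  induction L generalizing v with
  | nil => simp at hi
  | cons j L ih =>
    by_cases hij : i = j
    · subst hij
      refine cut_eq_one_of_le D I ?_
      rw [h, D.ν_pt]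
      norm_num
    · have hi' : i ∈ L := (List.mem_cons.1 hi).resolve_left hij
      exact cut_eq_one D I (ih hi' (by rw [setCoord_of_ne _ hij, h]))
        (ih hi' (by rw [setCoord_of_ne _ hij, h]))

lemma cutList_one (L : List ι) : cutList D I L (fun _ => 1) = fun _ => 1 := by
  induction L with
  | nil => rfl
  | cons i L ih =>
    funext v
    change cut D I i (cutList D I L fun _ => 1) v = 1
    rw [ih]
    exact cut_eq_one D I rfl rfl

/-- `cutList` on continuous maps. -/
noncomputable def cutListC (L : List ι) (α : C(KPow ι X, M)) : C(KPow ι X, M) :=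
  ⟨cutList D I L α, continuous_cutList D I (Γ := fun _ => α)
    (fun _ hf => α.continuous.comp hf) L continuous_id⟩

/-- A map that is trivial on the fat wedge is unchanged by `cut` up to homotopy relative to the fat
wedge. -/
lemma homotopicRel_cutListC (L : List ι) {α : C(KPow ι X, M)} (hα : ∀ v ∈ fatWedge X ι, α v = 1) :
    ContinuousMap.HomotopicRel α (cutListC D I L α) (fatWedge X ι) := by
  induction L with
  | nil => exact ContinuousMap.HomotopicRel.refl _
  | cons i L ih =>
    refine ih.trans ?_
    have hβ : ∀ v ∈ fatWedge X ι, cutListC D I L α v = 1 := by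
      obtain ⟨F⟩ := ih
      exact fun v hv => (F.fst_eq_snd hv).symm.trans (hα v hv)
    generalize hβdef : cutListC D I L α = β at hβ
    have hc : Continuous fun p : KPow ι X × unitInterval => setCoord p.1 i (D.h (p.1 i, p.2)) :=
      continuous_setCoord i continuous_fst (D.h.continuous.comp
        (((continuous_coord i).comp continuous_fst).prodMk continuous_snd))
    refine ⟨⟨⟨⟨fun p => β (setCoord p.2 i (D.h (p.2 i, p.1))),
      β.continuous.comp (hc.comp continuous_swap)⟩, fun v => ?_, fun v => ?_⟩, fun t v hv => ?_⟩⟩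
    · change β (setCoord v i (D.h (v i, 0))) = β v
      rw [D.h_zero, setCoord_self]
    · change β (setCoord v i (D.h (v i, 1))) = cut D I i (cutListC D I L α) v
      rw [hβdef, cut, hβ _ (setCoord_pt_mem_fatWedge v i), I.k_unit, I.χ_one, mul_one]
      split_ifs with h
      · rw [D.h_one _ (by linarith)]
        exact hβ _ (setCoord_pt_mem_fatWedge v i)
      · rfl
    · change β (setCoord v i (D.h (v i, t))) = β v
      rw [hβ v hv]
      refine hβ _ ?_
      obtain ⟨j, hj⟩ := hv
      by_cases hji : j = i
      · subst hji
        rw [hj, D.h_pt]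
        exact setCoord_pt_mem_fatWedge _ _
      · exact setCoord_mem_fatWedge i ⟨j, hji, hj⟩

/-- A map that is trivial on the fat wedge and null homotopic is null homotopic relative to the fat
wedge. -/
lemma homotopicRel_fatWedge_of_null (D : X.NDRData) (I : HInverse M) [Fintype ι]
    {α : PMap (X.pow ι) M}
    (hα : ∀ v ∈ fatWedge X ι, α.1 v = 1) (h : PMap.Homotopic α (PMap.const _ _)) :
    ContinuousMap.HomotopicRel α.1 (ContinuousMap.const _ 1) (fatWedge X ι) := by
  obtain ⟨F⟩ := h
  refine (homotopicRel_cutListC D I Finset.univ.toList hα).trans ?_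
  -- Cutting every stage of the null homotopy in all directions makes it trivial on the fat wedge
  -- throughout.
  let G : unitInterval → KPow ι X → M := fun s v => F (s, v)
  have h1 : ∀ s, ∀ v ∈ fatWedge X ι, cutList D I Finset.univ.toList (G s) v = 1 := by
    rintro s v ⟨i, hi⟩
    exact cutList_eq_one D I (by simp) hi
  have hc : Continuous fun p : KPow ι X × unitInterval =>
      cutList D I Finset.univ.toList (G p.2) p.1 :=
    continuous_cutList D I (Γ := fun (p : KPow ι X × unitInterval) => G p.2)
      (fun f hf => F.continuous.comp (continuous_snd.prodMk hf)) _ continuous_fst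
  have e0 : G 0 = α.1 := funext fun v => F.apply_zero v
  have e1 : G 1 = fun _ => 1 := funext fun v => (F.apply_one v).trans CGMonoid.pt_eq
  refine ⟨⟨⟨⟨fun p => cutList D I Finset.univ.toList (G p.1) p.2, hc.comp continuous_swap⟩,
    fun v => ?_, fun v => ?_⟩, fun t v hv => ?_⟩⟩
  · exact congrArg (fun g => cutList D I Finset.univ.toList g v) e0
  · refine (congrArg (fun g => cutList D I Finset.univ.toList g v) e1).trans ?_
    rw [cutList_one]
    rfl
  · refine (h1 t v hv).trans ((h1 0 v hv).symm.trans ?_)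
    exact congrArg (fun g => cutList D I Finset.univ.toList g v) e0

/-- `cut` on pointed maps. -/
noncomputable def cutP (i : ι) (α : PMap (X.pow ι) M) : PMap (X.pow ι) M :=
  ⟨⟨cut D I i α.1, continuous_cut D I i (Γ := fun _ => α.1)
    (fun f hf => α.1.continuous.comp hf) continuous_id⟩, by
    refine Eq.trans (cut_eq_one_of_le D I ?_) CGMonoid.pt_eq.symm
    change D.ν X.pt ≤ 1 / 4
    rw [D.ν_pt]
    norm_num⟩

/-- First the `i`-th coordinate is moved by `h` to its retraction, then the homotopy `k` is switched
on near the hyperplane. -/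
lemma cutP_homotopic (i : ι) (α : PMap (X.pow ι) M) :
    PMap.Homotopic (α.mul (I.χ.comp (α.comp (X.coordMap (killIdx {i}))))) (cutP D I i α) := by
  have hpt : α.1 (X.pow ι).pt = 1 := α.2.trans CGMonoid.pt_eq
  have hi : Continuous fun p : KPow ι X × unitInterval => p.1 i :=
    (continuous_coord i).comp continuous_fst
  have hν : Continuous fun p : KPow ι X × unitInterval => D.ν (p.1 i) := D.ν_continuous.comp hi
  have hd : Continuous fun p : KPow ι X × unitInterval => α.1 (setCoord p.1 i X.pt) :=
    α.1.continuous.comp (continuous_setCoord i continuous_fst continuous_const)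
  let mid : PMap (X.pow ι) M :=
    ⟨⟨fun v : KPow ι X => α.1 (setCoord v i (D.r (v i))) * I.χ.1 (α.1 (setCoord v i X.pt)),
      CGMonoid.continuous_mul (W := KPow ι X)
        (α.1.continuous.comp (continuous_setCoord i continuous_id
          (D.continuous_r.comp (continuous_coord i))))
        (I.χ.1.continuous.comp (α.1.continuous.comp (continuous_setCoord i continuous_id
          continuous_const)))⟩, by
      change α.1 (setCoord (X.pow ι).pt i (D.r X.pt)) *
        I.χ.1 (α.1 (setCoord (X.pow ι).pt i X.pt)) = M.pt
      rw [D.r_pt, setCoord_pt, hpt, I.χ_one, mul_one, CGMonoid.pt_eq]⟩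
  have s1 : PMap.Homotopic (α.mul (I.χ.comp (α.comp (X.coordMap (killIdx {i}))))) mid := by
    refine homotopic_of_pow (fun p => α.1 (setCoord p.1 i (D.h (p.1 i, p.2))) *
      I.χ.1 (α.1 (setCoord p.1 i X.pt))) ?_ (fun v => ?_) (fun v => rfl) fun t => ?_
    · exact CGMonoid.continuous_mul (W := KPow ι X × unitInterval) (α.1.continuous.comp
        (continuous_setCoord i continuous_fst (D.h.continuous.comp (hi.prodMk continuous_snd))))
        (I.χ.1.continuous.comp hd)
    · dsimp only
      rw [D.h_zero, setCoord_self, ← coordMap_killIdx_singleton]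
      rfl
    · change α.1 (setCoord (X.pow ι).pt i (D.h (X.pt, t))) *
        I.χ.1 (α.1 (setCoord (X.pow ι).pt i X.pt)) = M.pt
      rw [D.h_pt, setCoord_pt, hpt, I.χ_one, mul_one, CGMonoid.pt_eq]
  have s2 : PMap.Homotopic mid (cutP D I i α) := by
    refine homotopic_of_pow (fun p => if D.ν (p.1 i) ≤ 1 / 2 then
      I.k (α.1 (setCoord p.1 i X.pt), p.2 * toI (2 - 4 * D.ν (p.1 i))) else mid.1 p.1)
      ?_ (fun v => ?_) (fun v => ?_) fun t => ?_
    · refine Continuous.if_le ?_ (mid.1.continuous.comp continuous_fst) hν continuous_const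
        fun p hp => ?_
      · exact I.k_continuous.comp (hd.prodMk (by fun_prop))
      · rw [hp, toI_of_nonpos (by norm_num), mul_zero, I.k_zero]
        change _ = α.1 (setCoord p.1 i (D.h (p.1 i, 1))) * I.χ.1 (α.1 (setCoord p.1 i X.pt))
        rw [D.h_one _ (by rw [hp]; norm_num)]
    · dsimp only
      split_ifs with h
      · rw [zero_mul, I.k_zero]
        change _ = α.1 (setCoord v i (D.h (v i, 1))) * I.χ.1 (α.1 (setCoord v i X.pt))
        rw [D.h_one _ (by linarith)]
      · rfl
    · simp only [one_mul]
      exact rfl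
    · have h0 : D.ν ((X.pow ι).pt.coord i) ≤ 1 / 2 := by
        change D.ν X.pt ≤ 1 / 2
        rw [D.ν_pt]
        norm_num
      dsimp only
      rw [if_pos h0, setCoord_pt, hpt, I.k_unit, CGMonoid.pt_eq]
  exact ContinuousMap.HomotopicRel.trans s1 s2

lemma mk_cutP {i : ι} {α : PMap (X.pow ι) M}
    (h : pullback M (X.coordMap (killIdx {i})) (⟦α⟧ : HClass (X.pow ι) M) = 1) :
    (⟦cutP D I i α⟧ : HClass (X.pow ι) M) = ⟦α⟧ := by
  have h1 : (⟦α.mul (I.χ.comp (α.comp (X.coordMap (killIdx {i}))))⟧ : HClass (X.pow ι) M) =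
      ⟦cutP D I i α⟧ := Quotient.sound (cutP_homotopic D I i α)
  have h2 := I.mk_mul_comp (α.comp (X.coordMap (killIdx {i})))
  rw [← pullback_mk, h, one_mul] at h2
  rw [← h1, ← mk_mul_mk, h2, mul_one]

/-- A class that restricts trivially to all coordinate hyperplanes is represented by a map that is
trivial on the fat wedge. -/
lemma exists_rep_fatWedge (D : X.NDRData) (I : HInverse M) [Fintype ι]
    {a : HClass (X.pow ι) M}
    (h : ∀ i, pullback M (X.coordMap (killIdx {i})) a = 1) :
    ∃ γ : PMap (X.pow ι) M, ⟦γ⟧ = a ∧ ∀ v ∈ fatWedge X ι, γ.1 v = 1 := by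
  obtain ⟨α, rfl⟩ := Quotient.exists_rep a
  have key : ∀ L : List ι, ∃ γ : PMap (X.pow ι) M, (⟦γ⟧ : HClass (X.pow ι) M) = ⟦α⟧ ∧
      ⇑γ.1 = cutList D I L α.1 := by
    intro L
    induction L with
    | nil => exact ⟨α, rfl, rfl⟩
    | cons i L ih =>
      obtain ⟨γ, h1, h2⟩ := ih
      refine ⟨cutP D I i γ, ?_, ?_⟩
      · rw [mk_cutP D I (by rw [h1, h i]), h1]
      · change cut D I i γ.1 = cut D I i (cutList D I L α.1)
        rw [h2]
  obtain ⟨γ, h1, h2⟩ := key Finset.univ.toList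
  refine ⟨γ, h1, ?_⟩
  rintro v ⟨i, hi⟩
  rw [h2]
  exact cutList_eq_one D I (by simp) hi

end Cut

section Commute

variable (D : X.NDRData) (I : HInverse M) (i : ι) (f g : PMap (X.pow ι) M)

/-- The product of `f` and `g` at two points that differ in one coordinate, times the inverse of the
product in the other order, deformed to be trivial near the wedge. -/
noncomputable def commFun (v : KPow ι X) (p : KPow (Fin 2) X) : M :=
  -- Below `1/4` one of the factors `f`, `g` will be `1`, so at the threshold `1/8` both orders
  -- agree and `k` takes over at time `0`; it reaches `1` at `1/16`, before the wedge.
  if min (D.ν (p 0)) (D.ν (p 1)) ≤ 1 / 8 then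
    I.k (f.1 (setCoord v i (p 0)) * g.1 (setCoord v i (p 1)),
      toI (2 - 16 * min (D.ν (p 0)) (D.ν (p 1))))
  else f.1 (setCoord v i (p 0)) * g.1 (setCoord v i (p 1)) *
    I.χ.1 (g.1 (setCoord v i (p 1)) * f.1 (setCoord v i (p 0)))

lemma commFun_eq_one (v : KPow ι X) {p : KPow (Fin 2) X} (hp : ∃ j, p j = X.pt) :
    commFun D I i f g v p = 1 := by
  have h : min (D.ν (p 0)) (D.ν (p 1)) = 0 := by
    obtain ⟨j, hj⟩ := hp
    fin_cases j
    · rw [show p 0 = X.pt from hj, D.ν_pt, min_eq_left (D.ν_nonneg _)]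
    · rw [show p 1 = X.pt from hj, D.ν_pt, min_eq_right (D.ν_nonneg _)]
  rw [commFun, if_pos (by rw [h]; norm_num), h, toI_of_one_le (by norm_num), I.k_one]

/-- The function induced by `commFun` on the smash product. -/
noncomputable def commQuot (v : KPow ι X) : X.smash 2 → M :=
  Quotient.lift (s := X.smashSetoid 2) (commFun D I i f g v) <| by
    rintro a b (h | ⟨ha, hb⟩)
    · rw [h]
    · rw [commFun_eq_one D I i f g v ha, commFun_eq_one D I i f g v hb]

variable {f g}

lemma continuous_commFun (hf : ∀ v : KPow ι X, D.ν (v i) ≤ 1 / 4 → f.1 v = 1)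
    (hg : ∀ v : KPow ι X, D.ν (v i) ≤ 1 / 4 → g.1 v = 1) {W : Type u} [TopologicalSpace W]
    [CompactlyGeneratedSpace W] {v : W → KPow ι X} {p : W → KPow (Fin 2) X} (hv : Continuous v)
    (hp : Continuous p) : Continuous fun s => commFun D I i f g (v s) (p s) := by
  have h0 : Continuous fun s => p s 0 := (continuous_coord 0).comp hp
  have h1 : Continuous fun s => p s 1 := (continuous_coord 1).comp hp
  have hw : Continuous fun s => min (D.ν (p s 0)) (D.ν (p s 1)) :=
    (D.ν_continuous.comp h0).min (D.ν_continuous.comp h1)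
  have hf' : Continuous fun s => f.1 (setCoord (v s) i (p s 0)) :=
    f.1.continuous.comp (continuous_setCoord i hv h0)
  have hg' : Continuous fun s => g.1 (setCoord (v s) i (p s 1)) :=
    g.1.continuous.comp (continuous_setCoord i hv h1)
  have hfg := CGMonoid.continuous_mul hf' hg'
  refine Continuous.if_le ?_ ?_ hw continuous_const fun s hs => ?_
  · exact I.k_continuous.comp (hfg.prodMk (by fun_prop))
  · exact CGMonoid.continuous_mul hfg
      (I.χ.1.continuous.comp (CGMonoid.continuous_mul hg' hf'))
  · rw [hs, toI_of_nonpos (by norm_num), I.k_zero]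
    rcases min_le_iff.1 hs.le with h | h
    · rw [hf _ (by rw [setCoord_same]; linarith), one_mul, mul_one]
    · rw [hg _ (by rw [setCoord_same]; linarith), one_mul, mul_one]

lemma continuous_commQuot (hf : ∀ v : KPow ι X, D.ν (v i) ≤ 1 / 4 → f.1 v = 1)
    (hg : ∀ v : KPow ι X, D.ν (v i) ≤ 1 / 4 → g.1 v = 1) {W : Type u} [TopologicalSpace W]
    [CompactlyGeneratedSpace W] {v : W → KPow ι X} {z : W → X.smash 2} (hv : Continuous v)
    (hz : Continuous z) : Continuous fun s => commQuot D I i f g (v s) (z s) := by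
  refine continuous_from_compactlyGeneratedSpace _ fun S _ _ _ e he => ?_
  have h1 : Continuous fun p : S × X.smash 2 => commQuot D I i f g (v (e p.1)) p.2 := by
    refine (isQuotientMap_quotient_mk' (s := X.smashSetoid 2)).continuous_lift_prod_right ?_
    have := compactlyGenerated_prod_left S (KPow (Fin 2) X)
    exact continuous_commFun D I i hf hg (hv.comp (he.comp continuous_fst)) continuous_snd
  exact h1.comp (continuous_id.prodMk (hz.comp he))

/-- Classes that restrict trivially to a coordinate hyperplane commute. -/
lemma mul_comm_of_kill (D : X.NDRData) (I : HInverse M) (i : ι) (hcat : X.WeakCatLtTwo)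
    {a b : HClass (X.pow ι) M}
    (ha : pullback M (X.coordMap (killIdx {i})) a = 1)
    (hb : pullback M (X.coordMap (killIdx {i})) b = 1) : a * b = b * a := by
  obtain ⟨f0, rfl⟩ := Quotient.exists_rep a
  obtain ⟨g0, rfl⟩ := Quotient.exists_rep b
  rw [← mk_cutP D I ha, ← mk_cutP D I hb]
  generalize hfdef : cutP D I i f0 = f
  generalize hgdef : cutP D I i g0 = g
  have hf : ∀ v : KPow ι X, D.ν (v i) ≤ 1 / 4 → f.1 v = 1 := fun v hv => by
    rw [← hfdef]
    exact cut_eq_one_of_le D I hv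
  have hg : ∀ v : KPow ι X, D.ν (v i) ≤ 1 / 4 → g.1 v = 1 := fun v hv => by
    rw [← hgdef]
    exact cut_eq_one_of_le D I hv
  obtain ⟨H⟩ := hcat
  -- Up to the deformation near the wedge, this map is `commQuot` evaluated on the reduced diagonal
  -- of the `i`-th coordinate, so the null homotopy `H` contracts it.
  have key : (⟦(f.mul g).mul (I.χ.comp (g.mul f))⟧ : HClass (X.pow ι) M) = 1 := by
    refine Quotient.sound (homotopic_of_pow
      (fun p => commQuot D I i f g p.1 (H (p.2, p.1 i))) ?_ (fun v => ?_) (fun v => ?_)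
      fun t => ?_)
    · exact continuous_commQuot D I i hf hg (W := KPow ι X × unitInterval) continuous_fst
        (H.continuous.comp (continuous_snd.prodMk ((continuous_coord i).comp continuous_fst)))
    · dsimp only
      rw [H.apply_zero]
      change commFun D I i f g v ⟨fun _ => v i⟩ = f.1 v * g.1 v * I.χ.1 (g.1 v * f.1 v)
      simp only [commFun, min_self, setCoord_self]
      split_ifs with h
      · rw [hf v (by linarith), hg v (by linarith), mul_one, I.k_unit, I.χ_one, mul_one]
      · rfl
    · dsimp only
      rw [H.apply_one]
      exact (commFun_eq_one D I i f g v ⟨0, rfl⟩).trans CGMonoid.pt_eq.symm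
    · have h2 : H (t, X.pt) = (X.smash 2).pt := H.eq_fst t rfl
      change commQuot D I i f g (X.pow ι).pt (H (t, X.pt)) = M.pt
      rw [h2]
      exact (commFun_eq_one D I i f g _ ⟨0, rfl⟩).trans CGMonoid.pt_eq.symm
  rw [← mk_mul_mk, ← mk_mul_mk] at key
  have h2 := I.mk_mul_comp (g.mul f)
  rw [← mk_mul_mk] at h2
  have h3 := key.trans h2.symm
  exact (I.isUnit (⟦I.χ.comp (g.mul f)⟧ : HClass (X.pow ι) M)).mul_right_cancel h3

end Commute

end PtdCG

/-! ### Cohen relations from abelian normal subgroups. -/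

namespace Cohen

variable {G : Type*} [Group G] {ι : Type*}

lemma comm_mem_left {N : Subgroup G} [N.Normal] {a : G} (ha : a ∈ N) (b : G) : comm a b ∈ N := by
  have := N.mul_mem (N.inv_mem ha) (Subgroup.Normal.conj_mem ‹_› a ha b⁻¹)
  simpa [comm, mul_assoc] using this

lemma comm_mem_right {N : Subgroup G} [N.Normal] {b : G} (hb : b ∈ N) (a : G) : comm a b ∈ N := by
  have := N.mul_mem (Subgroup.Normal.conj_mem ‹_› _ (N.inv_mem hb) a⁻¹) hb
  simpa [comm, mul_assoc] using this

lemma comm_eq_one_of_commute {a b : G} (h : a * b = b * a) : comm a b = 1 := by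
  rw [comm, mul_assoc, h]
  group

/-- Conjugation by `b` turns `a` into `a * [a, b]`, a product of commuting elements. -/
lemma comm_zpow_left {a b : G} (h : Commute (comm a b) a) (m : ℤ) :
    comm (a ^ m) b = comm a b ^ m := by
  have h1 : b⁻¹ * a * b = a * comm a b := by
    rw [comm]
    group
  have h2 : b⁻¹ * a ^ m * b = (b⁻¹ * a * b) ^ m := by
    have := conj_zpow (a := b⁻¹) (b := a) (i := m)
    rw [inv_inv] at this
    exact this.symm
  rw [h1, (h.symm).mul_zpow] at h2
  calc comm (a ^ m) b = (a ^ m)⁻¹ * (b⁻¹ * a ^ m * b) := by rw [comm]; group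
    _ = comm a b ^ m := by rw [h2]; group

lemma comm_zpow_right {a b : G} (h : Commute (comm a b) b) (n : ℤ) :
    comm a (b ^ n) = comm a b ^ n := by
  have h1 : a⁻¹ * b⁻¹ * a = comm a b * b⁻¹ := by
    rw [comm]
    group
  have h2 : a⁻¹ * (b⁻¹) ^ n * a = (a⁻¹ * b⁻¹ * a) ^ n := by
    have := conj_zpow (a := a⁻¹) (b := b⁻¹) (i := n)
    rw [inv_inv] at this
    exact this.symm
  rw [h1, (h.inv_right).mul_zpow] at h2
  calc comm a (b ^ n) = (a⁻¹ * (b⁻¹) ^ n * a) * b ^ n := by rw [comm, inv_zpow]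
    _ = comm a b ^ n := by rw [h2, inv_zpow]; group

variable {N : ι → Subgroup G} [∀ i, (N i).Normal]

lemma foldl_comm_eq_one {x : ι → G} (hx : ∀ i, x i ∈ N i)
    (hN : ∀ i, ∀ a ∈ N i, ∀ b ∈ N i, a * b = b * a) (L : List ι) (a : G)
    (h : (∃ i ∈ L, a ∈ N i) ∨ ¬ L.Nodup) : (L.map x).foldl comm a = 1 := by
  induction L generalizing a with
  | nil => simp at h
  | cons j L ih =>
    rw [List.map_cons, List.foldl_cons]
    -- Once an iterated commutator lies in `N i`, normality keeps it there until the next entry `x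
    -- i`, with which it commutes; after that everything is `1`.
    rcases h with ⟨i, hi, ha⟩ | h
    · rcases List.mem_cons.1 hi with rfl | hi
      · rw [comm_eq_one_of_commute (hN i _ ha _ (hx i)), foldl_comm_one]
      · exact ih _ (Or.inl ⟨i, hi, comm_mem_left ha _⟩)
    · rw [List.nodup_cons, not_and_or, not_not] at h
      rcases h with h | h
      · exact ih _ (Or.inl ⟨j, h, comm_mem_right (hx j) _⟩)
      · exact ih _ (Or.inr h)

/-- Left normed commutators with a repeated entry are trivial if the entries lie in abelian normal
subgroups. -/
lemma leftComm_eq_one_of_not_nodup {x : ι → G} (hx : ∀ i, x i ∈ N i)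
    (hN : ∀ i, ∀ a ∈ N i, ∀ b ∈ N i, a * b = b * a) (L : List ι) (h : ¬ L.Nodup) :
    leftComm (L.map x) = 1 := by
  cases L with
  | nil => simp at h
  | cons i L =>
    rw [List.nodup_cons, not_and_or, not_not] at h
    rcases h with h | h
    · exact foldl_comm_eq_one hx hN L _ (Or.inl ⟨i, h, hx i⟩)
    · exact foldl_comm_eq_one hx hN L _ (Or.inr h)

/-- A commutator of `a ∈ N i` with `x j` lies in both `N i` and `N j`, so it commutes with both
entries and exponents come out on either side. -/
lemma foldl_comm_zpow {x : ι → G} (hx : ∀ i, x i ∈ N i)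
    (hN : ∀ i, ∀ a ∈ N i, ∀ b ∈ N i, a * b = b * a) (L : List (ι × ℤ)) (a : G) (m : ℤ)
    (ha : ∃ i, a ∈ N i) : (L.map fun p => x p.1 ^ p.2).foldl comm (a ^ m) =
      (L.map fun p => x p.1).foldl comm a ^ (m * (L.map Prod.snd).prod) := by
  induction L generalizing a m with
  | nil => simp
  | cons p L ih =>
    obtain ⟨i, hi⟩ := ha
    simp only [List.map_cons, List.foldl_cons, List.prod_cons]
    have h1 : comm (a ^ m) (x p.1 ^ p.2) = comm a (x p.1) ^ (m * p.2) := by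
      rw [comm_zpow_left, comm_zpow_right, ← zpow_mul, mul_comm]
      · exact hN p.1 _ (comm_mem_right (hx _) _) _ (hx _)
      · exact hN i _ (comm_mem_left hi _) _ hi
    rw [h1, ih _ _ ⟨p.1, comm_mem_right (hx _) _⟩, mul_assoc]

/-- Left normed commutators are multiplicative in powers of the entries if the entries lie in
abelian normal subgroups. -/
lemma leftComm_zpow_of_abelian {x : ι → G} (hx : ∀ i, x i ∈ N i)
    (hN : ∀ i, ∀ a ∈ N i, ∀ b ∈ N i, a * b = b * a) (L : List (ι × ℤ)) :
    leftComm (L.map fun p => x p.1 ^ p.2) =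
      leftComm (L.map fun p => x p.1) ^ (L.map Prod.snd).prod := by
  cases L with
  | nil => simp [leftComm]
  | cons p L => exact foldl_comm_zpow hx hN L _ _ ⟨p.1, hx p.1⟩

end Cohen

/-! ### The homomorphism from the Cohen group. -/

namespace PtdCG

variable {X : PtdCG.{u}} {ι κ : Type}

lemma coordPullback_xClass (φ : ι → Option κ) (i : ι) :
    X.coordPullback φ (X.xClass i) = (φ i).elim 1 X.xClass := by
  cases h : φ i with
  | none =>
    refine congrArg (Quotient.mk _) (Subtype.ext (ContinuousMap.ext fun v => ?_))
    change X.letter ((φ i).elim X.pt (KPow.coord v)) = 1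
    rw [h]
    exact X.letter_pt
  | some k =>
    refine congrArg (Quotient.mk _) (Subtype.ext (ContinuousMap.ext fun v => ?_))
    change X.letter ((φ i).elim X.pt (KPow.coord v)) = X.letter (KPow.coord v k)
    rw [h]
    rfl

variable (I : HInverse X.James)

/-- The class `x_i` as a unit. -/
noncomputable def xUnit (i : ι) : (HClass (X.pow ι) X.James)ˣ := (I.isUnit (X.xClass i)).unit

lemma coe_xUnit (i : ι) : (xUnit I i : HClass (X.pow ι) X.James) = X.xClass i := rfl

variable (X) in
/-- The classes that restrict trivially to the `i`-th coordinate hyperplane. -/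
noncomputable def killKer (i : ι) : Subgroup (HClass (X.pow ι) X.James)ˣ :=
  (Units.map (X.coordPullback (killIdx {i}))).ker

instance (i : ι) : (killKer X i).Normal := MonoidHom.normal_ker _

lemma mem_killKer {i : ι} {a : (HClass (X.pow ι) X.James)ˣ} :
    a ∈ killKer X i ↔ X.coordPullback (killIdx {i}) a = 1 := by
  rw [killKer, MonoidHom.mem_ker, Units.ext_iff]
  rfl

lemma xUnit_mem_killKer (i : ι) : xUnit I i ∈ killKer X i := by
  rw [mem_killKer, coe_xUnit, coordPullback_xClass]
  simp [killIdx]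

variable [DecidableEq ι]

lemma killKer_comm (I : HInverse X.James) (D : X.NDRData) (hcat : X.WeakCatLtTwo) (i : ι)
    (a) (ha : a ∈ killKer X i) (b) (hb : b ∈ killKer X i) : a * b = b * a :=
  Units.ext (mul_comm_of_kill D I i hcat (mem_killKer.1 ha) (mem_killKer.1 hb))

/-- The homomorphism from the Cohen group to the units of `[X^ι, J(X)]`. -/
noncomputable def cohenUnits (D : X.NDRData) (hcat : X.WeakCatLtTwo) :
    Cohen.K ι →* (HClass (X.pow ι) X.James)ˣ :=
  PresentedGroup.toGroup (f := xUnit I) <| by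
    rintro r (⟨L, hL, rfl⟩ | ⟨L, rfl⟩)
    · rw [Cohen.map_leftComm, List.map_map]
      have := Cohen.leftComm_eq_one_of_not_nodup (xUnit_mem_killKer I)
        (killKer_comm I D hcat) L hL
      simpa [Function.comp_def] using this
    · rw [map_mul, map_inv, mul_inv_eq_one, map_zpow, Cohen.map_leftComm, Cohen.map_leftComm,
        List.map_map, List.map_map]
      have := Cohen.leftComm_zpow_of_abelian (xUnit_mem_killKer I) (killKer_comm I D hcat) L
      simpa [Function.comp_def] using this

variable (D : X.NDRData) (hcat : X.WeakCatLtTwo)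

lemma cohenUnits_x (i : ι) : cohenUnits I D hcat (Cohen.K.x i) = xUnit I i :=
  PresentedGroup.toGroup.of _

/-- The homomorphism `e_X` from the Cohen group to `[X^ι, J(X)]`. -/
noncomputable def cohenHom : Cohen.K ι →* HClass (X.pow ι) X.James :=
  (Units.coeHom _).comp (cohenUnits I D hcat)

lemma cohenHom_x (i : ι) : cohenHom I D hcat (Cohen.K.x i) = X.xClass i :=
  congrArg Units.val (cohenUnits_x I D hcat i)

lemma cohenHom_mem_KGeo (α : Cohen.K ι) : cohenHom I D hcat α ∈ X.KGeo ι := by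
  refine ⟨cohenUnits I D hcat α, ?_, rfl⟩
  have h : (⊤ : Subgroup (Cohen.K ι)) ≤ (Subgroup.closure {a : (HClass (X.pow ι) X.James)ˣ |
      ∃ i : ι, a.val = X.xClass i}).comap (cohenUnits I D hcat) := by
    rw [← PresentedGroup.closure_range_of, Subgroup.closure_le]
    rintro _ ⟨i, rfl⟩
    exact Subgroup.subset_closure ⟨i, congrArg Units.val (cohenUnits_x I D hcat i)⟩
  exact h (Subgroup.mem_top α)

lemma coordPullback_cohenHom [DecidableEq κ] (φ : ι → Option κ) (α : Cohen.K ι) :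
    X.coordPullback φ (cohenHom I D hcat α) = cohenHom I D hcat (Cohen.K.map φ α) := by
  have h : (Units.map (X.coordPullback φ)).comp (cohenUnits I D hcat) =
      (cohenUnits I D hcat).comp (Cohen.K.map φ) := by
    refine PresentedGroup.ext fun i => Units.ext ?_
    change X.coordPullback φ (cohenUnits I D hcat (Cohen.K.x i)).val =
      (cohenUnits I D hcat (Cohen.K.map φ (Cohen.K.x i))).val
    have h1 : Cohen.K.map φ (Cohen.K.x i) = Cohen.K.relabel φ i := PresentedGroup.toGroup.of _
    rw [cohenUnits_x, coe_xUnit, coordPullback_xClass, h1, Cohen.K.relabel]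
    cases φ i with
    | none => exact (congrArg Units.val (map_one (cohenUnits I D hcat))).symm
    | some k => exact (congrArg Units.val (cohenUnits_x I D hcat k)).symm
  exact congrArg Units.val (DFunLike.congr_fun h α)

end PtdCG

/-! ### Reduced words and the identifications on `X^{ln}`. -/

namespace PtdCG

section WordLength

variable {Z : PtdCG.{u}}

/-- The number of letters of the reduced word. -/
def wordSize (w : Z.Word) : ℕ := (FreeMonoid.toList (α := {x : Z // x ≠ Z.pt}) w).length

lemma wordSize_letter_mul {x : Z} (hx : x ≠ Z.pt) (w : Z.Word) :
    wordSize (Z.letter x * w) = wordSize w + 1 := by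
  rw [letter_of_ne Z hx]
  rfl

lemma wordSize_letter_mul_le (x : Z) (w : Z.Word) :
    wordSize (Z.letter x * w) ≤ wordSize w + 1 := by
  by_cases hx : x = Z.pt
  · rw [hx, letter_pt, one_mul]
    exact Nat.le_succ _
  · exact (wordSize_letter_mul hx w).le

lemma wordSize_word_le {n : ℕ} (z : KPow (Fin n) Z) : wordSize (Z.word z) ≤ n := by
  induction n with
  | zero =>
    rw [word_zero]
    exact le_rfl
  | succ n ih =>
    rw [word_succ]
    exact (wordSize_letter_mul_le _ _).trans (Nat.succ_le_succ (ih _))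

lemma wordSize_word {n : ℕ} (z : KPow (Fin n) Z) (hz : ∀ s, z s ≠ Z.pt) :
    wordSize (Z.word z) = n := by
  induction n with
  | zero =>
    rw [word_zero]
    rfl
  | succ n ih => rw [word_succ, wordSize_letter_mul (hz 0), ih _ fun s => hz s.succ]

lemma letter_mul_inj {x y : Z} (hx : x ≠ Z.pt) (hy : y ≠ Z.pt) {w w' : Z.Word}
    (h : Z.letter x * w = Z.letter y * w') : x = y ∧ w = w' := by
  rw [letter_of_ne Z hx, letter_of_ne Z hy] at h
  have h1 : (⟨x, hx⟩ : {x : Z // x ≠ Z.pt}) ::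
      FreeMonoid.toList (α := {x : Z // x ≠ Z.pt}) w = ⟨y, hy⟩ ::
      FreeMonoid.toList (α := {x : Z // x ≠ Z.pt}) w' := h
  rw [List.cons_eq_cons] at h1
  exact ⟨congrArg Subtype.val h1.1, h1.2⟩

/-- The word of `z` has the full length `n`, so `z'` cannot contain base points either, and letters
are compared one by one. -/
lemma eq_of_word_eq {n : ℕ} {z z' : KPow (Fin n) Z} (hz : ∀ s, z s ≠ Z.pt)
    (h : Z.word z = Z.word z') : z = z' := by
  induction n with
  | zero => exact congrArg KPow.mk (funext fun s => s.elim0)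
  | succ n ih =>
    have h1 := wordSize_word z hz
    rw [h, word_succ] at h1
    have h2 : z' 0 ≠ Z.pt := by
      intro h0
      rw [h0, letter_pt, one_mul] at h1
      have := wordSize_word_le (⟨fun i => z' i.succ⟩ : KPow (Fin n) Z)
      omega
    rw [word_succ, word_succ] at h
    obtain ⟨h3, h4⟩ := letter_mul_inj (hz 0) h2 h
    have h5 := ih (fun s => hz s.succ) h4
    refine congrArg KPow.mk (funext fun s => ?_)
    refine Fin.cases h3 (fun s => ?_) s
    exact congrArg (fun c : KPow (Fin n) Z => c s) h5

lemma prod_ofFn_succAbove {N : Type*} [Monoid N] {k : ℕ} (f : Fin (k + 1) → N) (s : Fin (k + 1))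
    (h : f s = 1) : (List.ofFn f).prod = (List.ofFn fun i => f (s.succAbove i)).prod := by
  induction k with
  | zero =>
    have : s = 0 := Fin.fin_one_eq_zero s
    subst this
    simp [h]
  | succ k ih =>
    induction s using Fin.cases with
    | zero => simp [h]
    | succ s =>
      rw [List.ofFn_succ (f := f), List.prod_cons, ih (fun i => f i.succ) s h,
        List.ofFn_succ (f := fun i => f (s.succ.succAbove i)), List.prod_cons]
      simp

lemma word_succAbove {k : ℕ} (z : KPow (Fin (k + 1)) Z) {s : Fin (k + 1)} (h : z s = Z.pt) :
    Z.word z = Z.word (⟨fun i => z (s.succAbove i)⟩ : KPow (Fin k) Z) :=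
  prod_ofFn_succAbove (fun i => Z.letter (z i)) s (by rw [h, letter_pt])

end WordLength

variable {X M : PtdCG.{u}} [CGMonoid M] {l n : ℕ}

/-- The class of a family in the smash power. -/
def smashMk (X : PtdCG.{u}) {l : ℕ} (w : KPow (Fin l) X) : X.smash l :=
  Quotient.mk (X.smashSetoid l) w

lemma smashMk_eq_pt (hl : 0 < l) {w : KPow (Fin l) X} :
    X.smashMk w = (X.smash l).pt ↔ ∃ i, w i = X.pt := by
  constructor
  · intro h
    rcases Quotient.exact (s := X.smashSetoid l) h with h | h
    · exact ⟨⟨0, hl⟩, by rw [h]⟩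
    · exact h.1
  · exact fun h => Quotient.sound (s := X.smashSetoid l) (Or.inr ⟨h, ⟨0, hl⟩, rfl⟩)

lemma isQuotientMap_smashMk : IsQuotientMap (X.smashMk (l := l)) :=
  isQuotientMap_quotient_mk'

/-- The map `X^{ln} → (X^{(l)})^n`. -/
def toBlocks (X : PtdCG.{u}) {l n : ℕ} (v : KPow (Fin n × Fin l) X) : KPow (Fin n) (X.smash l) :=
  ⟨fun s => X.smashMk ⟨fun j => v (s, j)⟩⟩

lemma continuous_toBlocks : Continuous (X.toBlocks (l := l) (n := n)) := by
  refine continuous_KPow fun s => isQuotientMap_smashMk.continuous.comp ?_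
  exact continuous_KPow fun j => continuous_coord (s, j)

lemma continuous_of_toBlocks {T : Type*} [TopologicalSpace T] {F : KPow (Fin n) (X.smash l) → T}
    (hF : Continuous fun v : KPow (Fin n × Fin l) X => F (X.toBlocks v)) : Continuous F := by
  refine continuous_of_comp_quotient (isQuotientMap_smashMk (X := X) (l := l)) ?_
  have h : Continuous fun w : KPow (Fin n) (KPow (Fin l) X) =>
      (⟨fun p => w p.1 p.2⟩ : KPow (Fin n × Fin l) X) :=
    continuous_KPow fun p => (continuous_coord p.2).comp (continuous_coord p.1)
  exact hF.comp h

lemma surjective_toBlocks : Function.Surjective (X.toBlocks (l := l) (n := n)) := by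
  intro z
  choose w hw using fun s => isQuotientMap_smashMk.surjective (z s)
  exact ⟨⟨fun p => w p.1 p.2⟩, congrArg KPow.mk (funext hw)⟩

lemma isQuotientMap_toBlocks : IsQuotientMap (X.toBlocks (l := l) (n := n)) := by
  refine ⟨isCoinducing_iff.2 fun s => ?_, surjective_toBlocks⟩
  refine ⟨fun h => ?_, fun h => h.preimage continuous_toBlocks⟩
  have h1 : Continuous fun z => z ∈ s := continuous_of_toBlocks (continuous_Prop.2 h)
  exact continuous_Prop.1 h1

lemma isQuotientMap_quotMap : IsQuotientMap (X.quotMap l n).1 := by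
  have h := (isQuotientMap_quotient_mk' (s := Setoid.ker ((X.smash l).word (k := n)))).comp
    (isQuotientMap_toBlocks (X := X) (l := l) (n := n))
  exact h

/-- The word represented by an element of `X^{ln}`. -/
noncomputable def blockWord (X : PtdCG.{u}) {l n : ℕ} (v : KPow (Fin n × Fin l) X) :
    (X.smash l).Word := (X.smash l).word (X.toBlocks v)

lemma quotMap_eq_iff {v v' : KPow (Fin n × Fin l) X} :
    (X.quotMap l n).1 v = (X.quotMap l n).1 v' ↔ X.blockWord v = X.blockWord v' :=
  Quotient.eq (r := Setoid.ker ((X.smash l).word (k := n)))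

lemma continuous_blockWord : Continuous (X.blockWord (l := l) (n := n)) :=
  ((X.smash l).continuous_word n).comp continuous_toBlocks

lemma eq_of_blockWord_eq (hl : 0 < l) {v v' : KPow (Fin n × Fin l) X}
    (hv : v ∉ fatWedge X (Fin n × Fin l)) (h : X.blockWord v = X.blockWord v') : v = v' := by
  have h1 : ∀ s, X.toBlocks v s ≠ (X.smash l).pt := fun s hs => by
    obtain ⟨j, hj⟩ := (smashMk_eq_pt hl).1 hs
    exact hv ⟨_, hj⟩
  have h2 := eq_of_word_eq h1 h
  refine congrArg KPow.mk (funext fun p => ?_)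
  have h3 : X.smashMk ⟨fun j => v (p.1, j)⟩ = X.smashMk ⟨fun j => v' (p.1, j)⟩ :=
    congrArg (fun c : KPow (Fin n) (X.smash l) => c p.1) h2
  rcases Quotient.exact (s := X.smashSetoid l) h3 with h | ⟨⟨j, hj⟩, -⟩
  · exact congrArg (fun c : KPow (Fin l) X => c p.2) h
  · exact (hv ⟨_, hj⟩).elim

/-- All identifications made by `q` take place inside the fat wedge; hence homotopies that are
constant there descend. -/
lemma blockWord_eq_imp (hl : 0 < l) {v v' : KPow (Fin n × Fin l) X}
    (h : X.blockWord v = X.blockWord v') : v = v' ∨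
      (v ∈ fatWedge X (Fin n × Fin l) ∧ v' ∈ fatWedge X (Fin n × Fin l)) := by
  by_contra hc
  push Not at hc
  by_cases hv : v ∈ fatWedge X (Fin n × Fin l)
  · exact hc.1 (eq_of_blockWord_eq hl (hc.2 hv) h.symm).symm
  · exact hc.1 (eq_of_blockWord_eq hl hv h)

lemma deleteBlock_self {k : ℕ} (s : Fin (k + 1)) (j : Fin l) :
    deleteBlock (l := l) s (s, j) = none := by
  simp [deleteBlock]

lemma deleteBlock_succAbove {k : ℕ} (s : Fin (k + 1)) (i : Fin k) (j : Fin l) :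
    deleteBlock (l := l) s (s.succAbove i, j) = some (i, j) := by
  rcases lt_or_ge i.castSucc s with h | h
  · rw [Fin.succAbove_of_castSucc_lt _ _ h, deleteBlock, dif_pos h]
    rfl
  · have h' : s < i.succ := Fin.lt_def.2 (Nat.lt_succ_of_le h)
    rw [Fin.succAbove_of_le_castSucc _ _ h, deleteBlock, dif_neg (not_lt.2 h'.le), dif_pos h']
    rfl

lemma blockWord_deleteBlock {k : ℕ} (s : Fin (k + 1)) (v : KPow (Fin k × Fin l) X) :
    X.blockWord ((X.coordMap (deleteBlock s)).1 v) = X.blockWord v := by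
  refine (word_succAbove _ (s := s) ?_).trans ?_
  · refine congrArg (fun w => X.smashMk (KPow.mk w)) (funext fun j => ?_)
    change (deleteBlock (l := l) s (s, j)).elim X.pt v.coord = X.pt
    rw [deleteBlock_self]
    rfl
  · refine congrArg ((X.smash l).word (k := k)) (congrArg KPow.mk (funext fun i => ?_))
    refine congrArg (fun w => X.smashMk (KPow.mk w)) (funext fun j => ?_)
    change (deleteBlock (l := l) s (s.succAbove i, j)).elim X.pt v.coord = v (i, j)
    rw [deleteBlock_succAbove]
    rfl

/-- Remove the `s`-th block of coordinates. -/
def dropBlock {k : ℕ} (s : Fin (k + 1)) (v : KPow (Fin (k + 1) × Fin l) X) :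
    KPow (Fin k × Fin l) X := ⟨fun p => v (s.succAbove p.1, p.2)⟩

lemma continuous_dropBlock {k : ℕ} (s : Fin (k + 1)) :
    Continuous (dropBlock (X := X) (l := l) s) :=
  continuous_KPow fun p => continuous_coord (s.succAbove p.1, p.2)

lemma blockWord_dropBlock (hl : 0 < l) {k : ℕ} {p : Fin (k + 1) × Fin l}
    {v : KPow (Fin (k + 1) × Fin l) X} (h : v p = X.pt) :
    X.blockWord (dropBlock p.1 v) = X.blockWord v :=
  (word_succAbove (X.toBlocks v) (s := p.1) ((smashMk_eq_pt hl).2 ⟨p.2, h⟩)).symm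

/-- Apply a function to all coordinates. -/
def mapCoord {ι : Type} (φ : X → X) (v : KPow ι X) : KPow ι X := ⟨fun i => φ (v i)⟩

/-- A pointed function on `X` induces an endomorphism of the words in the smash power. -/
lemma blockWord_mapCoord {φ : X → X} (hφ : φ X.pt = X.pt) {v v' : KPow (Fin n × Fin l) X}
    (h : X.blockWord v = X.blockWord v') :
    X.blockWord (mapCoord φ v) = X.blockWord (mapCoord φ v') := by
  let ψ : X.smash l → X.smash l := Quotient.map' (s₁ := X.smashSetoid l) (s₂ := X.smashSetoid l)
    (mapCoord φ) (by
      rintro a b (h | ⟨⟨i, hi⟩, ⟨j, hj⟩⟩)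
      · exact Or.inl (by rw [h])
      · refine Or.inr ⟨⟨i, ?_⟩, ⟨j, ?_⟩⟩
        · change φ (a i) = X.pt
          rw [hi, hφ]
        · change φ (b j) = X.pt
          rw [hj, hφ])
  have hψ : ψ (X.smash l).pt = (X.smash l).pt :=
    congrArg (fun w => X.smashMk (KPow.mk w)) (funext fun _ => hφ)
  let E : X.smash l → (X.smash l).James := fun z => (X.smash l).letter (ψ z)
  have hE : E (X.smash l).pt = 1 := by
    change (X.smash l).letter (ψ (X.smash l).pt) = 1
    rw [hψ, letter_pt]
  have key : ∀ {n : ℕ} (z : KPow (Fin n) (X.smash l)), (X.smash l).word (mapCoord ψ z) =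
      wordLift E ((X.smash l).word z) := by
    intro n z
    induction n with
    | zero =>
      rw [word_zero, word_zero]
      rfl
    | succ n ih =>
      rw [word_succ, word_succ, wordLift_letter_mul hE, ← ih]
      rfl
  have h1 : ∀ v : KPow (Fin n × Fin l) X, X.blockWord (mapCoord φ v) =
      wordLift E (X.blockWord v) := fun v => key (X.toBlocks v)
  rw [h1, h1, h]

/-- Homotopies on `X^{ln}` that are compatible with the identifications descend. -/
lemma exists_descend_homotopy {c : PMap ((X.smash l).JamesFil n) M}
    (F : KPow (Fin n × Fin l) X × unitInterval → M) (hF : Continuous F)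
    (h0 : ∀ v, F (v, 0) = c.1 ((X.quotMap l n).1 v))
    (hpt : ∀ t, F ((X.pow (Fin n × Fin l)).pt, t) = 1)
    (hw : ∀ t v v', X.blockWord v = X.blockWord v' → F (v, t) = F (v', t)) :
    ∃ c' : PMap ((X.smash l).JamesFil n) M, PMap.Homotopic c c' ∧
      ∀ v : KPow (Fin n × Fin l) X, c'.1 ((X.quotMap l n).1 v) = F (v, 1) := by
  have hq := isQuotientMap_quotMap (X := X) (l := l) (n := n)
  let G : (X.smash l).JamesFil n × unitInterval → M := fun p =>
    F (Function.surjInv hq.surjective p.1, p.2)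
  have hG : ∀ (v : KPow (Fin n × Fin l) X) t, G ((X.quotMap l n).1 v, t) = F (v, t) :=
    fun v t => hw t _ _ (quotMap_eq_iff.1 (Function.surjInv_eq hq.surjective _))
  have hGc : Continuous G := by
    refine hq.continuous_lift_prod_left ?_
    exact hF.congr fun p => (hG p.1 p.2).symm
  have hGpt : ∀ t, G (((X.smash l).JamesFil n).pt, t) = M.pt := fun t => by
    have := hG (X.pow (Fin n × Fin l)).pt t
    rw [(X.quotMap l n).2] at this
    exact this.trans ((hpt t).trans CGMonoid.pt_eq.symm)
  refine ⟨⟨⟨fun y => G (y, 1), hGc.comp (by fun_prop)⟩, hGpt 1⟩, ?_, fun v => hG v 1⟩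
  refine PMap.homotopic_of G hGc (fun y => ?_) (fun y => rfl) hGpt
  obtain ⟨v, rfl⟩ := hq.surjective y
  exact (hG v 0).trans (h0 v)

lemma exists_descend (f : PMap (X.pow (Fin n × Fin l)) M)
    (hw : ∀ v v' : KPow (Fin n × Fin l) X, X.blockWord v = X.blockWord v' → f.1 v = f.1 v') :
    ∃ c : PMap ((X.smash l).JamesFil n) M,
      ∀ v : KPow (Fin n × Fin l) X, c.1 ((X.quotMap l n).1 v) = f.1 v := by
  have hq := isQuotientMap_quotMap (X := X) (l := l) (n := n)
  have h : Function.FactorsThrough f.1 (X.quotMap l n).1 :=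
    fun v v' hv => hw v v' (quotMap_eq_iff.1 hv)
  have h1 := hq.lift_comp f.1 h
  exact ⟨⟨hq.lift f.1 h, (congrArg (hq.lift f.1 h) (X.quotMap l n).2).symm.trans
    ((DFunLike.congr_fun h1 _).trans f.2)⟩, fun v => DFunLike.congr_fun h1 v⟩

end PtdCG

/-! ### Injectivity of `q^*`. -/

namespace PtdCG

variable {X M : PtdCG.{u}} [CGMonoid M] {l n : ℕ}

namespace NDRData

variable (D : X.NDRData) {ι : Type} [Fintype ι] [DecidableEq ι]

/-- The distance of a point of `X^ι` to the fat wedge. -/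
noncomputable def wedgeDist (v : KPow ι X) : ℝ := Finset.univ.fold min 1 fun i => D.ν (v i)

lemma continuous_wedgeDist : Continuous (D.wedgeDist (ι := ι)) := by
  have : ∀ s : Finset ι, Continuous fun v : KPow ι X => s.fold min 1 fun i => D.ν (v i) := by
    intro s
    induction s using Finset.induction_on with
    | empty => exact continuous_const
    | insert i s hi ih =>
      simp only [Finset.fold_insert hi]
      exact (D.ν_continuous.comp (continuous_coord i)).min ih
  exact this _

lemma wedgeDist_le_iff {v : KPow ι X} : D.wedgeDist v ≤ 1 / 2 ↔ ∃ i, D.ν (v i) ≤ 1 / 2 := by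
  rw [wedgeDist, Finset.fold_min_le]
  norm_num

lemma wedgeDist_le_zero {v : KPow ι X} (hv : v ∈ fatWedge X ι) : D.wedgeDist v ≤ 0 := by
  obtain ⟨i, hi⟩ := hv
  rw [wedgeDist, Finset.fold_min_le]
  exact Or.inr ⟨i, Finset.mem_univ i, by rw [hi, D.ν_pt]⟩

end NDRData

lemma mapCoord_r_eq_pt (D : X.NDRData) {ι : Type} {v : KPow ι X} {i : ι} (h : D.ν (v i) ≤ 1 / 2) :
    mapCoord D.r v i = X.pt :=
  D.h_one _ (by linarith)

lemma continuous_mapCoord {ι : Type} {W : Type u} [TopologicalSpace W] [CompactlyGeneratedSpace W]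
    {φ : W → X → X} (hφ : ∀ f : W → X, Continuous f → Continuous fun s => φ s (f s))
    {v : W → KPow ι X} (hv : Continuous v) : Continuous fun s => mapCoord (φ s) (v s) :=
  continuous_KPow fun i => hφ _ ((continuous_coord i).comp hv)

lemma mapCoord_pt {ι : Type} {φ : X → X} (hφ : φ X.pt = X.pt) :
    mapCoord φ (X.pow ι).pt = (X.pow ι).pt :=
  congrArg KPow.mk (funext fun _ => hφ)

/-- The homotopy extension property of the James filtration: a map that is null homotopic on the
previous stage is homotopic to a map that is trivial there. -/
lemma exists_homotopic_trivial_on_fatWedge (D : X.NDRData) (hl : 0 < l) {k : ℕ}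
    (c : PMap ((X.smash l).JamesFil (k + 1)) M) (b : PMap ((X.smash l).JamesFil k) M)
    (hb : ∀ v : KPow (Fin (k + 1) × Fin l) X, ∀ u : KPow (Fin k × Fin l) X,
      X.blockWord u = X.blockWord v → b.1 ((X.quotMap l k).1 u) = c.1 ((X.quotMap l (k + 1)).1 v))
    (hnull : PMap.Homotopic b (PMap.const _ _)) :
    ∃ c' : PMap ((X.smash l).JamesFil (k + 1)) M, PMap.Homotopic c c' ∧
      ∀ v ∈ fatWedge X (Fin (k + 1) × Fin l), c'.1 ((X.quotMap l (k + 1)).1 v) = 1 := by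
  obtain ⟨G⟩ := hnull
  let q : KPow (Fin (k + 1) × Fin l) X → (X.smash l).JamesFil (k + 1) := (X.quotMap l (k + 1)).1
  have hq : Continuous q := (X.quotMap l (k + 1)).1.continuous
  have hcw : ∀ v v', X.blockWord v = X.blockWord v' → c.1 (q v) = c.1 (q v') :=
    fun v v' h => congrArg c.1 (quotMap_eq_iff.2 h)
  have hcpt : c.1 (q (X.pow (Fin (k + 1) × Fin l)).pt) = 1 :=
    (congrArg c.1 (X.quotMap l (k + 1)).2).trans (c.2.trans CGMonoid.pt_eq)
  have hrt : ∀ t : unitInterval, D.h (X.pt, t) = X.pt := D.h_pt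
  -- Retracting all coordinates at once is compatible with words, and afterwards a whole
  -- neighbourhood of the fat wedge is sent into it.
  obtain ⟨c₁, hc₁, hc₁'⟩ := exists_descend_homotopy (c := c)
    (fun p => c.1 (q (mapCoord (fun x => D.h (x, p.2)) p.1)))
    (by
      refine c.1.continuous.comp (hq.comp (continuous_mapCoord
        (φ := fun (p : KPow (Fin (k + 1) × Fin l) X × unitInterval) x => D.h (x, p.2))
        (fun f hf => D.h.continuous.comp (hf.prodMk continuous_snd)) continuous_fst)))
    (fun v => by
      have : mapCoord (fun x => D.h (x, 0)) v = v :=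
        congrArg KPow.mk (funext fun i => D.h_zero (v i))
      exact congrArg (fun v => c.1 (q v)) this)
    (fun t => (congrArg (fun v => c.1 (q v)) (mapCoord_pt (hrt t))).trans hcpt)
    (fun t v v' h => hcw _ _ (blockWord_mapCoord (hrt t) h))
  let R : KPow (Fin (k + 1) × Fin l) X → KPow (Fin (k + 1) × Fin l) X := mapCoord D.r
  have hR : Continuous R := continuous_mapCoord (φ := fun _ => D.r)
    (fun f hf => D.continuous_r.comp hf) continuous_id
  have hRw : ∀ v v', X.blockWord v = X.blockWord v' → X.blockWord (R v) = X.blockWord (R v') :=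
    fun v v' h => blockWord_mapCoord D.r_pt h
  have hRpt : R (X.pow (Fin (k + 1) × Fin l)).pt = (X.pow (Fin (k + 1) × Fin l)).pt :=
    mapCoord_pt D.r_pt
  classical
  -- The null homotopy on the previous stage as a function of the word; the value `1` for longer
  -- words plays no role.
  let g : (X.smash l).Word → unitInterval → M := fun w t =>
    if h : ∃ u : KPow (Fin k × Fin l) X, X.blockWord u = w then
      G (t, (X.quotMap l k).1 h.choose) else 1
  have hg : ∀ (u : KPow (Fin k × Fin l) X) t,
      g (X.blockWord u) t = G (t, (X.quotMap l k).1 u) := by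
    intro u t
    have h : ∃ u' : KPow (Fin k × Fin l) X, X.blockWord u' = X.blockWord u := ⟨u, rfl⟩
    change dite _ _ _ = _
    rw [dif_pos h]
    exact congrArg (fun y => G (t, y)) (quotMap_eq_iff.2 h.choose_spec)
  have hdrop : ∀ (p : Fin (k + 1) × Fin l) (v : KPow (Fin (k + 1) × Fin l) X) (t : unitInterval),
      v p = X.pt → g (X.blockWord v) t = G (t, (X.quotMap l k).1 (dropBlock p.1 v)) := by
    intro p v t h
    rw [← blockWord_dropBlock hl h, hg]
  have hg0 : ∀ v ∈ fatWedge X (Fin (k + 1) × Fin l), g (X.blockWord v) 0 = c.1 (q v) := by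
    rintro v ⟨p, hp⟩
    rw [hdrop p v 0 hp, G.apply_zero]
    exact hb _ _ (blockWord_dropBlock hl hp)
  have hg1 : ∀ v ∈ fatWedge X (Fin (k + 1) × Fin l), g (X.blockWord v) 1 = 1 := by
    rintro v ⟨p, hp⟩
    rw [hdrop p v 1 hp, G.apply_one]
    exact CGMonoid.pt_eq
  have hRmem : ∀ v : KPow (Fin (k + 1) × Fin l) X, D.wedgeDist v ≤ 1 / 2 →
      R v ∈ fatWedge X (Fin (k + 1) × Fin l) := fun v hv => by
    obtain ⟨p, hp⟩ := D.wedgeDist_le_iff.1 hv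
    exact ⟨p, mapCoord_r_eq_pt D hp⟩
  -- The null homotopy is applied in full within distance `1/4` of the fat wedge and fades out to
  -- time `0` at distance `1/2`.
  let F : KPow (Fin (k + 1) × Fin l) X × unitInterval → M := fun p =>
    if D.wedgeDist p.1 ≤ 1 / 2 then
      g (X.blockWord (R p.1)) (p.2 * toI (2 - 4 * D.wedgeDist p.1)) else c.1 (q (R p.1))
  have hd : Continuous fun p : KPow (Fin (k + 1) × Fin l) X × unitInterval => D.wedgeDist p.1 :=
    D.continuous_wedgeDist.comp continuous_fst
  have hF : Continuous F := by
    -- Continuity is checked on a finite closed cover. Where the coordinate `i` is near the base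
    -- point, its block can be dropped after retraction, giving an explicit formula on the previous
    -- stage.
    let S : Option (Fin (k + 1) × Fin l) → Set (KPow (Fin (k + 1) × Fin l) X × unitInterval) :=
      fun o => o.elim {p | 1 / 2 ≤ D.wedgeDist p.1} fun i => {p | D.ν (p.1 i) ≤ 1 / 2}
    refine (locallyFinite_of_finite S).continuous ?_ ?_ ?_
    · refine Set.eq_univ_of_forall fun p => Set.mem_iUnion.2 ?_
      rcases le_total (1 / 2) (D.wedgeDist p.1) with h | h
      · exact ⟨none, h⟩
      · obtain ⟨i, hi⟩ := D.wedgeDist_le_iff.1 h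
        exact ⟨some i, hi⟩
    · rintro (_ | i)
      · exact isClosed_le continuous_const hd
      · exact isClosed_le (D.ν_continuous.comp ((continuous_coord i).comp continuous_fst))
          continuous_const
    · rintro (_ | i)
      · refine (c.1.continuous.comp (hq.comp (hR.comp continuous_fst))).continuousOn.congr ?_
        intro p hp
        change ite _ _ _ = c.1 (q (R p.1))
        split_ifs with h
        · rw [le_antisymm h hp, toI_of_nonpos (by norm_num), mul_zero]
          exact hg0 _ (hRmem _ h)
        · rfl
      · have hc : Continuous fun p : KPow (Fin (k + 1) × Fin l) X × unitInterval =>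
            G (p.2 * toI (2 - 4 * D.wedgeDist p.1),
              (X.quotMap l k).1 (dropBlock i.1 (R p.1))) := by
          refine G.continuous.comp (Continuous.prodMk (by fun_prop) ?_)
          exact (X.quotMap l k).1.continuous.comp
            ((continuous_dropBlock i.1).comp (hR.comp continuous_fst))
        refine hc.continuousOn.congr fun p hp => ?_
        change ite _ _ _ = _
        rw [if_pos (D.wedgeDist_le_iff.2 ⟨i, hp⟩)]
        exact hdrop i _ _ (mapCoord_r_eq_pt D hp)
  have hFw : ∀ t, ∀ v ∈ fatWedge X (Fin (k + 1) × Fin l), F (v, t) = g (X.blockWord (R v)) t := by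
    intro t v hv
    have h0 := D.wedgeDist_le_zero hv
    change ite _ _ _ = _
    rw [if_pos (h0.trans (by norm_num)), toI_of_one_le (by linarith), mul_one]
  have hRfat : ∀ v ∈ fatWedge X (Fin (k + 1) × Fin l), R v ∈ fatWedge X (Fin (k + 1) × Fin l) :=
    fun v hv => hRmem v ((D.wedgeDist_le_zero hv).trans (by norm_num))
  have hptmem : (X.pow (Fin (k + 1) × Fin l)).pt ∈ fatWedge X (Fin (k + 1) × Fin l) :=
    ⟨(0, ⟨0, hl⟩), rfl⟩
  obtain ⟨c₂, hc₂, hc₂'⟩ := exists_descend_homotopy (c := c₁) F hF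
    (fun v => by
      rw [hc₁']
      change ite _ _ _ = c.1 (q (R v))
      split_ifs with h
      · rw [zero_mul]
        exact hg0 _ (hRmem _ h)
      · rfl)
    (fun t => by
      rw [hFw t _ hptmem, hRpt]
      refine (hdrop (0, ⟨0, hl⟩) _ t rfl).trans ?_
      have h1 : (X.quotMap l k).1 (dropBlock 0 (X.pow (Fin (k + 1) × Fin l)).pt) =
        ((X.smash l).JamesFil k).pt := (X.quotMap l k).2
      exact (congrArg (fun y => G (t, y)) h1).trans
        ((G.eq_fst t rfl).trans (b.2.trans CGMonoid.pt_eq)))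
    (fun t v v' h => by
      rcases blockWord_eq_imp hl h with h1 | ⟨h1, h2⟩
      · rw [h1]
      · rw [hFw t v h1, hFw t v' h2, hRw v v' h])
  refine ⟨c₂, ContinuousMap.HomotopicRel.trans hc₁ hc₂, fun v hv => ?_⟩
  rw [hc₂', hFw 1 v hv]
  exact hg1 _ (hRfat v hv)

/-- A map out of a stage of the James filtration is null homotopic if its composite with the
quotient map from `X^{ln}` is null homotopic. -/
lemma homotopic_const_of_quotMap (D : X.NDRData) (I : HInverse M) (hl : 0 < l)
    (c : PMap ((X.smash l).JamesFil n) M)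
    (hc : PMap.Homotopic (c.comp (X.quotMap l n)) (PMap.const _ _)) :
    PMap.Homotopic c (PMap.const _ _) := by
  induction n with
  | zero =>
    have h : c = PMap.const _ _ := by
      refine Subtype.ext (ContinuousMap.ext fun y => ?_)
      obtain ⟨z, rfl⟩ := Quotient.exists_rep y
      refine Eq.trans (congrArg c.1 ?_) c.2
      exact congrArg (Quotient.mk _) (congrArg KPow.mk (funext fun i => i.elim0))
    rw [h]
    exact ContinuousMap.HomotopicRel.refl _
  | succ k ih =>
    -- Filling the last block with base points restricts `c` to the previous stage, where the
    -- induction hypothesis applies.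
    let f : PMap (X.pow (Fin k × Fin l)) M :=
      (c.comp (X.quotMap l (k + 1))).comp (X.coordMap (deleteBlock (Fin.last k)))
    have hf : ∀ v v', X.blockWord v = X.blockWord v' → f.1 v = f.1 v' := fun v v' h =>
      congrArg c.1 (quotMap_eq_iff.2
        (by rw [blockWord_deleteBlock (Fin.last k) v, blockWord_deleteBlock (Fin.last k) v', h]))
    obtain ⟨b, hb⟩ := exists_descend f hf
    have hbf : b.comp (X.quotMap l k) = f := Subtype.ext (ContinuousMap.ext hb)
    have hnull : PMap.Homotopic b (PMap.const _ _) := by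
      refine ih b ?_
      rw [hbf]
      have h1 : (⟦c.comp (X.quotMap l (k + 1))⟧ : HClass (X.pow (Fin (k + 1) × Fin l)) M) = 1 :=
        Quotient.sound hc
      have h2 := congrArg (pullback M (X.coordMap (deleteBlock (l := l) (Fin.last k)))) h1
      rw [map_one] at h2
      exact Quotient.exact h2
    obtain ⟨c', hcc', hc'⟩ := exists_homotopic_trivial_on_fatWedge D hl c b
      (fun v u h => (hb u).trans (congrArg c.1 (quotMap_eq_iff.2
        ((blockWord_deleteBlock (Fin.last k) u).trans h)))) hnull
    have h1 : (⟦c'.comp (X.quotMap l (k + 1))⟧ : HClass (X.pow (Fin (k + 1) × Fin l)) M) = 1 := by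
      have e : (⟦c⟧ : HClass ((X.smash l).JamesFil (k + 1)) M) = ⟦c'⟧ := Quotient.sound hcc'
      exact (congrArg (pullback M (X.quotMap l (k + 1))) e).symm.trans (Quotient.sound hc)
    -- A null homotopy relative to the fat wedge respects the identifications and so descends.
    obtain ⟨H⟩ := homotopicRel_fatWedge_of_null D I (α := c'.comp (X.quotMap l (k + 1))) hc'
      (Quotient.exact h1)
    have hptmem : (X.pow (Fin (k + 1) × Fin l)).pt ∈ fatWedge X (Fin (k + 1) × Fin l) :=
      ⟨(0, ⟨0, hl⟩), rfl⟩
    have hH : ∀ t, ∀ v ∈ fatWedge X (Fin (k + 1) × Fin l), H (t, v) = 1 := fun t v hv =>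
      (H.eq_fst t hv).trans (hc' v hv)
    obtain ⟨c₂, hc₂, hc₂'⟩ := exists_descend_homotopy (c := c') (fun p => H (p.2, p.1))
      (H.continuous.comp continuous_swap) (fun v => H.apply_zero v)
      (fun t => hH t _ hptmem)
      (fun t v v' h => by
        rcases blockWord_eq_imp hl h with h1 | ⟨h1, h2⟩
        · rw [h1]
        · exact (hH t v h1).trans (hH t v' h2).symm)
    have h3 : c₂ = PMap.const _ _ := by
      refine Subtype.ext (ContinuousMap.ext fun y => ?_)
      obtain ⟨v, rfl⟩ := isQuotientMap_quotMap.surjective y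
      exact (hc₂' v).trans ((H.apply_one v).trans CGMonoid.pt_eq.symm)
    rw [h3] at hc₂
    exact ContinuousMap.HomotopicRel.trans hcc' hc₂

lemma injective_pullback_quotMap (D : X.NDRData) (I : HInverse M) (hl : 0 < l) :
    Function.Injective (pullback M (X.quotMap l n)) := by
  intro a b h
  obtain ⟨u, rfl⟩ := I.isUnit b
  have h1 : pullback M (X.quotMap l n) (a * (u⁻¹ : (HClass ((X.smash l).JamesFil n) M)ˣ).val) =
      1 := by
    rw [map_mul, h, ← map_mul, Units.mul_inv, map_one]
  have key : ∀ d : HClass ((X.smash l).JamesFil n) M, pullback M (X.quotMap l n) d = 1 → d = 1 := by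
    rintro ⟨d⟩ hd
    exact Quotient.sound (homotopic_const_of_quotMap D I hl d (Quotient.exact hd))
  have h2 := key _ h1
  rwa [Units.mul_inv_eq_one] at h2

end PtdCG

/-! ### Lifting classes through `q^*`. -/

namespace PtdCG

variable {X Z M : PtdCG.{u}} [CGMonoid M] {l n : ℕ}

section Hat

/-- The product of the values of `Γ` on the subwords of length `m`. -/
def subwordProd (m : ℕ) (Γ : List Z → M) (w : Z.Word) : M :=
  ((((FreeMonoid.toList (α := {x : Z // x ≠ Z.pt}) w).map Subtype.val).sublistsLen m).map Γ).prod

lemma subwordProd_zero (Γ : List Z → M) (w : Z.Word) : subwordProd 0 Γ w = Γ [] := by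
  simp [subwordProd]

lemma subwordProd_of_lt {m : ℕ} (Γ : List Z → M) {w : Z.Word} (h : wordSize w < m) :
    subwordProd m Γ w = 1 := by
  rw [subwordProd, List.sublistsLen_of_length_lt (by rwa [List.length_map])]
  rfl

lemma subwordProd_succ_one (m : ℕ) (Γ : List Z → M) : subwordProd (m + 1) Γ (1 : Z.Word) = 1 :=
  subwordProd_of_lt Γ (Nat.succ_pos m)

/-- Subwords either omit the first letter or begin with it; those beginning with a base point
contribute `1`. The formula thus holds for unreduced words, which yields continuity. -/
lemma subwordProd_letter_mul {m : ℕ} {Γ : List Z → M} (hΓ : ∀ L, Z.pt ∈ L → Γ L = 1) (x : Z)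
    (w : Z.Word) : subwordProd (m + 1) Γ (Z.letter x * w) =
      subwordProd (m + 1) Γ w * subwordProd m (fun L => Γ (x :: L)) w := by
  by_cases hx : x = Z.pt
  · subst hx
    have h : subwordProd m (fun L => Γ (Z.pt :: L)) w = 1 := by
      refine List.prod_eq_one fun a ha => ?_
      obtain ⟨L, -, rfl⟩ := List.mem_map.1 ha
      exact hΓ _ (by simp)
    rw [h, mul_one, letter_pt, one_mul]
  · have h : ((FreeMonoid.toList (α := {x : Z // x ≠ Z.pt}) (Z.letter x * w)).map Subtype.val) =
        x :: (FreeMonoid.toList (α := {x : Z // x ≠ Z.pt}) w).map Subtype.val := by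
      rw [letter_of_ne Z hx]
      rfl
    rw [subwordProd, h, List.sublistsLen_succ_cons, List.map_append, List.prod_append,
      List.map_map]
    rfl

lemma continuous_subwordProd_word {k m : ℕ} {W : Type u} [TopologicalSpace W]
    [CompactlyGeneratedSpace W] {Γ : W → List Z → M} (hΓ : ∀ s L, Z.pt ∈ L → Γ s L = 1)
    (hc : ∀ f : W → KPow (Fin m) Z, Continuous f → Continuous fun s => Γ s (List.ofFn (f s).coord))
    {v : W → KPow (Fin k) Z} (hv : Continuous v) :
    Continuous fun s => subwordProd m (Γ s) (Z.word (v s)) := by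
  induction k generalizing m Γ with
  | zero =>
    simp only [word_zero]
    cases m with
    | zero =>
      simp only [subwordProd_zero]
      exact hc (fun _ => ⟨Fin.elim0⟩) continuous_const
    | succ m =>
      simp only [subwordProd_succ_one]
      exact continuous_const
  | succ k ih =>
    have ht : Continuous fun s => (⟨fun i => v s i.succ⟩ : KPow (Fin k) Z) :=
      continuous_KPow fun i => (continuous_coord i.succ).comp hv
    cases m with
    | zero =>
      simp only [subwordProd_zero]
      exact hc (fun _ => ⟨Fin.elim0⟩) continuous_const
    | succ m =>
      simp only [word_succ, subwordProd_letter_mul (hΓ _)]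
      refine CGMonoid.continuous_mul (ih hΓ hc ht)
        (ih (fun s L hL => hΓ s _ (List.mem_cons_of_mem _ hL)) (fun f hf => ?_) ht)
      have h1 : Continuous fun s =>
          (⟨Fin.cons (v s 0) (f s).coord⟩ : KPow (Fin (m + 1)) Z) := by
        refine continuous_KPow fun i => ?_
        refine Fin.cases ?_ (fun i => ?_) i
        · exact ((continuous_coord 0).comp hv : Continuous fun s => v s 0)
        · exact ((continuous_coord i).comp hf : Continuous fun s => f s i)
      refine (hc _ h1).congr fun s => ?_
      simp [List.ofFn_succ]

lemma subwordProd_word {m : ℕ} {Γ : List Z → M} (hΓ : ∀ L, Z.pt ∈ L → Γ L = 1)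
    (z : KPow (Fin m) Z) : subwordProd m Γ (Z.word z) = Γ (List.ofFn z.coord) := by
  induction m generalizing Γ with
  | zero => simp [subwordProd_zero]
  | succ m ih =>
    rw [word_succ, subwordProd_letter_mul hΓ, ih (fun L hL => hΓ _ (List.mem_cons_of_mem _ hL)),
      subwordProd_of_lt _ (Nat.lt_succ_of_le (wordSize_word_le _)), one_mul, List.ofFn_succ]

/-- A map on `Z^{k+1}` that is trivial on the fat wedge extends to `J(Z)`. -/
lemma exists_extend_word {k : ℕ} {γ : KPow (Fin (k + 1)) Z → M} (hγ : Continuous γ)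
    (h1 : ∀ z ∈ fatWedge Z (Fin (k + 1)), γ z = 1) :
    ∃ f : PMap Z.James M, ∀ z : KPow (Fin (k + 1)) Z, f.1 (Z.word z) = γ z := by
  classical
  -- The default of `getD` is never used on lists of length `k + 1`.
  let Γ : List Z → M := fun L => if Z.pt ∈ L then 1 else γ ⟨fun i => L.getD i Z.pt⟩
  have hΓ : ∀ L, Z.pt ∈ L → Γ L = 1 := fun L hL => if_pos hL
  have hΓγ : ∀ z : KPow (Fin (k + 1)) Z, Γ (List.ofFn z.coord) = γ z := by
    intro z
    change ite _ _ _ = _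
    split_ifs with h
    · obtain ⟨i, hi⟩ := (List.mem_ofFn' _ _).1 h
      exact (h1 z ⟨i, hi⟩).symm
    · refine congrArg γ (congrArg KPow.mk (funext fun i => ?_))
      rw [List.getD_eq_getElem _ _ (by rw [List.length_ofFn]; exact i.2), List.getElem_ofFn]
  refine ⟨⟨⟨subwordProd (k + 1) Γ, continuous_from_word fun m => ?_⟩, ?_⟩, fun z => ?_⟩
  · refine continuous_subwordProd_word (Γ := fun _ => Γ) (fun _ => hΓ) (fun f hf => ?_)
      continuous_id
    simp only [hΓγ]
    exact hγ.comp hf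
  · exact (subwordProd_succ_one k Γ).trans CGMonoid.pt_eq.symm
  · exact (subwordProd_word hΓ z).trans (hΓγ z)

end Hat

/-- The pointed map `X^{ln} → J(X^{(l)})`. -/
noncomputable def blockWordP (X : PtdCG.{u}) (l n : ℕ) :
    PMap (X.pow (Fin n × Fin l)) (X.smash l).James :=
  ⟨⟨X.blockWord, continuous_blockWord⟩, by
    refine List.prod_eq_one fun a ha => ?_
    obtain ⟨i, rfl⟩ := (List.mem_ofFn' _ _).1 ha
    exact (X.smash l).letter_pt⟩

/-- A map on `X^{l(k+1)}` that is trivial on the fat wedge extends to `J(X^{(l)})`. -/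
lemma exists_extend_blockWord (hl : 0 < l) {k : ℕ} {γ : PMap (X.pow (Fin (k + 1) × Fin l)) M}
    (hγ : ∀ v ∈ fatWedge X (Fin (k + 1) × Fin l), γ.1 v = 1) :
    ∃ f : PMap (X.smash l).James M, f.comp (X.blockWordP l (k + 1)) = γ := by
  let γ' : KPow (Fin (k + 1)) (X.smash l) → M :=
    fun z => γ.1 (Function.surjInv surjective_toBlocks z)
  have h : ∀ v : KPow (Fin (k + 1) × Fin l) X, γ' (X.toBlocks v) = γ.1 v := by
    intro v
    have h1 := Function.surjInv_eq (surjective_toBlocks (X := X) (l := l)) (X.toBlocks v)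
    rcases blockWord_eq_imp hl (congrArg ((X.smash l).word (k := k + 1)) h1) with h2 | ⟨h2, h3⟩
    · exact congrArg γ.1 h2
    · exact (hγ _ h2).trans (hγ _ h3).symm
  obtain ⟨f, hf⟩ := exists_extend_word (γ := γ')
    (continuous_of_toBlocks (γ.1.continuous.congr fun v => (h v).symm)) (by
      rintro z ⟨i, hi⟩
      obtain ⟨v, rfl⟩ := surjective_toBlocks z
      obtain ⟨j, hj⟩ := (smashMk_eq_pt hl).1 hi
      exact (h v).trans (hγ v ⟨(i, j), hj⟩))
  exact ⟨f, Subtype.ext (ContinuousMap.ext fun v => (hf _).trans (h v))⟩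

lemma pullback_pullback {Y Y' Y'' : PtdCG.{u}} (g : PMap Y' Y) (g' : PMap Y'' Y') (a : HClass Y M) :
    pullback M g' (pullback M g a) = pullback M (g.comp g') a := by
  obtain ⟨f, rfl⟩ := Quotient.exists_rep a
  rfl

lemma coordPullback_coordPullback {ι κ μ : Type} (φ : ι → Option κ) (ψ : κ → Option μ)
    (a : HClass (X.pow ι) X.James) :
    X.coordPullback ψ (X.coordPullback φ a) = X.coordPullback (fun i => (φ i).bind ψ) a := by
  refine (pullback_pullback _ _ a).trans ?_
  refine congrArg (fun g => pullback X.James g a) (Subtype.ext (ContinuousMap.ext fun v => ?_))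
  refine congrArg KPow.mk (funext fun i => ?_)
  change (φ i).elim X.pt (fun j => (ψ j).elim X.pt (KPow.coord v)) =
    ((φ i).bind ψ).elim X.pt (KPow.coord v)
  cases φ i <;> rfl

section Index

variable {k : ℕ}

lemma deleteBlock_last_castSucc (i : Fin k) (j : Fin l) :
    deleteBlock (Fin.last k) (i.castSucc, j) = some (i, j) := by
  rw [deleteBlock, dif_pos (Fin.castSucc_lt_last i)]
  rfl

/-- What `B` contains in the last block is irrelevant, as that block is deleted in any case. -/
lemma bind_deleteBlock_last_kill (A : Set (Fin k × Fin l)) (B : Set (Fin (k + 1) × Fin l))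
    (h : ∀ i j, (i.castSucc, j) ∈ B ↔ (i, j) ∈ A) :
    (fun p => (deleteBlock (Fin.last k) p).bind (killIdx A)) =
      fun p => (killIdx B p).bind (deleteBlock (Fin.last k)) := by
  funext ⟨i, j⟩
  induction i using Fin.lastCases with
  | last =>
    rw [deleteBlock_self]
    unfold killIdx
    split_ifs
    · rfl
    · exact (deleteBlock_self _ _).symm
  | cast i =>
    rw [deleteBlock_last_castSucc]
    change killIdx A (i, j) = _
    unfold killIdx
    by_cases hA : (i, j) ∈ A
    · rw [if_pos hA, if_pos ((h i j).2 hA)]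
      rfl
    · rw [if_neg hA, if_neg (mt (h i j).1 hA)]
      exact (deleteBlock_last_castSucc i j).symm

/-- The simplicial identity for faces; it passes condition (b) on to the restriction. -/
lemma bind_deleteBlock_last (s : Fin (k + 1)) :
    (fun p => (deleteBlock (l := l) (Fin.last (k + 1)) p).bind (deleteBlock s)) =
      fun p => (deleteBlock (l := l) s.castSucc p).bind (deleteBlock (Fin.last k)) := by
  funext ⟨i, j⟩
  induction i using Fin.lastCases with
  | last =>
    have h : deleteBlock (l := l) s.castSucc (Fin.last (k + 1), j) = some (Fin.last k, j) := by
      have := deleteBlock_succAbove (l := l) s.castSucc (Fin.last k) j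
      rwa [Fin.succAbove_castSucc_of_le _ _ (Fin.le_last s), Fin.succ_last] at this
    change _ = (deleteBlock (l := l) s.castSucc (Fin.last (k + 1), j)).bind _
    rw [h, deleteBlock_self]
    exact (deleteBlock_self _ _).symm
  | cast i =>
    rw [deleteBlock_last_castSucc]
    rcases Fin.eq_self_or_eq_succAbove s i with rfl | ⟨i, rfl⟩
    · rw [deleteBlock_self]
      exact deleteBlock_self _ _
    · have h := deleteBlock_succAbove (l := l) s.castSucc i.castSucc j
      rw [Fin.castSucc_succAbove_castSucc] at h
      rw [h]
      exact (deleteBlock_succAbove s i j).trans (deleteBlock_last_castSucc i j).symm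

/-- Killing a block factors through deleting it, so a class with trivial `D_s` vanishes when the
block is killed. -/
lemma killIdx_block (s : Fin (k + 1)) : killIdx (block (l := l) s) =
    fun p => (deleteBlock s p).bind fun q => some (s.succAbove q.1, q.2) := by
  funext ⟨i, j⟩
  unfold killIdx block
  rcases Fin.eq_self_or_eq_succAbove s i with rfl | ⟨i, rfl⟩
  · rw [deleteBlock_self, if_pos (by rfl)]
    rfl
  · rw [deleteBlock_succAbove, if_neg (show (s.succAbove i, j) ∉ _ from Fin.succAbove_ne s i)]
    rfl

end Index

/-- A single base point coordinate already collapses its block in the smash power. -/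
lemma toBlocks_kill (hl : 0 < l) (s : Fin n) (j : Fin l) (v : KPow (Fin n × Fin l) X) :
    X.toBlocks ((X.coordMap (killIdx {(s, j)})).1 v) =
      X.toBlocks ((X.coordMap (killIdx (block s))).1 v) := by
  refine congrArg KPow.mk (funext fun t => ?_)
  by_cases h : t = s
  · subst h
    have h1 : ∀ A : Set (Fin n × Fin l), (t, j) ∈ A → X.smashMk ⟨fun i =>
        (killIdx A (t, i)).elim X.pt v.coord⟩ = (X.smash l).pt := fun A hA => by
      refine (smashMk_eq_pt hl).2 ⟨j, ?_⟩
      change (killIdx A (t, j)).elim X.pt v.coord = X.pt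
      rw [killIdx, if_pos hA]
      rfl
    exact (h1 {(t, j)} rfl).trans (h1 (block t) rfl).symm
  · have h1 : ∀ A : Set (Fin n × Fin l), (∀ i, (t, i) ∉ A) → (⟨fun i =>
        (killIdx A (t, i)).elim X.pt v.coord⟩ : KPow (Fin l) X) = ⟨fun i => v (t, i)⟩ :=
      fun A hA => by
      refine congrArg KPow.mk (funext fun i => ?_)
      rw [killIdx, if_neg (hA i)]
      rfl
    refine congrArg X.smashMk ((h1 _ fun i hi => h ?_).trans (h1 _ fun i hi => h hi).symm)
    exact congrArg Prod.fst hi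

lemma coordPullback_kill_blockWordP (hl : 0 < l) (s : Fin n) (j : Fin l)
    (b : HClass (X.smash l).James X.James) :
    X.coordPullback (killIdx {(s, j)}) (pullback X.James (X.blockWordP l n) b) =
      X.coordPullback (killIdx (block s)) (pullback X.James (X.blockWordP l n) b) := by
  refine (pullback_pullback _ _ b).trans (Eq.trans ?_ (pullback_pullback _ _ b).symm)
  refine congrArg (fun g => pullback X.James g b) (Subtype.ext (ContinuousMap.ext fun v => ?_))
  exact congrArg ((X.smash l).word (k := n)) (toBlocks_kill hl s j v)

lemma coordPullback_deleteBlock_blockWordP {k : ℕ} (s : Fin (k + 1))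
    (b : HClass (X.smash l).James X.James) :
    X.coordPullback (deleteBlock s) (pullback X.James (X.blockWordP l (k + 1)) b) =
      pullback X.James (X.blockWordP l k) b := by
  refine (pullback_pullback _ _ b).trans ?_
  refine congrArg (fun g => pullback X.James g b) (Subtype.ext (ContinuousMap.ext fun v => ?_))
  exact blockWord_deleteBlock s v

/-- Classes that satisfy the compatibility conditions come from `J(X^{(l)})`. -/
lemma exists_pullback_blockWordP (D : X.NDRData) (I : HInverse X.James) (hl : 0 < l)
    (α : HClass (X.pow (Fin n × Fin l)) X.James)
    (ha : ∀ s j, X.coordPullback (killIdx {(s, j)}) α = X.coordPullback (killIdx (block s)) α)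
    (hb : ∀ s t, X.coordPullback (deleteBlock s) α = X.coordPullback (deleteBlock t) α) :
    ∃ β, pullback X.James (X.blockWordP l n) β = α := by
  induction n with
  | zero =>
    obtain ⟨f, rfl⟩ := Quotient.exists_rep α
    refine ⟨1, (map_one _).trans (congrArg (Quotient.mk _) ?_)⟩
    refine Subtype.ext (ContinuousMap.ext fun v => ?_)
    refine f.2.symm.trans (congrArg f.1 ?_)
    exact congrArg KPow.mk (funext fun p => p.1.elim0)
  | succ k ih =>
    let α' : HClass (X.pow (Fin k × Fin l)) X.James := X.coordPullback (deleteBlock (Fin.last k)) α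
    have hα' : ∀ s : Fin (k + 1), X.coordPullback (deleteBlock s) α = α' := fun s => hb s _
    have e1 : ∀ (A : Set (Fin k × Fin l)) (B : Set (Fin (k + 1) × Fin l)),
        (∀ i j, (i.castSucc, j) ∈ B ↔ (i, j) ∈ A) → X.coordPullback (killIdx A) α' =
          X.coordPullback (deleteBlock (Fin.last k)) (X.coordPullback (killIdx B) α) := by
      intro A B h
      refine (coordPullback_coordPullback _ _ α).trans ?_
      rw [coordPullback_coordPullback]
      exact congrArg (fun φ => X.coordPullback φ α) (bind_deleteBlock_last_kill A B h)
    obtain ⟨β', hβ'⟩ := ih α' (fun s j => by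
        rw [e1 {(s, j)} {(s.castSucc, j)} (by simp), e1 (block s) (block s.castSucc)
          (by simp [block]), ha]) (by
      obtain ⟨a, e2⟩ : ∃ a, ∀ s : Fin k, X.coordPullback (deleteBlock s) α' = a := by
        cases k with
        | zero => exact ⟨1, fun s => s.elim0⟩
        | succ k =>
          refine ⟨X.coordPullback (deleteBlock (Fin.last k)) α', fun s => ?_⟩
          refine (coordPullback_coordPullback _ _ α).trans ?_
          refine (congrArg (fun φ => X.coordPullback φ α) (bind_deleteBlock_last s)).trans ?_
          refine (coordPullback_coordPullback _ _ α).symm.trans ?_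
          exact congrArg _ (hα' _)
      exact fun s t => (e2 s).trans (e2 t).symm)
    obtain ⟨u, rfl⟩ := I.isUnit β'
    let W := pullback X.James (X.blockWordP l (k + 1))
    -- The common restriction comes from `β'` on all of `J(X^{(l)})`. Dividing by its pullback gives
    -- a class with all `D_s` trivial, hence by (a) trivial on every coordinate hyperplane, so it
    -- has a representative that extends over words.
    let α₁ := α * W (u⁻¹ : (HClass (X.smash l).James X.James)ˣ).val
    have hd : ∀ s : Fin (k + 1), X.coordPullback (deleteBlock s) α₁ = 1 := by
      intro s
      refine (map_mul _ _ _).trans ?_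
      rw [coordPullback_deleteBlock_blockWordP, hα', ← hβ', ← map_mul, Units.mul_inv, map_one]
    have hk : ∀ p : Fin (k + 1) × Fin l,
        pullback X.James (X.coordMap (killIdx {p})) α₁ = 1 := by
      rintro ⟨s, j⟩
      have h1 : X.coordPullback (killIdx {(s, j)}) α₁ = X.coordPullback (killIdx (block s)) α₁ := by
        refine (map_mul _ _ _).trans (Eq.trans ?_ (map_mul _ _ _).symm)
        rw [ha, coordPullback_kill_blockWordP hl]
      refine h1.trans ?_
      rw [killIdx_block]
      refine (coordPullback_coordPullback _ _ α₁).symm.trans ?_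
      rw [hd]
      exact map_one _
    obtain ⟨γ, hγ, hγ1⟩ := exists_rep_fatWedge D I hk
    obtain ⟨f, hf⟩ := exists_extend_blockWord hl hγ1
    refine ⟨⟦f⟧ * u.val, ?_⟩
    rw [map_mul, pullback_mk, hf, hγ]
    change α * W _ * W _ = α
    rw [mul_assoc, ← map_mul, Units.inv_mul, map_one, mul_one]

/-- The inclusion `J_n(Z) → J(Z)`. -/
noncomputable def jamesFilIncl (Z : PtdCG.{u}) (n : ℕ) : PMap (Z.JamesFil n) Z.James :=
  ⟨⟨Quotient.lift (s := Setoid.ker (Z.word (k := n))) Z.word fun _ _ h => h,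
    (Z.continuous_word n).quotient_lift _⟩, by
    refine List.prod_eq_one fun a ha => ?_
    obtain ⟨i, rfl⟩ := (List.mem_ofFn' _ _).1 ha
    exact Z.letter_pt⟩

lemma exists_quotPullback (D : X.NDRData) (I : HInverse X.James) (hl : 0 < l)
    (α : HClass (X.pow (Fin n × Fin l)) X.James)
    (ha : ∀ s j, X.coordPullback (killIdx {(s, j)}) α = X.coordPullback (killIdx (block s)) α)
    (hb : ∀ s t, X.coordPullback (deleteBlock s) α = X.coordPullback (deleteBlock t) α) :
    ∃ β, X.quotPullback l n β = α := by
  obtain ⟨β, rfl⟩ := exists_pullback_blockWordP D I hl α ha hb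
  exact ⟨pullback X.James ((X.smash l).jamesFilIncl n) β, pullback_pullback _ _ β⟩

end PtdCG

/-! ### Assembly of the two homomorphisms. -/

theorem proposition2p11 (X : PtdCG.{u}) [PathConnectedSpace X] (hX : X.Nondegenerate)
    (hcat : X.WeakCatLtTwo) (l n : ℕ) (hl : 0 < l) (hn : 0 < n) :
    (∀ a : PtdCG.HClass (X.pow (Fin n × Fin l)) X.James, IsUnit a) ∧
    (∀ b : PtdCG.HClass ((X.smash l).JamesFil n) X.James, IsUnit b) ∧
    ∃ (eK : Cohen.K (Fin n × Fin l) →* PtdCG.HClass (X.pow (Fin n × Fin l)) X.James)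
      (eH : Cohen.H l n →* X.HGeo l n),
      (∀ i, eK (Cohen.K.x i) = X.xClass i) ∧
      (∀ h : Cohen.H l n, X.quotPullback l n (eH h) = eK h) ∧
      (∀ h : Cohen.H l n, (∀ i, Cohen.K.map (killIdx {i}) (h : Cohen.K (Fin n × Fin l)) = 1) →
        ∀ i, X.coordPullback (killIdx {i}) (X.quotPullback l n (eH h)) = 1) := by
  obtain ⟨I⟩ := PtdCG.exists_hInverse hX hcat
  obtain ⟨D⟩ := hX.exists_data
  let eK : Cohen.K (Fin n × Fin l) →* PtdCG.HClass (X.pow (Fin n × Fin l)) X.James :=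
    PtdCG.cohenHom I D hcat
  have hK : ∀ {κ : Type} [DecidableEq κ] (φ : Fin n × Fin l → Option κ) α,
      X.coordPullback φ (eK α) = PtdCG.cohenHom I D hcat (Cohen.K.map φ α) :=
    fun φ α => PtdCG.coordPullback_cohenHom I D hcat φ α
  have ha : ∀ (h : Cohen.H l n) s j, X.coordPullback (killIdx {(s, j)}) (eK h) =
      X.coordPullback (killIdx (block s)) (eK h) := fun h s j => by rw [hK, hK, h.2.1]
  have hb : ∀ (h : Cohen.H l n) s t, X.coordPullback (deleteBlock s) (eK h) =
      X.coordPullback (deleteBlock t) (eK h) := fun h s t => by rw [hK, hK, h.2.2 s t]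
  choose β hβ using fun h : Cohen.H l n =>
    PtdCG.exists_quotPullback D I hl (eK h) (ha h) (hb h)
  have hinj : Function.Injective (X.quotPullback l n) := PtdCG.injective_pullback_quotMap D I hl
  -- The lifts are chosen one by one; injectivity of `q^*` makes the choice multiplicative.
  let eH : Cohen.H l n →* X.HGeo l n :=
    { toFun := fun h => ⟨β h, by
        rw [hβ]
        exact PtdCG.cohenHom_mem_KGeo I D hcat h.1, by
        rw [hβ]
        exact ha h, by
        rw [hβ]
        exact hb h⟩
      map_one' := Subtype.ext (hinj (by
        change X.quotPullback l n (β 1) = X.quotPullback l n 1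
        rw [hβ, map_one]
        exact map_one eK))
      map_mul' := fun g h => Subtype.ext (hinj (by
        change X.quotPullback l n (β (g * h)) = X.quotPullback l n (β g * β h)
        rw [hβ, map_mul, hβ, hβ]
        exact map_mul eK _ _)) }
  refine ⟨fun a => I.isUnit a, fun b => I.isUnit b, eK, eH, PtdCG.cohenHom_x I D hcat, hβ,
    fun h hh i => ?_⟩
  change X.coordPullback (killIdx {i}) (X.quotPullback l n (β h)) = 1
  rw [hβ, hK, hh, map_one]
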